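/- Setting. Let $d\ge 1$, let $|\cdot|$ be the Euclidean norm, and let $\mathcal P_1(\mathbf R^n)$ be the set of Borel probability measures on $\mathbf R^n$ with finite first moment. Let $K:\mathbf R^d\times\mathbf R^d\to\mathbf R^d$ satisfy $K(z,z')+K(z',z)=0$ and be Lipschitz continuous with constant $L$ in each of its two variables, uniformly in the other. For $N\ge 1$ let $T^N_t$ ($t\in\mathbf R$) be the flow on $(\mathbf R^d)^N$ of the system $\dot z_k=\frac1N\sum_{l=1}^N K(z_k,z_l)$, $k=1,\dots,N$, and for $Z_N=(z_1,\dots,z_N)$ let $\mu_{Z_N}=\frac1N\sum_{k=1}^N\delta_{z_k}$. For a symmetric (permutation invariant) $P_N^{in}\in\mathcal P_1((\mathbf R^d)^N)$ let $P_N(t)=T^N_t\#P_N^{in}$, let $P_{N:m}(t)$ be the image of $P_N(t)$ under $(z_1,\dots,z_N)\mapsto(z_1,\dots,z_m)$ for $1\le m\le N$, and let $P_{N:m}(t)=0$ for $m>N$. Let $\mathscr L^d$ be Lebesgue measure and let $\mathrm{dist}_{MK,1}(\mu,\nu)=\inf_\pi\iint|x-y|\,\pi(dx\,dy)$, the infimum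 running over all couplings $\pi$ of $\mu$ and $\nu$. For a probability density $f^{in}$ on $\mathbf R^d$ with $\int|z|f^{in}(z)\,dz<\infty$, let $f$ be the solution of the mean field equation $$\partial_tf+\mathrm{div}_z(f\,\mathcal Kf)=0,\qquad f|_{t=0}=f^{in},\qquad \mathcal Kf(t,z)=\int K(z,z')f(t,z')\,dz',$$ that is, $t\mapsto f(t)\mathscr L^d$ is a weak solution which is weakly continuous on $\mathbf R$ with values in $\mathcal P_1(\mathbf R^d)$ and whose first moment is locally integrable in $t$. On $(\mathbf R^d)^m$, $\mathrm{Lip}(\phi)$ is the Lipschitz constant for the Euclidean norm, and $$\|P-Q\|_{W^{-1,1}((\mathbf R^d)^m)}=\sup\{|\langle P-Q,\phi\rangle| : \|\phi\|_{L^\infty}\le 1,\ \mathrm{Lip}(\phi)\le 1\}.$$ Theorem. (a) For all $N\ge1$, all symmetric $P_N^{in}\in\mathcal P_1((\mathbf R^d)^N)$, all $m\ge 1$ and all $t\in\mathbf R$, $$\int_{(\mathbf R^d)^N}\mu_{T^N_tZ_N^{in}}^{\otimes m}\,P_N^{in}(dZ_N^{in})=\frac{N!}{(N-m)!\,N^m}P_{N:m}(t)+R_{N,m}(t),$$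 where $R_{N,m}(t)$ is a positive measure on $(\mathbf R^d)^m$ with total mass $$\langle R_{N,m}(t),1\rangle=1-\frac{N!}{(N-m)!\,N^m}\le\frac{m(m-1)}{2N}.$$ Here $\frac{N!}{(N-m)!}$ means $N(N-1)\cdots(N-m+1)$, which is $0$ if $m>N$. (b) For all $N\ge 1$, all symmetric $P_N^{in}\in\mathcal P_1((\mathbf R^d)^N)$, all $f^{in}$ and $f$ as above, all $t\in\mathbf R$, all $m=1,\dots,N$ and all bounded Lipschitz continuous $\phi_m:(\mathbf R^d)^m\to\mathbf R$, $$|\langle P_{N:m}(t)-(f(t)\mathscr L^d)^{\otimes m},\phi_m\rangle|\le\|\phi_m\|_{L^\infty}\frac{m(m-1)}N+m\,e^{2L|t|}\,\mathrm{Lip}(\phi_m)\int_{(\mathbf R^d)^N}\mathrm{dist}_{MK,1}(\mu_{Z_N^{in}},f^{in}\mathscr L^d)\,P_N^{in}(dZ_N^{in}).$$ (c) There is a constant $C(a,d)$, depending only on $a$ and $d$ (and not on $K$, $L$, $f^{in}$, $N$, $m$, $t$), such that if $P_N^{in}=(f^{in}\mathscr L^d)^{\otimes N}$ and $a:=\int|z|^{d+5}f^{in}(z)\,dz<\infty$,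 then for all $t\in\mathbf R$ and all $N\ge m\ge 1$ $$\|P_{N:m}(t)-(f(t)\mathscr L^d)^{\otimes m}\|_{W^{-1,1}((\mathbf R^d)^m)}\le m\left(\frac{m-1}N+e^{2L|t|}\frac{C(a,d)}{N^{1/(d+4)}}\right),$$ and in particular, for $m=1$, $$\mathrm{dist}_{MK,1}(P_{N:1}(t),f(t)\mathscr L^d)\le \frac{C(a,d)\,e^{2L|t|}}{N^{1/(d+4)}}.$$ -/

import Mathlib

open MeasureTheory
open scoped NNReal ENNReal ContDiff BoundedContinuousFunction

noncomputable section

namespace MeanField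

/-- The one-particle phase space `ℝ^d` with its Euclidean norm. -/
abbrev Phase (d : ℕ) : Type := EuclideanSpace ℝ (Fin d)

/-- The `N`-particle phase space `(ℝ^d)^N`. -/
abbrev Config (d N : ℕ) : Type := Fin N → Phase d

/-- The space `(ℝ^d)^m` carrying the Euclidean norm of `ℝ^(dm)`; this is where test functions
live, so that Lipschitz constants refer to the Euclidean norm and not to the sup norm. -/
abbrev EConfig (d m : ℕ) : Type := PiLp 2 (fun _ : Fin m => Phase d)

/-! ### Probability measures, densities, Monge-Kantorovich distance -/

/-- `μ` belongs to `𝒫₁(X)`: a probability measure with finite first moment. -/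
def IsP1 {X : Type*} [NormedAddCommGroup X] [MeasurableSpace X] (μ : Measure X) : Prop :=
  IsProbabilityMeasure μ ∧ Integrable (fun x => ‖x‖) μ

/-- The measure `g ℒ^d` on `ℝ^d`, for `g ≥ 0`. -/
def density {d : ℕ} (g : Phase d → ℝ) : Measure (Phase d) :=
  (volume : Measure (Phase d)).withDensity (fun z => ENNReal.ofReal (g z))

/-- `g` is a probability density on `ℝ^d` (with respect to Lebesgue measure)
with `∫ |z| g(z) dz < ∞`. -/
def IsP1Density {d : ℕ} (g : Phase d → ℝ) : Prop :=
  Integrable g ∧ 0 ≤ᵐ[volume] g ∧ ∫ z, g z = 1 ∧ Integrable (fun z => ‖z‖ * g z)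

/-- The set `Π(μ, ν)` of couplings of `μ` and `ν`. -/
def couplings {X : Type*} [MeasurableSpace X] (μ ν : Measure X) : Set (Measure (X × X)) :=
  {π | IsProbabilityMeasure π ∧ π.map Prod.fst = μ ∧ π.map Prod.snd = ν}

/-- The Monge-Kantorovich distance with exponent `1`,
`inf_{π ∈ Π(μ, ν)} ∬ |x - y| π(dx dy)`, with values in `[0, ∞]` (finite on `𝒫₁`). -/
def distMK {X : Type*} [MetricSpace X] [MeasurableSpace X] (μ ν : Measure X) : ℝ≥0∞ :=
  ⨅ π ∈ couplings μ ν, ∫⁻ p, edist p.1 p.2 ∂π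

/-- `Lip(φ) = sup_{x ≠ y} |φ(x) - φ(y)| / |x - y|` (the pairs `x = y` contribute `0`),
for a Lipschitz continuous `φ`. -/
def lip {X : Type*} [MetricSpace X] (φ : X → ℝ) : ℝ :=
  ⨆ p : X × X, |φ p.1 - φ p.2| / dist p.1 p.2

/-- `‖φ‖_{L^∞} = sup |φ|`, for a bounded continuous `φ`. -/
def supNorm {X : Type*} (φ : X → ℝ) : ℝ := ⨆ x, |φ x|

/-- `‖P - Q‖_{W^{-1,1}((ℝ^d)^m)}`, where `W^{-1,1}` is normed by duality with `W^{1,∞}`, the space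
of bounded Lipschitz functions with norm `max (‖φ‖_{L^∞}, Lip φ)`. -/
def normWNegOneOne {d m : ℕ} (P Q : Measure (Config d m)) : ℝ≥0∞ :=
  ⨆ (φ : EConfig d m → ℝ) (_ : ∀ x, |φ x| ≤ 1) (_ : LipschitzWith 1 φ),
    ENNReal.ofReal |(∫ Z, φ (WithLp.toLp 2 Z) ∂P) - ∫ Z, φ (WithLp.toLp 2 Z) ∂Q|

/-! ### The `N`-body dynamics -/

/-- The vector field `Z ↦ ((1/N) ∑_l K(z_k, z_l))_k` of the `N`-body system. -/
def nBodyField {d : ℕ} (K : Phase d → Phase d → Phase d) (N : ℕ) (Z : Config d N) : Config d N :=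
  fun k => (N : ℝ)⁻¹ • ∑ l, K (Z k) (Z l)

/-- `z` is a solution, defined for all times, of the `N`-body system with initial data `Zin`. -/
def IsTrajectory {d : ℕ} (K : Phase d → Phase d → Phase d) {N : ℕ} (Zin : Config d N)
    (z : ℝ → Config d N) : Prop :=
  z 0 = Zin ∧ ∀ t, HasDerivAt z (nBodyField K N (z t)) t

open Classical in
/-- The flow `T^N_t`. For a kernel that is Lipschitz continuous in each variable, the `N`-body
system has exactly one global solution for each initial data, and the `else` branch
is never used. -/
def flow {d : ℕ} (K : Phase d → Phase d → Phase d) (N : ℕ) (t : ℝ) (Zin : Config d N) :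
    Config d N :=
  if h : ∃ z, IsTrajectory K Zin z then h.choose t else Zin

/-- The empirical measure `μ_Z = (1/N) ∑_k δ_{z_k}`. -/
def empirical {d N : ℕ} (Z : Config d N) : Measure (Phase d) :=
  (N : ℝ≥0∞)⁻¹ • ∑ k, Measure.dirac (Z k)

/-- Invariance of `P` under all permutations of the particles. -/
def IsSymmetric {d N : ℕ} (P : Measure (Config d N)) : Prop :=
  ∀ σ : Equiv.Perm (Fin N), P.map (fun Z i => Z (σ i)) = P

/-- The law `P_N(t) = T^N_t # P_N^in`. -/
def law {d N : ℕ} (K : Phase d → Phase d → Phase d) (Pin : Measure (Config d N)) (t : ℝ) :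
    Measure (Config d N) :=
  Pin.map (flow K N t)

/-- The `m`-body marginal `P_{N:m}`, the image of `P` under `(z_1, …, z_N) ↦ (z_1, …, z_m)` if
`m ≤ N`, and `0` if `m > N`. -/
def marginal {d N : ℕ} (m : ℕ) (P : Measure (Config d N)) : Measure (Config d m) :=
  if h : m ≤ N then P.map (fun Z i => Z (Fin.castLE h i)) else 0

/-- The tensor power `μ^{⊗ m}`. -/
def tensorPow {d : ℕ} (m : ℕ) (μ : Measure (Phase d)) : Measure (Config d m) :=
  Measure.pi (fun _ : Fin m => μ)

/-! ### The mean field equation -/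

/-- `𝒦μ(z) = ∫ K(z, z') μ(dz')`. -/
def meanField {d : ℕ} (K : Phase d → Phase d → Phase d) (μ : Measure (Phase d)) (z : Phase d) :
    Phase d :=
  ∫ z', K z z' ∂μ

/-- `μ` is a weak solution of `∂_t μ + div (μ 𝒦μ) = 0`, `μ(0) = μin`, which is a weakly continuous
function of `t ∈ ℝ` with values in `𝒫₁(ℝ^d)`. The local integrability in time of the first moment
is what gives the nonlinear term a meaning. -/
structure IsWeakSolution {d : ℕ} (K : Phase d → Phase d → Phase d) (μin : Measure (Phase d))
    (μ : ℝ → Measure (Phase d)) : Prop where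
  isP1 : ∀ t, IsP1 (μ t)
  continuous : ∀ φ : Phase d →ᵇ ℝ, Continuous fun t => ∫ z, φ z ∂(μ t)
  moment : LocallyIntegrable (fun t => ∫ z, ‖z‖ ∂(μ t)) volume
  initial : μ 0 = μin
  equation : ∀ φ : Phase d → ℝ, ContDiff ℝ ∞ φ → HasCompactSupport φ → ∀ t : ℝ,
    (∫ z, φ z ∂(μ t)) - ∫ z, φ z ∂(μ 0)
      = ∫ s in (0 : ℝ)..t, ∫ z, fderiv ℝ φ z (meanField K (μ s) z) ∂(μ s)

/-- `f` is the solution of the mean field equation `∂_t f + div_z (f 𝒦f) = 0` with initial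
density `fin`. -/
def IsVlasovSolution {d : ℕ} (K : Phase d → Phase d → Phase d) (fin : Phase d → ℝ)
    (f : ℝ → Phase d → ℝ) : Prop :=
  (∀ t, IsP1Density (f t)) ∧ IsWeakSolution K (density fin) (fun t => density (f t))

end MeanField

end

open MeanField

/-! Statement (a) is combinatorial. The `m`-th tensor power of an empirical measure is `N^(-m)`
times the sum, over all maps `ι : Fin m → Fin N`, of Dirac masses at `(z_(ι 1), …, z_(ι m))`. After
averaging over a symmetric law every injective `ι` contributes the same `m`-body marginal, and there
are `N (N-1) ⋯ (N-m+1)` of them; the non-injective ones make up the positive remainder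
(`exists_remainder`). The law stays symmetric because the flow commutes with permutations.

Statement (b) compares the tensor power of the empirical measure with that of `f(t)` by Dobrushin's
argument. The mean field of a weak solution is Lipschitz in space and continuous in time, so it has
a flow `X`, and uniqueness for the linear continuity equation gives `μ t = ν.map X` (`eq_map_sol`).
Uniqueness is proved by duality: a Lipschitz solution of the backward transport equation is
mollified to become an admissible test function, with a commutator error that vanishes with the
mollification radius. The particles `z_k(t)` and the images `X(z_k)` then satisfy a Gronwall
inequality, whose source is the discrepancy `U` between the initial empirical measure and `ν` tested
on Lipschitz functions. It gives `|z_k(t) - X(z_k)| ≤ U (e^(2L|t|) - e^(L|t|))`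
(`dist_flow_characteristics_le`). Pushing both initial measures through the `e^(L|t|)`-Lipschitz map
`X` costs `e^(L|t|) U`, so the two contributions add up to `e^(2L|t|) U`.

The whole estimate only asks that `U` satisfy `DualBound`. For (b), `U` is the Monge-Kantorovich
distance, through the elementary half of Kantorovich duality. For (c), `U` is `ballDiscrepancy`,
which averages test functions over balls of radius `ε` and compares the masses of these balls; its
mean for independent particles is controlled by a variance, a weighted Young inequality and a
moment. For `m = 1` the distance itself is bounded by the explicit coupling `(z_k(t), X(z_k))`, so
the hard half of duality is never needed. -/

/-! ### Global solutions of globally Lipschitz differential equations -/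

section GlobalODE

open Set Filter Topology

variable {E : Type*} [NormedAddCommGroup E] [NormedSpace ℝ E]

/-- A solution, defined for all times, of `x' = v(t, x)` with `x(t₀) = x₀`. -/
def IsGlobalSolution (v : ℝ → E → E) (t₀ : ℝ) (x₀ : E) (x : ℝ → E) : Prop :=
  x t₀ = x₀ ∧ ∀ t, HasDerivAt x (v t (x t)) t

/-- The length of the interval of existence depends on the Lipschitz constant alone, not on the
initial data; this is what makes continuation to all times possible. -/
theorem exists_local_solution_uniform [CompleteSpace E] {v : ℝ → E → E} {K : ℝ≥0}
    (hv : ∀ t, LipschitzWith K (v t)) (hc : ∀ x, Continuous fun t => v t x) (t₀ : ℝ) (x₀ : E) :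
    ∃ x : ℝ → E, x t₀ = x₀ ∧ ∀ t ∈ Ioo (t₀ - 1 / (2 * K + 2)) (t₀ + 1 / (2 * K + 2)),
      HasDerivAt x (v t (x t)) t := by
  set δ : ℝ := 1 / (2 * K + 2) with hδ
  have hK : (0 : ℝ) ≤ K := K.2
  have hδ0 : 0 < δ := by positivity
  have hδK : δ * (2 * K + 2) = 1 := by rw [hδ]; field_simp
  obtain ⟨M, hM⟩ := (isCompact_Icc (a := t₀ - δ) (b := t₀ + δ)).exists_bound_of_continuousOn
    (hc x₀).continuousOn
  have hM0 : 0 ≤ M := (norm_nonneg _).trans (hM t₀ ⟨by linarith, by linarith⟩)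
  lift M to ℝ≥0 using hM0
  -- On the ball of radius `M` around `x₀` the field is bounded by `M + K M`, and `(M + K M) δ = M /
  -- 2`, so the trajectory cannot leave the ball within time `δ`.
  have hPL : IsPicardLindelof v (tmin := t₀ - δ) (tmax := t₀ + δ)
      ⟨t₀, by constructor <;> linarith⟩ x₀ M 0 (M + K * M) K := by
    refine ⟨fun t _ => (hv t).lipschitzOnWith, fun x _ => (hc x).continuousOn, ?_, ?_⟩
    · intro t ht x hx
      have h1 : ‖v t x - v t x₀‖ ≤ K * M := by
        rw [← dist_eq_norm]
        exact ((hv t).dist_le_mul x x₀).trans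
          (mul_le_mul_of_nonneg_left (Metric.mem_closedBall.1 hx) hK)
      have h2 := hM t ht
      calc ‖v t x‖ = ‖v t x₀ + (v t x - v t x₀)‖ := by congr 1; abel
        _ ≤ ‖v t x₀‖ + ‖v t x - v t x₀‖ := norm_add_le _ _
        _ ≤ _ := by push_cast; linarith
    · simp only [add_sub_cancel_left, sub_sub_cancel, max_self, NNReal.coe_zero, sub_zero]
      push_cast
      nlinarith [M.2, mul_nonneg M.2 hδ0.le]
  obtain ⟨x, hx0, hx⟩ := hPL.exists_eq_forall_mem_Icc_hasDerivWithinAt₀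
  exact ⟨x, hx0, fun t ht => (hx t (Ioo_subset_Icc_self ht)).hasDerivAt (Icc_mem_nhds ht.1 ht.2)⟩

theorem eqOn_of_solutions_Ioo {v : ℝ → E → E} {K : ℝ≥0} (hv : ∀ t, LipschitzWith K (v t))
    {x y : ℝ → E} {a b s : ℝ} (hs : s ∈ Ioo a b) (hx : ∀ t ∈ Ioo a b, HasDerivAt x (v t (x t)) t)
    (hy : ∀ t ∈ Ioo a b, HasDerivAt y (v t (y t)) t) (h : x s = y s) : EqOn x y (Ioo a b) :=
  ODE_solution_unique_of_mem_Ioo (s := fun _ => univ) (fun t _ => (hv t).lipschitzOnWith) hs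
    (fun t ht => ⟨hx t ht, mem_univ _⟩) (fun t ht => ⟨hy t ht, mem_univ _⟩) h

theorem exists_glued_solution {v : ℝ → E → E} {K : ℝ≥0} (hv : ∀ t, LipschitzWith K (v t))
    {x y : ℝ → E} {a b c d s : ℝ} (hac : a ≤ c) (hbd : b ≤ d) (hs : s ∈ Ioo c b)
    (hx : ∀ t ∈ Ioo a b, HasDerivAt x (v t (x t)) t)
    (hy : ∀ t ∈ Ioo c d, HasDerivAt y (v t (y t)) t) (h : x s = y s) :
    ∃ z : ℝ → E, EqOn z x (Ioo a b) ∧ EqOn z y (Ioo c d) ∧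
      ∀ t ∈ Ioo a d, HasDerivAt z (v t (z t)) t := by
  have hxy : EqOn x y (Ioo c b) := eqOn_of_solutions_Ioo hv hs
    (fun t ht => hx t ⟨hac.trans_lt ht.1, ht.2⟩) (fun t ht => hy t ⟨ht.1, ht.2.trans_le hbd⟩) h
  have hzx : EqOn (fun t => if t < s then x t else y t) x (Ioo a b) := by
    intro t ht
    by_cases hts : t < s
    · simp [hts]
    · simp only [hts, if_false]
      exact (hxy ⟨hs.1.trans_le (not_lt.1 hts), ht.2⟩).symm
  have hzy : EqOn (fun t => if t < s then x t else y t) y (Ioo c d) := by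
    intro t ht
    by_cases hts : t < s
    · simp only [hts, if_true]
      exact hxy ⟨ht.1, hts.trans hs.2⟩
    · simp [hts]
  refine ⟨_, hzx, hzy, fun t ht => ?_⟩
  by_cases hts : t < s
  · have hm : t ∈ Ioo a b := ⟨ht.1, hts.trans hs.2⟩
    rw [show (if t < s then x t else y t) = x t from hzx hm]
    exact (hx t hm).congr_of_eventuallyEq (hzx.eventuallyEq_of_mem (Ioo_mem_nhds hm.1 hm.2))
  · have hm : t ∈ Ioo c d := ⟨hs.1.trans_le (not_lt.1 hts), ht.2⟩
    rw [show (if t < s then x t else y t) = y t from hzy hm]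
    exact (hy t hm).congr_of_eventuallyEq (hzy.eventuallyEq_of_mem (Ioo_mem_nhds hm.1 hm.2))

theorem exists_solution_Ioo [CompleteSpace E] {v : ℝ → E → E} {K : ℝ≥0}
    (hv : ∀ t, LipschitzWith K (v t)) (hc : ∀ x, Continuous fun t => v t x) (t₀ : ℝ) (x₀ : E)
    (n : ℕ) :
    ∃ x : ℝ → E, x t₀ = x₀ ∧
      ∀ t ∈ Ioo (t₀ - (n + 1) * (1 / (2 * (2 * K + 2)))) (t₀ + (n + 1) * (1 / (2 * (2 * K + 2)))),
        HasDerivAt x (v t (x t)) t := by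
  have hK : (0 : ℝ) ≤ K := K.2
  set δ : ℝ := 1 / (2 * (2 * K + 2)) with hδ
  have hδ2 : 1 / (2 * (K : ℝ) + 2) = 2 * δ := by rw [hδ]; field_simp
  have hδ0 : 0 < δ := by positivity
  induction n with
  | zero =>
    obtain ⟨x, h0, hx⟩ := exists_local_solution_uniform hv hc t₀ x₀
    rw [hδ2] at hx
    exact ⟨x, h0, fun t ht => hx t ⟨by have := ht.1; push_cast at this; linarith,
      by have := ht.2; push_cast at this; linarith⟩⟩
  | succ n ih =>
    obtain ⟨x, h0, hx⟩ := ih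
    set A : ℝ := (n + 1) * δ with hA
    have hAδ : δ ≤ A := by rw [hA]; nlinarith [(Nat.cast_nonneg n : (0 : ℝ) ≤ n)]
    have hA' : ((n + 1 : ℕ) + 1 : ℝ) * δ = A + δ := by push_cast; ring
    rw [hA']
    -- A local solution lives for time `2 δ` on each side, so restarting `δ / 2` inside each end of
    -- the interval gains `δ` beyond it and leaves an overlap for gluing.
    obtain ⟨y, hy0, hy⟩ := exists_local_solution_uniform hv hc (t₀ + A - δ / 2) (x (t₀ + A - δ / 2))
    obtain ⟨w, hw0, hw⟩ :=
      exists_local_solution_uniform hv hc (t₀ - A + δ / 2) (x (t₀ - A + δ / 2))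
    rw [hδ2] at hy hw
    obtain ⟨z, hzx, -, hz⟩ := exists_glued_solution hv (s := t₀ + A - δ / 2) (a := t₀ - A)
      (b := t₀ + A) (c := t₀ + A - δ) (d := t₀ + A + δ) (by linarith) (by linarith)
      ⟨by linarith, by linarith⟩ hx (fun t ht => hy t ⟨by linarith [ht.1], by linarith [ht.2]⟩)
      hy0.symm
    have hzs : z (t₀ - A + δ / 2) = x (t₀ - A + δ / 2) := hzx ⟨by linarith, by linarith⟩
    obtain ⟨u, -, huz, hu⟩ := exists_glued_solution hv (s := t₀ - A + δ / 2) (a := t₀ - A - δ)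
      (b := t₀ - A + δ) (c := t₀ - A) (d := t₀ + A + δ) (by linarith) (by linarith)
      ⟨by linarith, by linarith⟩ (fun t ht => hw t ⟨by linarith [ht.1], by linarith [ht.2]⟩) hz
      (hw0.trans hzs.symm)
    refine ⟨u, ?_, fun t ht => hu t ⟨by linarith [ht.1], by linarith [ht.2]⟩⟩
    rw [huz ⟨by linarith, by linarith⟩, hzx ⟨by linarith, by linarith⟩, h0]

theorem exists_isGlobalSolution [CompleteSpace E] {v : ℝ → E → E} {K : ℝ≥0}
    (hv : ∀ t, LipschitzWith K (v t)) (hc : ∀ x, Continuous fun t => v t x) (t₀ : ℝ) (x₀ : E) :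
    ∃ x, IsGlobalSolution v t₀ x₀ x := by
  choose X hX0 hX using exists_solution_Ioo hv hc t₀ x₀
  have hK : (0 : ℝ) ≤ K := K.2
  set δ : ℝ := 1 / (2 * (2 * K + 2)) with hδ
  have hδ0 : 0 < δ := by positivity
  have key : ∀ n m : ℕ, n ≤ m → EqOn (X m) (X n) (Ioo (t₀ - (n + 1) * δ) (t₀ + (n + 1) * δ)) := by
    intro n m hnm
    have h1 : ((n : ℝ) + 1) * δ ≤ (m + 1) * δ := by gcongr
    have h2 : 0 < ((n : ℝ) + 1) * δ := by positivity
    exact eqOn_of_solutions_Ioo hv (s := t₀) ⟨by linarith, by linarith⟩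
      (fun t ht => hX m t ⟨by linarith [ht.1], by linarith [ht.2]⟩) (hX n)
      (by rw [hX0, hX0])
  have hex : ∀ t : ℝ, ∃ n : ℕ, t ∈ Ioo (t₀ - (n + 1) * δ) (t₀ + (n + 1) * δ) := by
    intro t
    obtain ⟨n, hn⟩ := exists_nat_gt (|t - t₀| / δ)
    rw [div_lt_iff₀ hδ0] at hn
    have := abs_lt.1 (hn.trans (by linarith : (n : ℝ) * δ < (n + 1) * δ))
    exact ⟨n, by linarith, by linarith⟩
  choose ν hν using hex
  have heq : ∀ (n : ℕ), EqOn (fun t => X (ν t) t) (X n)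
      (Ioo (t₀ - (n + 1) * δ) (t₀ + (n + 1) * δ)) := by
    intro n t ht
    rcases le_total n (ν t) with h | h
    · exact key n _ h ht
    · exact (key _ n h (hν t)).symm
  refine ⟨fun t => X (ν t) t, hX0 _, fun t => ?_⟩
  exact (hX (ν t) t (hν t)).congr_of_eventuallyEq
    ((heq (ν t)).eventuallyEq_of_mem (Ioo_mem_nhds (hν t).1 (hν t).2))

theorem dist_solutions_le_of_le {v : ℝ → E → E} {K : ℝ≥0} (hv : ∀ t, LipschitzWith K (v t))
    {x y : ℝ → E} (hx : ∀ t, HasDerivAt x (v t (x t)) t) (hy : ∀ t, HasDerivAt y (v t (y t)) t)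
    {s t : ℝ} (hst : s ≤ t) :
    dist (x t) (y t) ≤ dist (x s) (y s) * Real.exp (K * (t - s)) :=
  dist_le_of_trajectories_ODE hv
    (fun r _ => (hx r).continuousAt.continuousWithinAt) (fun r _ => (hx r).hasDerivWithinAt)
    (fun r _ => (hy r).continuousAt.continuousWithinAt) (fun r _ => (hy r).hasDerivWithinAt)
    le_rfl t ⟨hst, le_rfl⟩

theorem dist_solutions_le {v : ℝ → E → E} {K : ℝ≥0} (hv : ∀ t, LipschitzWith K (v t))
    {x y : ℝ → E} (hx : ∀ t, HasDerivAt x (v t (x t)) t) (hy : ∀ t, HasDerivAt y (v t (y t)) t)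
    (s t : ℝ) :
    dist (x t) (y t) ≤ dist (x s) (y s) * Real.exp (K * |t - s|) := by
  rcases le_total s t with h | h
  · rw [abs_of_nonneg (sub_nonneg.2 h)]
    exact dist_solutions_le_of_le hv hx hy h
  · have hrev : ∀ z : ℝ → E, (∀ t, HasDerivAt z (v t (z t)) t) →
        ∀ t, HasDerivAt (fun r => z (-r)) ((fun r w => -v (-r) w) t (z (-t))) t := fun z hz t => by
      have := HasDerivAt.scomp t (hz (-t)) (hasDerivAt_neg t)
      simpa [Function.comp_def] using this
    have := dist_solutions_le_of_le (v := fun r w => -v (-r) w) (fun r => (hv (-r)).neg)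
      (hrev x hx) (hrev y hy) (neg_le_neg h)
    simp only [neg_neg] at this
    rwa [abs_of_nonpos (sub_nonpos.2 h), neg_sub, show s - t = -t - -s by ring]

theorem IsGlobalSolution.eq {v : ℝ → E → E} {K : ℝ≥0} (hv : ∀ t, LipschitzWith K (v t))
    {t₀ : ℝ} {x₀ : E} {x y : ℝ → E} (hx : IsGlobalSolution v t₀ x₀ x)
    (hy : IsGlobalSolution v t₀ x₀ y) : x = y := by
  ext t
  have := dist_solutions_le hv hx.2 hy.2 t₀ t
  rw [hx.1, hy.1, dist_self, zero_mul] at this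
  exact dist_le_zero.1 this

end GlobalODE

namespace MeanField

/-! ### The `N`-body flow: Lipschitz dependence, permutations, time reversal -/

section NBody

variable {d : ℕ} {K : Phase d → Phase d → Phase d} {L : ℝ≥0}

theorem dist_kernel_le (h1 : ∀ z', LipschitzWith L (fun z => K z z'))
    (h2 : ∀ z, LipschitzWith L (fun z' => K z z')) (z w z' w' : Phase d) :
    dist (K z w) (K z' w') ≤ L * (dist z z' + dist w w') := by
  calc dist (K z w) (K z' w') ≤ dist (K z w) (K z' w) + dist (K z' w) (K z' w') :=
        dist_triangle _ _ _
    _ ≤ L * dist z z' + L * dist w w' :=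
        add_le_add ((h1 w).dist_le_mul z z') ((h2 z').dist_le_mul w w')
    _ = _ := by ring

theorem continuous_kernel (h1 : ∀ z', LipschitzWith L (fun z => K z z'))
    (h2 : ∀ z, LipschitzWith L (fun z' => K z z')) :
    Continuous fun p : Phase d × Phase d => K p.1 p.2 :=
  continuous_prod_of_continuous_lipschitzWith' _ L (fun z => h2 z) (fun w => (h1 w).continuous)

theorem dist_avg_le {N : ℕ} (hN : 1 ≤ N) {V : Type*} [NormedAddCommGroup V] [NormedSpace ℝ V]
    {u w : Fin N → V} {c : ℝ} (h : ∀ l, dist (u l) (w l) ≤ c) :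
    dist ((N : ℝ)⁻¹ • ∑ l, u l) ((N : ℝ)⁻¹ • ∑ l, w l) ≤ c := by
  have hN' : (0 : ℝ) < N := by exact_mod_cast hN
  rw [dist_smul₀, norm_inv, Real.norm_natCast]
  calc (N : ℝ)⁻¹ * dist (∑ l, u l) (∑ l, w l) ≤ (N : ℝ)⁻¹ * ∑ l, dist (u l) (w l) := by
        gcongr; exact dist_sum_sum_le _ _ _
    _ ≤ (N : ℝ)⁻¹ * ∑ _l : Fin N, c := by gcongr with l; exact h l
    _ = c := by simp; field_simp

/-- In the sup norm over particles the constant does not depend on `N`: each term of the average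
moves by at most `L` in each of its two arguments. -/
theorem lipschitzWith_nBodyField (h1 : ∀ z', LipschitzWith L (fun z => K z z'))
    (h2 : ∀ z, LipschitzWith L (fun z' => K z z')) {N : ℕ} (hN : 1 ≤ N) :
    LipschitzWith (2 * L) (nBodyField K N) := by
  refine LipschitzWith.of_dist_le_mul fun Z W => ?_
  refine (dist_pi_le_iff (by positivity)).2 fun k => dist_avg_le hN fun l => ?_
  refine (dist_kernel_le h1 h2 _ _ _ _).trans ?_
  have := dist_le_pi_dist Z W k
  have := dist_le_pi_dist Z W l
  push_cast
  nlinarith [L.2]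

theorem isTrajectory_flow (h1 : ∀ z', LipschitzWith L (fun z => K z z'))
    (h2 : ∀ z, LipschitzWith L (fun z' => K z z')) {N : ℕ} (hN : 1 ≤ N) (Z : Config d N) :
    IsTrajectory K Z (fun t => flow K N t Z) := by
  have h : ∃ z, IsTrajectory K Z z :=
    exists_isGlobalSolution (v := fun _ => nBodyField K N)
      (fun _ => lipschitzWith_nBodyField h1 h2 hN) (fun _ => continuous_const) 0 Z
  have : (fun t => flow K N t Z) = h.choose := by
    ext t : 1
    simp only [flow, dif_pos h]
  rw [this]
  exact h.choose_spec

theorem flow_eq_of_isTrajectory (h1 : ∀ z', LipschitzWith L (fun z => K z z'))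
    (h2 : ∀ z, LipschitzWith L (fun z' => K z z')) {N : ℕ} (hN : 1 ≤ N) {Z : Config d N}
    {z : ℝ → Config d N} (hz : IsTrajectory K Z z) (t : ℝ) : flow K N t Z = z t := by
  have hx : IsGlobalSolution (fun _ => nBodyField K N) 0 Z (fun t => flow K N t Z) :=
    isTrajectory_flow h1 h2 hN Z
  exact congr_fun (hx.eq (fun _ => lipschitzWith_nBodyField h1 h2 hN) hz) t

theorem lipschitzWith_flow (h1 : ∀ z', LipschitzWith L (fun z => K z z'))
    (h2 : ∀ z, LipschitzWith L (fun z' => K z z')) {N : ℕ} (hN : 1 ≤ N) (t : ℝ) :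
    LipschitzWith (Real.exp (2 * L * |t|)).toNNReal (flow K N t) := by
  refine LipschitzWith.of_dist_le_mul fun Z W => ?_
  have := dist_solutions_le (v := fun _ => nBodyField K N)
    (fun _ => lipschitzWith_nBodyField h1 h2 hN) (isTrajectory_flow h1 h2 hN Z).2
    (isTrajectory_flow h1 h2 hN W).2 0 t
  simp only [(isTrajectory_flow h1 h2 hN Z).1, (isTrajectory_flow h1 h2 hN W).1, sub_zero] at this
  rw [Real.coe_toNNReal _ (Real.exp_pos _).le, mul_comm]
  push_cast at this
  exact this

theorem measurable_flow (h1 : ∀ z', LipschitzWith L (fun z => K z z'))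
    (h2 : ∀ z, LipschitzWith L (fun z' => K z z')) {N : ℕ} (hN : 1 ≤ N) (t : ℝ) :
    Measurable (flow K N t) :=
  (lipschitzWith_flow h1 h2 hN t).continuous.measurable

/-- The field is equivariant under relabelling, so a relabelled trajectory is a trajectory, and
uniqueness identifies it. -/
theorem flow_comp_perm (h1 : ∀ z', LipschitzWith L (fun z => K z z'))
    (h2 : ∀ z, LipschitzWith L (fun z' => K z z')) {N : ℕ} (hN : 1 ≤ N) (t : ℝ)
    (σ : Equiv.Perm (Fin N)) (Z : Config d N) :
    flow K N t (fun i => Z (σ i)) = fun i => flow K N t Z (σ i) := by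
  refine flow_eq_of_isTrajectory h1 h2 hN (z := fun t i => flow K N t Z (σ i)) ⟨?_, fun s => ?_⟩ t
  · have := (isTrajectory_flow h1 h2 hN Z).1
    ext i : 1
    exact congr_fun this (σ i)
  · rw [hasDerivAt_pi]
    intro i
    have := hasDerivAt_pi.1 ((isTrajectory_flow h1 h2 hN Z).2 s) (σ i)
    convert this using 1
    simp only [nBodyField]
    congr 1
    exact Equiv.sum_comp σ (fun l => K (flow K N s Z (σ i)) (flow K N s Z l))

theorem flow_neg (h1 : ∀ z', LipschitzWith L (fun z => K z z'))
    (h2 : ∀ z, LipschitzWith L (fun z' => K z z')) {N : ℕ} (hN : 1 ≤ N) (t : ℝ) :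
    flow K N (-t) = flow (fun z z' => -K z z') N t := by
  ext Z : 1
  symm
  refine flow_eq_of_isTrajectory (L := L) (fun z => (h1 z).neg) (fun z => (h2 z).neg) hN
    (z := fun t => flow K N (-t) Z) ⟨by simpa using (isTrajectory_flow h1 h2 hN Z).1, fun s => ?_⟩ t
  have := HasDerivAt.scomp s ((isTrajectory_flow h1 h2 hN Z).2 (-s)) (hasDerivAt_neg s)
  have hK : nBodyField (fun z z' => -K z z') N (flow K N (-s) Z) =
      (-1 : ℝ) • nBodyField K N (flow K N (-s) Z) := by
    funext k
    simp [nBodyField]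
  change HasDerivAt _ (nBodyField (fun z z' => -K z z') N (flow K N (-s) Z)) s
  rw [hK]
  exact this

end NBody

/-! ### Tensor powers of empirical measures and marginals of symmetric laws -/

section Symmetric

variable {d : ℕ}

theorem isSymmetric_map {N : ℕ} {P : Measure (Config d N)} (hP : IsSymmetric P)
    {T : Config d N → Config d N} (hT : Measurable T)
    (hTσ : ∀ (σ : Equiv.Perm (Fin N)) Z, T (fun i => Z (σ i)) = fun i => T Z (σ i)) :
    IsSymmetric (P.map T) := by
  intro σ
  have hσ : Measurable fun (Z : Config d N) i => Z (σ i) := by fun_prop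
  conv_rhs => rw [← hP σ, Measure.map_map hT hσ]
  rw [Measure.map_map hσ hT]
  congr 1
  ext Z : 1
  exact (hTσ σ Z).symm

/-- An injection `Fin m → Fin N` is the standard inclusion followed by a permutation, and the
permutation does not change the law. -/
theorem map_comp_injective {N m : ℕ} {P : Measure (Config d N)} (hP : IsSymmetric P)
    {ι : Fin m → Fin N} (hι : Function.Injective ι) :
    P.map (fun Z i => Z (ι i)) = marginal m P := by
  have hm : m ≤ N := by simpa using Fintype.card_le_of_injective ι hι
  obtain ⟨σ, hσ⟩ : ∃ σ : Equiv.Perm (Fin N), ∀ i, σ (Fin.castLE hm i) = ι i := by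
    classical
    let e := (Equiv.ofInjective _ (Fin.castLE_injective hm)).symm.trans (Equiv.ofInjective ι hι)
    refine ⟨e.extendSubtype, fun i => ?_⟩
    rw [Equiv.extendSubtype_apply_of_mem e _ ⟨i, rfl⟩]
    have : (Equiv.ofInjective _ (Fin.castLE_injective hm)).symm ⟨Fin.castLE hm i, ⟨i, rfl⟩⟩ = i :=
      Equiv.ofInjective_symm_apply (Fin.castLE_injective hm) i
    simp only [e, Equiv.trans_apply, this, Equiv.ofInjective_apply]
  rw [marginal, dif_pos hm]
  conv_rhs => rw [← hP σ]
  rw [Measure.map_map (by fun_prop) (by fun_prop)]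
  congr 1
  ext Z : 1
  funext i
  simp [hσ]

theorem empirical_apply {N : ℕ} (Z : Config d N) {s : Set (Phase d)} (hs : MeasurableSet s) :
    empirical Z s = (N : ℝ≥0∞)⁻¹ * ∑ k, s.indicator 1 (Z k) := by
  simp [empirical, Measure.dirac_apply' _ hs]

theorem isProbabilityMeasure_empirical {N : ℕ} (hN : 1 ≤ N) (Z : Config d N) :
    IsProbabilityMeasure (empirical Z) := by
  constructor
  rw [empirical_apply _ MeasurableSet.univ]
  simp only [Set.indicator_univ, Pi.one_apply, Finset.sum_const, Finset.card_univ, Fintype.card_fin,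
    nsmul_eq_mul, mul_one]
  exact ENNReal.inv_mul_cancel (by simpa using Nat.one_le_iff_ne_zero.1 hN) (by simp)

/-- On a box the product measure is a product of `m` sums over particles; expanding it produces one
term for each choice `ι` of a particle per slot. -/
theorem tensorPow_empirical {N : ℕ} (hN : 1 ≤ N) (m : ℕ) (Z : Config d N) :
    tensorPow m (empirical Z) =
      ((N : ℝ≥0∞)⁻¹) ^ m • ∑ ι : Fin m → Fin N, Measure.dirac (fun i => Z (ι i)) := by
  have := isProbabilityMeasure_empirical hN Z
  refine Measure.pi_eq (μ := fun _ : Fin m => empirical Z) fun s hs => ?_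
  have hms : MeasurableSet (Set.univ.pi s) := MeasurableSet.univ_pi hs
  simp only [Measure.smul_apply, Measure.finsetSum_apply, smul_eq_mul, empirical_apply _ (hs _),
    Finset.prod_mul_distrib, Finset.prod_const, Finset.card_univ, Fintype.card_fin]
  congr 1
  rw [Finset.prod_univ_sum]
  simp only [Fintype.piFinset_univ]
  refine Finset.sum_congr rfl fun ι _ => ?_
  rw [Measure.dirac_apply' _ hms]
  by_cases h : ∀ i, Z (ι i) ∈ s i
  · rw [Set.indicator_of_mem (by simpa using h)]
    simp [Set.indicator_of_mem (h _)]
  · obtain ⟨i, hi⟩ := not_forall.1 h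
    rw [Set.indicator_of_notMem (by simpa using ⟨i, hi⟩)]
    exact (Finset.prod_eq_zero (Finset.mem_univ i) (Set.indicator_of_notMem hi _)).symm

theorem bind_tensorPow_empirical {N : ℕ} (hN : 1 ≤ N) (m : ℕ) (P : Measure (Config d N))
    {T : Config d N → Config d N} (hT : Measurable T) :
    P.bind (fun Z => tensorPow m (empirical (T Z))) =
      ((N : ℝ≥0∞)⁻¹) ^ m • ∑ ι : Fin m → Fin N, (P.map T).map (fun Z i => Z (ι i)) := by
  have hmeas : ∀ ι : Fin m → Fin N, Measurable fun Z : Config d N => fun i => T Z (ι i) :=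
    fun ι => by fun_prop
  have hM : Measurable fun Z => tensorPow m (empirical (T Z)) := by
    simp only [tensorPow_empirical hN]
    refine Measure.measurable_of_measurable_coe _ fun s hs => ?_
    simp only [Measure.smul_apply, Measure.finsetSum_apply, smul_eq_mul]
    refine Measurable.const_mul (Finset.measurable_sum _ fun ι _ => ?_) _
    exact (Measure.measurable_coe hs).comp (Measure.measurable_dirac.comp (hmeas ι))
  ext s hs
  rw [Measure.bind_apply hs hM.aemeasurable]
  simp only [tensorPow_empirical hN, Measure.smul_apply, Measure.finsetSum_apply, smul_eq_mul]
  have hd : ∀ ι : Fin m → Fin N, Measurable fun Z : Config d N =>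
      Measure.dirac (fun i => T Z (ι i)) s := fun ι =>
    (Measure.measurable_coe hs).comp (Measure.measurable_dirac.comp (hmeas ι))
  rw [lintegral_const_mul _ (Finset.measurable_sum _ fun ι _ => hd ι),
    lintegral_finsetSum _ fun ι _ => hd ι]
  congr 1
  refine Finset.sum_congr rfl fun ι _ => ?_
  rw [Measure.map_map (by fun_prop) hT, Measure.map_apply ((by fun_prop :
    Measurable fun (Z : Config d N) i => Z (ι i)).comp hT) hs]
  simp only [Measure.dirac_apply' _ hs]
  rw [← lintegral_indicator_one (((by fun_prop :
    Measurable fun (Z : Config d N) i => Z (ι i)).comp hT) hs)]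
  rfl

theorem card_injective_maps (m N : ℕ) :
    (Finset.univ.filter fun ι : Fin m → Fin N => Function.Injective ι).card =
      N.descFactorial m := by
  classical
  rw [← Fintype.card_subtype, Fintype.card_congr (Equiv.subtypeInjectiveEquivEmbedding _ _)]
  simp [Fintype.card_embedding_eq]

/-- Write `c_m` for the quotient. Then `c_(m+1) ≥ (1 - m/N) c_m` and `c_m ≤ 1`, so `1 - c_m` grows
by at most `m/N` at each step, and `0 + 1 + ⋯ + (m-1) = m (m-1) / 2`. -/
theorem one_sub_descFactorial_div_le {N : ℕ} (hN : 1 ≤ N) (m : ℕ) :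
    1 - (N.descFactorial m : ℝ) / (N : ℝ) ^ m ≤ (m : ℝ) * ((m : ℝ) - 1) / (2 * (N : ℝ)) := by
  have hN' : (0 : ℝ) < N := by exact_mod_cast hN
  induction m with
  | zero => simp
  | succ m ih =>
    have hc : (N.descFactorial m : ℝ) / (N : ℝ) ^ m ≤ 1 := by
      rw [div_le_one (by positivity)]
      exact_mod_cast Nat.descFactorial_le_pow N m
    have hc0 : 0 ≤ (N.descFactorial m : ℝ) / (N : ℝ) ^ m := by positivity
    -- The subtraction in `ℕ` is truncated, so this is only an inequality when `m > N`; it has the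
    -- direction that is needed.
    have hsub : (N : ℝ) - m ≤ ((N - m : ℕ) : ℝ) := by
      rw [sub_le_iff_le_add]; exact_mod_cast (by omega : N ≤ N - m + m)
    have h1 : (N.descFactorial (m + 1) : ℝ) / (N : ℝ) ^ (m + 1) =
        ((N - m : ℕ) : ℝ) / N * ((N.descFactorial m : ℝ) / (N : ℝ) ^ m) := by
      rw [Nat.descFactorial_succ]; push_cast; rw [pow_succ]; field_simp
    have h2 : 1 - (m : ℝ) / N ≤ ((N - m : ℕ) : ℝ) / N := by
      rw [← div_self hN'.ne', ← sub_div]; gcongr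
    have h3 : (0 : ℝ) ≤ m / N := by positivity
    have h4 : ((m + 1 : ℕ) : ℝ) * (((m + 1 : ℕ) : ℝ) - 1) / (2 * (N : ℝ)) =
        (m : ℝ) * ((m : ℝ) - 1) / (2 * (N : ℝ)) + m / N := by
      push_cast; field_simp; ring
    rw [h1, h4]
    nlinarith [mul_le_mul_of_nonneg_right h2 hc0]

theorem ofReal_descFactorial_div {N : ℕ} (hN : 1 ≤ N) (m : ℕ) :
    ENNReal.ofReal ((N.descFactorial m : ℝ) / (N : ℝ) ^ m) =
      ((N : ℝ≥0∞)⁻¹) ^ m * N.descFactorial m := by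
  have hN' : (0 : ℝ) < N := by exact_mod_cast hN
  rw [div_eq_inv_mul, ENNReal.ofReal_mul (by positivity), ENNReal.ofReal_natCast, ← inv_pow,
    ENNReal.ofReal_pow (by positivity), ENNReal.ofReal_inv_of_pos hN', ENNReal.ofReal_natCast]

/-- The average of the tensor powers of the empirical measure of a symmetric law is the marginal of
this law, up to a small positive remainder. -/
theorem exists_remainder {N : ℕ} (hN : 1 ≤ N) (m : ℕ) {P : Measure (Config d N)}
    [IsProbabilityMeasure P] {T : Config d N → Config d N} (hT : Measurable T)
    (hP : IsSymmetric (P.map T)) :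
    ∃ R : Measure (Config d m),
      P.bind (fun Z => tensorPow m (empirical (T Z))) =
        ENNReal.ofReal ((N.descFactorial m : ℝ) / (N : ℝ) ^ m) • marginal m (P.map T) + R ∧
      R Set.univ = ENNReal.ofReal (1 - (N.descFactorial m : ℝ) / (N : ℝ) ^ m) := by
  classical
  have hN' : (0 : ℝ) < N := by exact_mod_cast hN
  have : IsProbabilityMeasure (P.map T) := Measure.isProbabilityMeasure_map hT.aemeasurable
  -- The remainder is the sum over non-injective `ι`, so its positivity is built in; for `m > N`
  -- there are no injections and it is the whole sum.
  refine ⟨((N : ℝ≥0∞)⁻¹) ^ m • ∑ ι : Fin m → Fin N with ¬ Function.Injective ι,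
    (P.map T).map (fun Z i => Z (ι i)), ?_, ?_⟩
  · rw [bind_tensorPow_empirical hN m P hT,
      ← Finset.sum_filter_add_sum_filter_not Finset.univ fun ι : Fin m → Fin N =>
        Function.Injective ι, smul_add]
    congr 1
    rw [Finset.sum_congr rfl fun ι hι => map_comp_injective hP (Finset.mem_filter.1 hι).2,
      Finset.sum_const, card_injective_maps, ofReal_descFactorial_div hN, mul_smul,
      Nat.cast_smul_eq_nsmul]
  · have hone : ∀ ι : Fin m → Fin N, (P.map T).map (fun Z i => Z (ι i)) Set.univ = 1 := fun ι => by
      rw [Measure.map_apply (by fun_prop) MeasurableSet.univ, Set.preimage_univ, measure_univ]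
    have hcard : (Finset.univ.filter fun ι : Fin m → Fin N => ¬ Function.Injective ι).card =
        N ^ m - N.descFactorial m := by
      have := Finset.card_filter_add_card_filter_not (s := (Finset.univ : Finset (Fin m → Fin N)))
        (fun ι => Function.Injective ι)
      rw [card_injective_maps] at this
      simp only [Finset.card_univ, Fintype.card_fun, Fintype.card_fin] at this
      omega
    simp only [Measure.smul_apply, Measure.finsetSum_apply, hone, Finset.sum_const, hcard,
      smul_eq_mul, nsmul_eq_mul, mul_one]
    have : 1 - (N.descFactorial m : ℝ) / (N : ℝ) ^ m =
        ((N : ℝ) ^ m)⁻¹ * ((N ^ m - N.descFactorial m : ℕ) : ℝ) := by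
      rw [Nat.cast_sub (Nat.descFactorial_le_pow N m)]; push_cast; field_simp
    rw [this, ENNReal.ofReal_mul (by positivity), ENNReal.ofReal_natCast, ← inv_pow,
      ENNReal.ofReal_pow (by positivity), ENNReal.ofReal_inv_of_pos hN', ENNReal.ofReal_natCast]

end Symmetric

/-! ### Linear growth of the mean field, and smooth cut-offs of the first moment -/

section FirstMoment

variable {d : ℕ} {K : Phase d → Phase d → Phase d} {L : ℝ≥0}

theorem IsP1.integrable_of_lipschitz {X V : Type*} [NormedAddCommGroup X] [MeasurableSpace X]
    [BorelSpace X] [SecondCountableTopology X] [NormedAddCommGroup V] [SecondCountableTopology V]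
    {ν : Measure X} (hν : IsP1 ν) {g : X → V}
    {C : ℝ≥0} (hg : LipschitzWith C g) : Integrable g ν := by
  have := hν.1
  refine Integrable.mono' ((hν.2.const_mul C).add (integrable_const ‖g 0‖))
    hg.continuous.aestronglyMeasurable (ae_of_all _ fun x => ?_)
  have := hg.dist_le_mul x 0
  rw [dist_eq_norm, dist_zero_right] at this
  have h2 := norm_sub_norm_le (g x) (g 0)
  simp only [Pi.add_apply]
  linarith

theorem lipschitzWith_meanField (h1 : ∀ z', LipschitzWith L (fun z => K z z'))
    (h2 : ∀ z, LipschitzWith L (fun z' => K z z')) {ν : Measure (Phase d)} (hν : IsP1 ν) :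
    LipschitzWith L (meanField K ν) := by
  have := hν.1
  refine LipschitzWith.of_dist_le_mul fun z w => ?_
  rw [dist_eq_norm, meanField, meanField,
    ← integral_sub (hν.integrable_of_lipschitz (h2 z)) (hν.integrable_of_lipschitz (h2 w))]
  refine (norm_integral_le_of_norm_le_const (C := L * dist z w) (ae_of_all _ fun z' => ?_)).trans
    (by simp)
  rw [← dist_eq_norm]
  exact (h1 z').dist_le_mul z w

/-- Antisymmetry enters through `K 0 0 = 0`, which turns the Lipschitz bounds into linear growth. -/
theorem norm_kernel_le (h0 : ∀ z z', K z z' + K z' z = 0)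
    (h1 : ∀ z', LipschitzWith L (fun z => K z z'))
    (h2 : ∀ z, LipschitzWith L (fun z' => K z z')) (z z' : Phase d) :
    ‖K z z'‖ ≤ L * (‖z‖ + ‖z'‖) := by
  have hK : K 0 0 = 0 := by
    have := h0 0 0
    rwa [← two_smul ℝ, smul_eq_zero_iff_right two_ne_zero] at this
  simpa [hK] using dist_kernel_le h1 h2 z z' 0 0

theorem norm_meanField_le (h0 : ∀ z z', K z z' + K z' z = 0)
    (h1 : ∀ z', LipschitzWith L (fun z => K z z'))
    (h2 : ∀ z, LipschitzWith L (fun z' => K z z')) {ν : Measure (Phase d)} (hν : IsP1 ν)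
    (z : Phase d) : ‖meanField K ν z‖ ≤ L * (‖z‖ + ∫ z', ‖z'‖ ∂ν) := by
  have := hν.1
  refine (norm_integral_le_of_norm_le (((integrable_const ‖z‖).add hν.2).const_mul (L : ℝ))
    (ae_of_all _ fun z' => norm_kernel_le h0 h1 h2 z z')).trans_eq ?_
  rw [integral_const_mul, integral_add' (integrable_const _) hν.2]
  simp

theorem sqrt_one_add_norm_sq_le {V : Type*} [SeminormedAddCommGroup V] (z : V) :
    √(1 + ‖z‖ ^ 2) ≤ 1 + ‖z‖ := by
  rw [Real.sqrt_le_left (by positivity)]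
  nlinarith [norm_nonneg z]

/-- The weight `√(1 + |z|²)` is a smooth stand-in for `|z|`. Truncating it at scale `n + 1` gives
admissible test functions whose gradients are bounded uniformly in `n`, because the gradient of the
cut-off decays like the inverse of the scale on which the weight is large. -/
theorem exists_cutoff_moment (d : ℕ) : ∃ C : ℝ, 0 ≤ C ∧ ∃ φ : ℕ → Phase d → ℝ,
    (∀ n, ContDiff ℝ ∞ (φ n)) ∧ (∀ n, HasCompactSupport (φ n)) ∧
    (∀ n z, |φ n z| ≤ √(1 + ‖z‖ ^ 2)) ∧ (∀ n z, ‖fderiv ℝ (φ n) z‖ ≤ C) ∧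
    ∀ z, Filter.Tendsto (fun n => φ n z) Filter.atTop (nhds √(1 + ‖z‖ ^ 2)) := by
  let χ : ContDiffBump (0 : Phase d) := ⟨1, 2, one_pos, one_lt_two⟩
  have hχ : ContDiff ℝ ∞ χ := χ.contDiff
  have hχc : HasCompactSupport χ := χ.hasCompactSupport
  obtain ⟨C, hC⟩ := (hχc.fderiv (𝕜 := ℝ)).exists_bound_of_continuous
    (hχ.continuous_fderiv (by simp))
  have hC0 : 0 ≤ C := (norm_nonneg _).trans (hC 0)
  have hpos : ∀ z : Phase d, 0 < 1 + ‖z‖ ^ 2 := fun z => by positivity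
  have hJ : ContDiff ℝ ∞ fun z : Phase d => √(1 + ‖z‖ ^ 2) :=
    (contDiff_const.add (contDiff_norm_sq ℝ)).sqrt fun z => (hpos z).ne'
  have hJle : ∀ z : Phase d, √(1 + ‖z‖ ^ 2) ≤ 1 + ‖z‖ := sqrt_one_add_norm_sq_le
  have hJL : LipschitzWith 1 fun z : Phase d => √(1 + ‖z‖ ^ 2) := by
    refine LipschitzWith.of_dist_le_mul fun z w => ?_
    rw [Real.dist_eq, NNReal.coe_one, one_mul, abs_le]
    have key : ∀ z w : Phase d, √(1 + ‖z‖ ^ 2) ≤ √(1 + ‖w‖ ^ 2) + dist z w := fun z w => by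
      have hw : ‖w‖ ≤ √(1 + ‖w‖ ^ 2) := Real.le_sqrt_of_sq_le (by linarith)
      have hz : ‖z‖ ≤ ‖w‖ + dist z w := by
        rw [dist_eq_norm]; linarith [norm_sub_norm_le z w]
      have hsq := Real.sq_sqrt (hpos w).le
      rw [Real.sqrt_le_left (by positivity)]
      nlinarith [norm_nonneg z, norm_nonneg w, dist_nonneg (x := z) (y := w)]
    constructor
    · have := key w z; rw [dist_comm] at this; linarith
    · linarith [key z w]
  have hsc : ∀ n : ℕ, (0 : ℝ) < (n + 1 : ℝ)⁻¹ := fun n => by positivity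
  refine ⟨1 + 3 * C, by positivity, fun n z => χ ((n + 1 : ℝ)⁻¹ • z) * √(1 + ‖z‖ ^ 2),
    fun n => (hχ.comp (contDiff_const_smul _)).mul hJ,
    fun n => (hχc.comp_smul (hsc n).ne').mul_right, fun n z => ?_, fun n z => ?_, fun z => ?_⟩
  · rw [abs_mul, abs_of_nonneg χ.nonneg, abs_of_nonneg (Real.sqrt_nonneg _)]
    exact mul_le_of_le_one_left (Real.sqrt_nonneg _) χ.le_one
  · have hd : HasFDerivAt (fun z : Phase d => χ ((n + 1 : ℝ)⁻¹ • z))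
        ((fderiv ℝ χ ((n + 1 : ℝ)⁻¹ • z)).comp
          ((n + 1 : ℝ)⁻¹ • ContinuousLinearMap.id ℝ (Phase d))) z :=
      HasFDerivAt.comp (f := fun z => (n + 1 : ℝ)⁻¹ • z) z
        ((hχ.differentiable (by simp)) _).hasFDerivAt
        ((n + 1 : ℝ)⁻¹ • ContinuousLinearMap.id ℝ (Phase d)).hasFDerivAt
    have hdJ := ((hJ.differentiable (by simp)) z).hasFDerivAt
    refine (congrArg norm (hd.mul hdJ).fderiv).trans_le ?_
    have hdJn : ‖fderiv ℝ (fun z : Phase d => √(1 + ‖z‖ ^ 2)) z‖ ≤ 1 := by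
      simpa using norm_fderiv_le_of_lipschitz ℝ hJL (x₀ := z)
    have e1 : ‖χ ((n + 1 : ℝ)⁻¹ • z) • fderiv ℝ (fun z : Phase d => √(1 + ‖z‖ ^ 2)) z‖ ≤ 1 := by
      rw [norm_smul, Real.norm_of_nonneg χ.nonneg]
      exact mul_le_one₀ χ.le_one (norm_nonneg _) hdJn
    have e2 : ‖√(1 + ‖z‖ ^ 2) • (fderiv ℝ χ ((n + 1 : ℝ)⁻¹ • z)).comp
          ((n + 1 : ℝ)⁻¹ • ContinuousLinearMap.id ℝ (Phase d))‖ ≤ 3 * C := by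
      rw [ContinuousLinearMap.comp_smul, ContinuousLinearMap.comp_id, norm_smul, norm_smul,
        Real.norm_of_nonneg (Real.sqrt_nonneg _), Real.norm_of_nonneg (hsc n).le]
      -- On the support of the cut-off the weight is at most `1 + 2 (n + 1) ≤ 3 (n + 1)`, whence the
      -- constant `3 C`; off the support the derivative vanishes.
      by_cases hz : ‖z‖ ≤ 2 * (n + 1)
      · have h3 : √(1 + ‖z‖ ^ 2) * (n + 1 : ℝ)⁻¹ ≤ 3 := by
          rw [← div_eq_mul_inv, div_le_iff₀ (by positivity)]
          linarith [hJle z, (Nat.cast_nonneg n : (0 : ℝ) ≤ n)]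
        rw [← mul_assoc]
        exact mul_le_mul h3 (hC _) (norm_nonneg _) (by norm_num)
      · have : fderiv ℝ χ ((n + 1 : ℝ)⁻¹ • z) = 0 := by
          refine image_eq_zero_of_notMem_tsupport fun hmem => hz ?_
          have := tsupport_fderiv_subset ℝ hmem
          rw [χ.tsupport_eq, mem_closedBall_zero_iff, norm_smul,
            Real.norm_of_nonneg (hsc n).le, inv_mul_le_iff₀ (by positivity)] at this
          change ‖z‖ ≤ (n + 1) * 2 at this
          linarith
        rw [this, norm_zero]
        simp only [mul_zero]
        positivity
    exact (norm_add_le _ _).trans (add_le_add e1 e2)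
  · refine tendsto_const_nhds.congr' ?_
    obtain ⟨N, hN⟩ := exists_nat_ge ‖z‖
    filter_upwards [Filter.eventually_ge_atTop N] with n hn
    rw [χ.one_of_mem_closedBall, one_mul]
    rw [mem_closedBall_zero_iff, norm_smul, Real.norm_of_nonneg (hsc n).le,
      inv_mul_le_iff₀ (by positivity)]
    change ‖z‖ ≤ (n + 1) * 1
    have : (N : ℝ) ≤ n := by exact_mod_cast hn
    linarith

end FirstMoment

/-! ### Time regularity of weak solutions and of their mean field -/

section WeakSolution

variable {d : ℕ} {K : Phase d → Phase d → Phase d} {L : ℝ≥0} {μin : Measure (Phase d)}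
  {μ : ℝ → Measure (Phase d)}

/-- By the portmanteau theorem `t ↦ μ t U` is lower semicontinuous for open `U`, and open sets form
a generating π-system. This makes `μ` a Markov kernel, so that integrals against `μ s` are
measurable in `s`. -/
theorem IsWeakSolution.measurable (hμ : IsWeakSolution K μin μ) : Measurable μ := by
  have hp : ∀ t, IsProbabilityMeasure (μ t) := fun t => (hμ.isP1 t).1
  let P : ℝ → ProbabilityMeasure (Phase d) := fun t => ⟨μ t, hp t⟩
  have hP : Continuous P := by
    rw [continuous_iff_continuousAt]
    exact fun t => ProbabilityMeasure.tendsto_iff_forall_integral_tendsto.2 fun φ =>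
      (hμ.continuous φ).continuousAt
  refine Measurable.measure_of_isPiSystem_of_isProbabilityMeasure
    (S := {s : Set (Phase d) | IsOpen s}) (BorelSpace.measurable_eq) isPiSystem_isOpen
    fun U hU => ?_
  have : LowerSemicontinuous fun t => μ t U := by
    rw [lowerSemicontinuous_iff_le_liminf]
    exact fun t => ProbabilityMeasure.le_liminf_measure_open_of_tendsto (hP.tendsto t) hU
  exact this.measurable

theorem IsWeakSolution.aestronglyMeasurable_transport (hμ : IsWeakSolution K μin μ)
    (h1 : ∀ z', LipschitzWith L (fun z => K z z'))
    (h2 : ∀ z, LipschitzWith L (fun z' => K z z'))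
    {φ : Phase d → ℝ} (hφ : Continuous (fderiv ℝ φ)) :
    StronglyMeasurable fun s => ∫ z, fderiv ℝ φ z (meanField K (μ s) z) ∂(μ s) := by
  have hp : ∀ t, IsProbabilityMeasure (μ t) := fun t => (hμ.isP1 t).1
  let κ : ProbabilityTheory.Kernel ℝ (Phase d) := ⟨μ, hμ.measurable⟩
  have : ProbabilityTheory.IsMarkovKernel κ := ⟨hp⟩
  have hin : StronglyMeasurable fun q : ℝ × Phase d => meanField K (μ q.1) q.2 := by
    have hK : StronglyMeasurable fun r : (ℝ × Phase d) × Phase d => K r.1.2 r.2 :=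
      ((continuous_kernel h1 h2).comp
        ((continuous_snd.comp continuous_fst).prodMk continuous_snd)).stronglyMeasurable
    exact hK.integral_kernel_prod_right' (κ := κ.comap Prod.fst measurable_fst)
  have hout : StronglyMeasurable fun q : ℝ × Phase d =>
      fderiv ℝ φ q.2 (meanField K (μ q.1) q.2) := by
    have hc : Continuous fun r : (Phase d →L[ℝ] ℝ) × Phase d => r.1 r.2 := by fun_prop
    exact hc.comp_stronglyMeasurable
      (((hφ.comp continuous_snd).stronglyMeasurable).prodMk hin)
  exact hout.integral_kernel_prod_right' (κ := κ)

/-- Weak continuity says nothing about unbounded functions. Testing the equation with the cut-off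
weights bounds their increments by the integral of the first moment over the time interval,
uniformly in `n`; local integrability of the moment then yields continuity in the limit. -/
theorem continuous_moment (hμ : IsWeakSolution K μin μ)
    (h0 : ∀ z z', K z z' + K z' z = 0)
    (h1 : ∀ z', LipschitzWith L (fun z => K z z'))
    (h2 : ∀ z, LipschitzWith L (fun z' => K z z')) :
    Continuous fun t => ∫ z, √(1 + ‖z‖ ^ 2) ∂(μ t) := by
  have hp : ∀ t, IsProbabilityMeasure (μ t) := fun t => (hμ.isP1 t).1
  obtain ⟨C, hC0, φ, hφs, hφc, hφle, hφd, hφt⟩ := exists_cutoff_moment d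
  have hbound : ∀ n s, ‖∫ z, fderiv ℝ (φ n) z (meanField K (μ s) z) ∂(μ s)‖ ≤
      C * L * 2 * ∫ z, ‖z‖ ∂(μ s) := fun n s => by
    have hi := (hμ.isP1 s).2
    refine (norm_integral_le_of_norm_le (g := fun z => C * (L * (‖z‖ + ∫ z', ‖z'‖ ∂(μ s))))
      (((hi.add (integrable_const _)).const_mul _).const_mul _) (ae_of_all _ fun z => ?_)).trans_eq ?_
    · exact (ContinuousLinearMap.le_opNorm _ _).trans (mul_le_mul (hφd n z)
        (norm_meanField_le h0 h1 h2 (hμ.isP1 s) z) (norm_nonneg _) hC0)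
    · rw [integral_const_mul, integral_const_mul, integral_add hi (integrable_const _)]
      simp only [integral_const, probReal_univ, one_smul]
      ring
  have hmi : ∀ a b, IntervalIntegrable (fun s => C * L * 2 * ∫ z, ‖z‖ ∂(μ s)) volume a b :=
    fun a b => ((hμ.moment.integrableOn_isCompact isCompact_uIcc).intervalIntegrable).const_mul _
  have hint : ∀ n a b, IntervalIntegrable
      (fun s => ∫ z, fderiv ℝ (φ n) z (meanField K (μ s) z) ∂(μ s)) volume a b := fun n a b =>
    (hmi a b).mono_fun (hμ.aestronglyMeasurable_transport h1 h2
      ((hφs n).continuous_fderiv (by simp))).aestronglyMeasurable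
      (ae_of_all _ fun s => (hbound n s).trans (le_abs_self _))
  have hdiff : ∀ n s t, |∫ z, φ n z ∂(μ t) - ∫ z, φ n z ∂(μ s)| ≤
      |∫ r in s..t, C * L * 2 * ∫ z, ‖z‖ ∂(μ r)| := fun n s t => by
    have e : ∫ z, φ n z ∂(μ t) - ∫ z, φ n z ∂(μ s) =
        ∫ r in s..t, ∫ z, fderiv ℝ (φ n) z (meanField K (μ r) z) ∂(μ r) := by
      rw [← intervalIntegral.integral_interval_sub_left (hint n 0 t) (hint n 0 s),
        ← hμ.equation _ (hφs n) (hφc n) t, ← hμ.equation _ (hφs n) (hφc n) s]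
      ring
    rw [e]
    exact intervalIntegral.norm_integral_le_abs_of_norm_le (ae_of_all _ fun r => hbound n r)
      (hmi s t)
  have hJi : ∀ t, Integrable (fun z : Phase d => √(1 + ‖z‖ ^ 2)) (μ t) := fun t => by
    refine ((integrable_const (1 : ℝ)).add (hμ.isP1 t).2).mono' (by fun_prop) (ae_of_all _ fun z => ?_)
    rw [Real.norm_of_nonneg (Real.sqrt_nonneg _)]
    exact sqrt_one_add_norm_sq_le z
  have hlim : ∀ t, Filter.Tendsto (fun n => ∫ z, φ n z ∂(μ t)) Filter.atTop
      (nhds (∫ z, √(1 + ‖z‖ ^ 2) ∂(μ t))) := fun t =>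
    tendsto_integral_of_dominated_convergence _
      (fun n => (hφs n).continuous.aestronglyMeasurable) (hJi t)
      (fun n => ae_of_all _ fun z => hφle n z) (ae_of_all _ fun z => hφt z)
  have hJ : ∀ s t, |∫ z, √(1 + ‖z‖ ^ 2) ∂(μ t) - ∫ z, √(1 + ‖z‖ ^ 2) ∂(μ s)| ≤
      |∫ r in s..t, C * L * 2 * ∫ z, ‖z‖ ∂(μ r)| := fun s t =>
    le_of_tendsto (((hlim t).sub (hlim s)).abs) (Filter.Eventually.of_forall fun n => hdiff n s t)
  rw [continuous_iff_continuousAt]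
  intro s
  rw [ContinuousAt, tendsto_iff_dist_tendsto_zero]
  have hc : Continuous fun t => |∫ r in s..t, C * L * 2 * ∫ z, ‖z‖ ∂(μ r)| :=
    (intervalIntegral.continuous_primitive hmi s).abs
  have h := hc.tendsto s
  simp only [intervalIntegral.integral_same, abs_zero] at h
  exact squeeze_zero (fun _ => dist_nonneg) (fun t => hJ s t) h

/-- A uniform integrability argument: continuity of the integral of the weight prevents mass from
escaping to infinity, so clamping `g` at height `n` is an error that is small uniformly for `t` near
`t₀`. -/
theorem continuous_integral_of_linear_growth {μ : ℝ → Measure (Phase d)} (hP : ∀ t, IsP1 (μ t))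
    (hc : ∀ φ : Phase d →ᵇ ℝ, Continuous fun t => ∫ z, φ z ∂(μ t))
    (hm : Continuous fun t => ∫ z, √(1 + ‖z‖ ^ 2) ∂(μ t)) {g : Phase d → ℝ} (hg : Continuous g)
    {C : ℝ} (hgC : ∀ z, |g z| ≤ C * √(1 + ‖z‖ ^ 2)) :
    Continuous fun t => ∫ z, g z ∂(μ t) := by
  have hp : ∀ t, IsProbabilityMeasure (μ t) := fun t => (hP t).1
  have hJi : ∀ t, Integrable (fun z : Phase d => √(1 + ‖z‖ ^ 2)) (μ t) := fun t => by
    refine ((integrable_const (1 : ℝ)).add (hP t).2).mono' (by fun_prop) (ae_of_all _ fun z => ?_)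
    rw [Real.norm_of_nonneg (Real.sqrt_nonneg _)]
    exact sqrt_one_add_norm_sq_le z
  have hgi : ∀ t, Integrable g (μ t) := fun t =>
    ((hJi t).const_mul C).mono' hg.aestronglyMeasurable (ae_of_all _ hgC)
  have hC0 : 0 ≤ C := by
    have := (abs_nonneg _).trans (hgC 0)
    simpa using this
  set q : Phase d → ℝ := fun z => C * √(1 + ‖z‖ ^ 2) with hq
  have hq0 : ∀ z, 0 ≤ q z := fun z => by positivity
  have hqc : Continuous q := by fun_prop
  have hqi : ∀ t, Integrable q (μ t) := fun t => (hJi t).const_mul C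
  have hqm : Continuous fun t => ∫ z, q z ∂(μ t) := by
    simp only [hq, integral_const_mul]
    exact hm.const_mul C
  have clampc : ∀ (h : Phase d → ℝ), Continuous h → ∀ n : ℕ,
      Continuous fun t => ∫ z, max (-n : ℝ) (min (h z) n) ∂(μ t) := fun h hh n => by
    let ψ : Phase d →ᵇ ℝ := BoundedContinuousFunction.ofNormedAddCommGroup
      (fun z => max (-n : ℝ) (min (h z) n)) (by fun_prop) n (fun z => by
        rw [Real.norm_eq_abs, abs_le]
        exact ⟨le_max_left _ _, max_le (by linarith [(Nat.cast_nonneg n : (0 : ℝ) ≤ n)])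
          (min_le_right _ _)⟩)
    exact hc ψ
  have clampi : ∀ (h : Phase d → ℝ), Continuous h → ∀ (n : ℕ) t,
      Integrable (fun z => max (-n : ℝ) (min (h z) n)) (μ t) := fun h hh n t => by
    refine (integrable_const (n : ℝ)).mono' (by fun_prop) (ae_of_all _ fun z => ?_)
    rw [Real.norm_eq_abs, abs_le]
    exact ⟨le_max_left _ _, max_le (by linarith [(Nat.cast_nonneg n : (0 : ℝ) ≤ n)])
      (min_le_right _ _)⟩
  -- The left side is the positive part of `|g| - n` and the right side that of `q - n`, with `|g| ≤
  -- q`.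
  have herr : ∀ (n : ℕ) z, |g z - max (-n : ℝ) (min (g z) n)| ≤
      q z - max (-n : ℝ) (min (q z) n) := fun n z => by
    have h1 := abs_le.1 (hgC z)
    have h2 := hq0 z
    have h3 : (0 : ℝ) ≤ n := Nat.cast_nonneg n
    change -q z ≤ g z ∧ g z ≤ q z at h1
    rw [max_eq_right (a := -(n : ℝ)) (b := min (q z) n) (by
      rw [le_min_iff]; constructor <;> linarith)]
    rw [abs_le]
    rcases le_total (g z) n with h | h <;> rcases le_total (q z) n with h' | h' <;>
      rcases le_total (-(n : ℝ)) (g z) with h'' | h'' <;>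
      simp only [min_eq_left h, min_eq_right h, min_eq_left h', min_eq_right h'] <;>
      constructor <;>
      first
      | linarith [le_max_left (-(n : ℝ)) (g z), le_max_right (-(n : ℝ)) (g z),
          max_le (a := -(n : ℝ)) (b := g z) (c := g z) (by assumption) le_rfl]
      | linarith [le_max_left (-(n : ℝ)) (g z), le_max_right (-(n : ℝ)) (g z),
          max_le (a := -(n : ℝ)) (b := g z) (c := -(n : ℝ)) le_rfl (by assumption)]
      | linarith [le_max_left (-(n : ℝ)) (n : ℝ), le_max_right (-(n : ℝ)) (n : ℝ),
          max_le (a := -(n : ℝ)) (b := (n : ℝ)) (c := (n : ℝ)) (by linarith) le_rfl]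
  rw [continuous_iff_continuousAt]
  intro t₀
  refine continuousAt_of_locally_uniform_approx_of_continuousAt fun u hu => ?_
  obtain ⟨ε, hε, hεu⟩ := Metric.mem_uniformity_dist.1 hu
  have htend : Filter.Tendsto (fun n : ℕ => ∫ z, max (-n : ℝ) (min (q z) n) ∂(μ t₀)) Filter.atTop
      (nhds (∫ z, q z ∂(μ t₀))) := by
    refine tendsto_integral_of_dominated_convergence q
      (fun n => (clampi q hqc n t₀).aestronglyMeasurable) (hqi t₀)
      (fun n => ae_of_all _ fun z => ?_) (ae_of_all _ fun z => ?_)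
    · have h3 : (0 : ℝ) ≤ n := Nat.cast_nonneg n
      rw [Real.norm_eq_abs, abs_le]
      exact ⟨le_max_of_le_right (le_min (by linarith [hq0 z]) (by linarith [hq0 z])),
        max_le (by linarith [hq0 z]) (min_le_left _ _)⟩
    · refine tendsto_const_nhds.congr' ?_
      obtain ⟨N, hN⟩ := exists_nat_ge (q z)
      filter_upwards [Filter.eventually_ge_atTop N] with n hn
      have : (N : ℝ) ≤ n := by exact_mod_cast hn
      rw [min_eq_left (by linarith), max_eq_right (by linarith [hq0 z])]
  -- The level `n` is chosen at the single time `t₀`; for this fixed level the tail of `q` is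
  -- continuous in `t`, hence still below `ε` nearby.
  obtain ⟨n, hn⟩ := (htend.eventually (lt_mem_nhds (sub_lt_self _ hε))).exists
  have hev : ∀ᶠ t in nhds t₀, ∫ z, q z ∂(μ t) - ∫ z, max (-n : ℝ) (min (q z) n) ∂(μ t) < ε :=
    ((hqm.sub (clampc q hqc n)).tendsto t₀).eventually (gt_mem_nhds (by
      change _ - _ < ε; linarith))
  refine ⟨_, hev, fun t => ∫ z, max (-n : ℝ) (min (g z) n) ∂(μ t),
    (clampc g hg n).continuousAt, fun t ht => hεu ?_⟩
  change _ < ε at ht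
  refine lt_of_le_of_lt ?_ ht
  rw [Real.dist_eq, ← integral_sub (hgi t) (clampi g hg n t),
    ← integral_sub (hqi t) (clampi q hqc n t)]
  have hi : Integrable (fun z => q z - max (-n : ℝ) (min (q z) n)) (μ t) :=
    (hqi t).sub (clampi q hqc n t)
  exact norm_integral_le_of_norm_le (f := fun z => g z - max (-n : ℝ) (min (g z) n)) hi
    (ae_of_all _ fun z => herr n z)

theorem continuous_meanField (hμ : IsWeakSolution K μin μ)
    (h0 : ∀ z z', K z z' + K z' z = 0)
    (h1 : ∀ z', LipschitzWith L (fun z => K z z'))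
    (h2 : ∀ z, LipschitzWith L (fun z' => K z z')) (z : Phase d) :
    Continuous fun t => meanField K (μ t) z := by
  have hco : ∀ i, Continuous fun t => (meanField K (μ t) z) i := fun i => by
    have e : ∀ t, (meanField K (μ t) z) i = ∫ z', (K z z') i ∂(μ t) := fun t =>
      ((EuclideanSpace.proj (𝕜 := ℝ) i).integral_comp_comm
        ((hμ.isP1 t).integrable_of_lipschitz (h2 z))).symm
    simp only [e]
    refine continuous_integral_of_linear_growth hμ.isP1 hμ.continuous (continuous_moment hμ h0 h1 h2)
      ((EuclideanSpace.proj (𝕜 := ℝ) i).continuous.comp (h2 z).continuous)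
      (C := L * (‖z‖ + 1)) fun z' => ?_
    have hJ1 : 1 ≤ √(1 + ‖z'‖ ^ 2) := Real.le_sqrt_of_sq_le (by nlinarith [norm_nonneg z'])
    have hJ2 : ‖z'‖ ≤ √(1 + ‖z'‖ ^ 2) := Real.le_sqrt_of_sq_le (by linarith)
    calc |(K z z') i| ≤ ‖K z z'‖ := PiLp.norm_apply_le (K z z') i
      _ ≤ L * (‖z‖ + ‖z'‖) := norm_kernel_le h0 h1 h2 z z'
      _ ≤ L * ((‖z‖ + 1) * √(1 + ‖z'‖ ^ 2)) := by
          gcongr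
          nlinarith [norm_nonneg z]
      _ = _ := by ring
  exact (PiLp.continuous_toLp 2 _).comp (continuous_pi hco)

theorem continuous_uncurry_of_lipschitz {X Y : Type*} [PseudoMetricSpace X] [PseudoMetricSpace Y]
    {b : ℝ → X → Y} {L : ℝ≥0} (hL : ∀ t, LipschitzWith L (b t))
    (hc : ∀ z, Continuous fun t => b t z) : Continuous fun p : ℝ × X => b p.1 p.2 :=
  continuous_prod_of_continuous_lipschitzWith' (fun p : ℝ × X => b p.1 p.2) L hL hc

theorem eventually_forall_dist_lt {X Y : Type*} [TopologicalSpace X] [PseudoMetricSpace Y]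
    {F : ℝ → X → Y} {S : Set X} (hS : IsCompact S) (t₀ : ℝ)
    (hF : ∀ z ∈ S, ContinuousAt (fun p : ℝ × X => F p.1 p.2) (t₀, z)) {δ : ℝ} (hδ : 0 < δ) :
    ∀ᶠ s in nhds t₀, ∀ z ∈ S, dist (F s z) (F t₀ z) < δ := by
  refine hS.eventually_forall_of_forall_eventually fun z hz => ?_
  have hc : ContinuousAt (fun p : ℝ × X => dist (F p.1 p.2) (F t₀ p.2)) (t₀, z) :=
    (hF z hz).dist (ContinuousAt.comp (f := fun p : ℝ × X => (t₀, p.2)) (x := (t₀, z)) (hF z hz)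
      (by fun_prop))
  exact hc.eventually (gt_mem_nhds (by simpa using hδ))

/-- A family of curves is differentiable at a given time, uniformly on compact sets of parameters,
if the derivatives are jointly continuous at that time. -/
theorem eventually_forall_norm_sub_le {X V : Type*} [TopologicalSpace X] [NormedAddCommGroup V]
    [NormedSpace ℝ V] {q q' : ℝ → X → V} {S : Set X} (hS : IsCompact S) (t : ℝ)
    (hq : ∀ z ∈ S, ∀ s, HasDerivAt (fun s => q s z) (q' s z) s)
    (hq' : ∀ z ∈ S, ContinuousAt (fun p : ℝ × X => q' p.1 p.2) (t, z)) {δ : ℝ} (hδ : 0 < δ) :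
    ∀ᶠ h in nhds (0 : ℝ), ∀ z ∈ S, ‖q (t + h) z - q t z - h • q' t z‖ ≤ δ * |h| := by
  obtain ⟨η, hη, hball⟩ := Metric.eventually_nhds_iff_ball.1
    (eventually_forall_dist_lt hS t hq' hδ)
  filter_upwards [Metric.ball_mem_nhds (0 : ℝ) hη] with h hh z hz
  have hder : ∀ s ∈ Metric.ball t η, HasDerivWithinAt (fun s => q s z - (s - t) • q' t z)
      (q' s z - q' t z) (Metric.ball t η) s := fun s _ => by
    have h1 := ((hasDerivAt_id s).sub_const t).smul_const (q' t z)
    rw [one_smul] at h1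
    exact ((hq z hz s).sub h1).hasDerivWithinAt
  have hth : t + h ∈ Metric.ball t η := by simpa [Metric.mem_ball, dist_eq_norm] using hh
  have := (convex_ball t η).norm_image_sub_le_of_norm_hasDerivWithin_le (C := δ) hder
    (fun s hs => by rw [← dist_eq_norm]; exact (hball s hs z hz).le)
    (Metric.mem_ball_self hη) hth
  simp only [sub_self, zero_smul, sub_zero, add_sub_cancel_left, Real.norm_eq_abs] at this
  rwa [sub_right_comm]

/-- The weak formulation is integrated in time. Its integrand is continuous: the transported
gradients converge uniformly on the support of `φ`, and for a frozen gradient weak continuity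
applies. The fundamental theorem of calculus then differentiates it. -/
theorem hasDerivAt_integral_test (hμ : IsWeakSolution K μin μ)
    (h0 : ∀ z z', K z z' + K z' z = 0)
    (h1 : ∀ z', LipschitzWith L (fun z => K z z'))
    (h2 : ∀ z, LipschitzWith L (fun z' => K z z'))
    {φ : Phase d → ℝ} (hφ : ContDiff ℝ ∞ φ) (hφc : HasCompactSupport φ) (t : ℝ) :
    HasDerivAt (fun s => ∫ z, φ z ∂(μ s)) (∫ z, fderiv ℝ φ z (meanField K (μ t) z) ∂(μ t)) t := by
  have hp : ∀ t, IsProbabilityMeasure (μ t) := fun t => (hμ.isP1 t).1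
  have hb : Continuous fun p : ℝ × Phase d => meanField K (μ p.1) p.2 :=
    continuous_uncurry_of_lipschitz (fun s => lipschitzWith_meanField h1 h2 (hμ.isP1 s))
      (fun z => continuous_meanField hμ h0 h1 h2 z)
  have hD : Continuous (fderiv ℝ φ) := hφ.continuous_fderiv (by simp)
  have hH : Continuous fun p : ℝ × Phase d => fderiv ℝ φ p.2 (meanField K (μ p.1) p.2) :=
    (hD.comp continuous_snd).clm_apply hb
  have hsupp : ∀ s, ∀ z ∉ tsupport φ, fderiv ℝ φ z (meanField K (μ s) z) = 0 := fun s z hz => by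
    rw [image_eq_zero_of_notMem_tsupport fun h => hz (tsupport_fderiv_subset ℝ h)]
    rfl
  have hHc : ∀ s, Continuous fun z => fderiv ℝ φ z (meanField K (μ s) z) := fun s =>
    hH.comp (continuous_const.prodMk continuous_id)
  have hHs : ∀ s, HasCompactSupport fun z => fderiv ℝ φ z (meanField K (μ s) z) := fun s =>
    HasCompactSupport.intro hφc (hsupp s)
  have hHi : ∀ s r, Integrable (fun z => fderiv ℝ φ z (meanField K (μ s) z)) (μ r) := fun s r =>
    (hHc s).integrable_of_hasCompactSupport (hHs s)
  have hcont : Continuous fun s => ∫ z, fderiv ℝ φ z (meanField K (μ s) z) ∂(μ s) := by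
    rw [continuous_iff_continuousAt]
    intro s₀
    refine continuousAt_of_locally_uniform_approx_of_continuousAt fun u hu => ?_
    obtain ⟨ε, hε, hεu⟩ := Metric.mem_uniformity_dist.1 hu
    let ψ : Phase d →ᵇ ℝ := BoundedContinuousFunction.ofNormedAddCommGroup _ (hHc s₀)
      ((hHs s₀).exists_bound_of_continuous (hHc s₀)).choose
      ((hHs s₀).exists_bound_of_continuous (hHc s₀)).choose_spec
    refine ⟨_, eventually_forall_dist_lt
      (F := fun s z => fderiv ℝ φ z (meanField K (μ s) z)) hφc s₀ (fun z _ => hH.continuousAt)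
      (half_pos hε), fun s => ∫ z, ψ z ∂(μ s),
      (hμ.continuous ψ).continuousAt, fun s hs => hεu ?_⟩
    refine lt_of_le_of_lt ?_ (half_lt_self hε)
    rw [dist_eq_norm]
    change ‖_ - ∫ z, fderiv ℝ φ z (meanField K (μ s₀) z) ∂(μ s)‖ ≤ _
    rw [← integral_sub (hHi s s) (hHi s₀ s)]
    refine (norm_integral_le_of_norm_le_const (C := ε / 2) (ae_of_all _ fun z => ?_)).trans
      (by simp)
    by_cases hz : z ∈ tsupport φ
    · rw [← dist_eq_norm]
      exact (hs z hz).le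
    · rw [hsupp s z hz, hsupp s₀ z hz]
      simpa using (half_pos hε).le
  have hder := hcont.integral_hasStrictDerivAt 0 t
  refine (hder.hasDerivAt.const_add (∫ z, φ z ∂(μ 0))).congr_of_eventuallyEq
    (Filter.Eventually.of_forall fun s => ?_)
  change _ = ∫ z, φ z ∂(μ 0) + _
  rw [← hμ.equation φ hφ hφc s]
  ring

end WeakSolution

/-! ### A mean value inequality and first-order expansions of the characteristics -/

section Transport

open Filter Topology

/-- A mean value inequality without differentiability. It will be applied to `t ↦ ∫ g t ∂(μ t)`, for
which only a local bound on the increments is established. -/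
theorem abs_sub_le_of_eventually_abs_sub_le {f : ℝ → ℝ} {a b c : ℝ} (hab : a ≤ b)
    (hf : ∀ t ∈ Set.Icc a b, ∀ δ > 0, ∀ᶠ h in 𝓝 (0 : ℝ), |f (t + h) - f t| ≤ (c + δ) * |h|) :
    |f b - f a| ≤ c * (b - a) := by
  have hcont : ContinuousOn f (Set.Icc a b) := fun t ht => by
    refine ContinuousAt.continuousWithinAt ?_
    have h0 : Tendsto (fun h => f (t + h)) (𝓝 0) (𝓝 (f t)) := by
      rw [tendsto_iff_dist_tendsto_zero]
      refine squeeze_zero' (Eventually.of_forall fun _ => dist_nonneg) (hf t ht 1 one_pos) ?_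
      have : Continuous fun h : ℝ => (c + 1) * |h| := by fun_prop
      simpa using this.tendsto 0
    have h1 : Tendsto (fun s => s - t) (𝓝 t) (𝓝 0) := by
      have : Continuous fun s : ℝ => s - t := by fun_prop
      simpa using this.tendsto t
    simpa [ContinuousAt, Function.comp_def] using h0.comp h1
  have key : ∀ δ > 0, |f b - f a| ≤ (c + δ) * (b - a) := fun δ hδ => by
    refine image_norm_le_of_liminf_right_slope_norm_lt_deriv_boundary (f := fun t => f t - f a)
      (f' := fun _ => c) (B := fun t => (c + δ) * (t - a)) (B' := fun _ => c + δ)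
      (hcont.sub continuousOn_const) (fun t ht r hr => ?_) (by simp) (by fun_prop)
      (fun t _ => ?_) (fun _ _ _ => by linarith) ⟨hab, le_rfl⟩
    · refine Eventually.frequently ?_
      obtain ⟨η, hη, hball⟩ := Metric.eventually_nhds_iff_ball.1
        (hf t ⟨ht.1, ht.2.le⟩ ((r - c) / 2) (by linarith))
      filter_upwards [Ioo_mem_nhdsGT (show t < t + η by linarith)] with s hs
      have h1 := hball (s - t) (by
        rw [mem_ball_zero_iff, Real.norm_eq_abs, abs_lt]; constructor <;> linarith [hs.1, hs.2])
      have hst : 0 < s - t := by linarith [hs.1]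
      rw [add_sub_cancel, abs_of_pos hst] at h1
      rw [slope_def_field, div_lt_iff₀ hst]
      simp only [Function.comp_apply, Real.norm_eq_abs]
      have h2 := abs_sub_abs_le_abs_sub (f s - f a) (f t - f a)
      rw [sub_sub_sub_cancel_right] at h2
      nlinarith
    · have := ((hasDerivAt_id t).sub_const a).const_mul (c + δ)
      rw [mul_one] at this
      exact this.hasDerivWithinAt
  have hlim : Tendsto (fun δ => (c + δ) * (b - a)) (𝓝[>] 0) (𝓝 ((c + 0) * (b - a))) := by
    have : Continuous fun δ => (c + δ) * (b - a) := by fun_prop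
    exact (this.tendsto 0).mono_left nhdsWithin_le_nhds
  rw [add_zero] at hlim
  exact ge_of_tendsto hlim (eventually_mem_nhdsWithin.mono key)

variable {d : ℕ} {b : ℝ → Phase d → Phase d} {L : ℝ≥0}
  {sol : ℝ → Phase d → ℝ → Phase d}

theorem sol_flow (hbL : ∀ t, LipschitzWith L (b t))
    (hsol : ∀ t z, IsGlobalSolution b t z (sol t z)) (s t : ℝ) (z : Phase d) :
    sol s (sol t z s) = sol t z :=
  (hsol s _).eq hbL ⟨rfl, (hsol t z).2⟩

theorem dist_sol_le (hbL : ∀ t, LipschitzWith L (b t))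
    (hsol : ∀ t z, IsGlobalSolution b t z (sol t z)) (s t : ℝ) (y z : Phase d) :
    dist (sol t y s) (sol t z s) ≤ dist y z * Real.exp (L * |s - t|) := by
  simpa only [(hsol t y).1, (hsol t z).1] using
    dist_solutions_le hbL (hsol t y).2 (hsol t z).2 t s

theorem eventually_sol_sub_le (hbL : ∀ t, LipschitzWith L (b t))
    (hbc : ∀ z, Continuous fun t => b t z)
    (hsol : ∀ t z, IsGlobalSolution b t z (sol t z)) (R t : ℝ) {δ : ℝ} (hδ : 0 < δ) :
    ∀ᶠ h in 𝓝 (0 : ℝ), ∀ y ∈ Metric.closedBall (0 : Phase d) R,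
      ‖sol t y (t + h) - y - h • b t y‖ ≤ δ * |h| := by
  have hb := continuous_uncurry_of_lipschitz hbL hbc
  have hsc : ∀ y, ContinuousAt (fun p : ℝ × Phase d => sol t p.2 p.1) (t, y) := fun y => by
    rw [ContinuousAt, tendsto_iff_dist_tendsto_zero]
    have hy : Continuous (sol t y) :=
      continuous_iff_continuousAt.2 fun s => ((hsol t y).2 s).continuousAt
    have hlim : Continuous fun p : ℝ × Phase d =>
        dist p.2 y * Real.exp (L * |p.1 - t|) + dist (sol t y p.1) (sol t y t) :=
      by fun_prop
    have := hlim.tendsto (t, y)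
    simp only [dist_self, zero_mul, add_zero] at this
    refine squeeze_zero (fun _ => dist_nonneg) (fun p => ?_) this
    exact (dist_triangle _ (sol t y p.1) _).trans
      (add_le_add (dist_sol_le hbL hsol p.1 t p.2 y) le_rfl)
  have := eventually_forall_norm_sub_le (q := fun s y => sol t y s)
    (q' := fun s y => b s (sol t y s)) (isCompact_closedBall (0 : Phase d) R) t
    (fun y _ s => (hsol t y).2 s)
    (fun y _ => ContinuousAt.comp (f := fun p : ℝ × Phase d => (p.1, sol t p.2 p.1))
      (x := (t, y)) hb.continuousAt (continuousAt_fst.prodMk (hsc y))) hδ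
  simpa only [(hsol t _).1] using this

/-- The backward Euler step `y - h b(t, y)` is carried by the flow to within `o(h)` of `y`,
uniformly on balls. This expresses the backward transport equation without differentiating the flow
in its initial time. -/
theorem eventually_sol_backward_sub_le (hbL : ∀ t, LipschitzWith L (b t))
    (hbc : ∀ z, Continuous fun t => b t z)
    (hsol : ∀ t z, IsGlobalSolution b t z (sol t z)) (R t : ℝ) {δ : ℝ} (hδ : 0 < δ) :
    ∀ᶠ h in 𝓝 (0 : ℝ), ∀ y ∈ Metric.closedBall (0 : Phase d) R,
      ‖sol t (y - h • b t y) (t + h) - y‖ ≤ δ * |h| := by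
  obtain ⟨B, hB⟩ := (isCompact_closedBall (0 : Phase d) R).exists_bound_of_continuousOn
    (hbL t).continuous.continuousOn
  have hsmall : ∀ᶠ h in 𝓝 (0 : ℝ), |h| * B < 1 ∧ L * (|h| * B) < δ / 2 := by
    have h1 : Continuous fun h : ℝ => |h| * B := by fun_prop
    have h2 : Continuous fun h : ℝ => L * (|h| * B) := by fun_prop
    exact ((h1.tendsto 0).eventually (gt_mem_nhds (by simp))).and
      ((h2.tendsto 0).eventually (gt_mem_nhds (by simpa using half_pos hδ)))
  filter_upwards [hsmall, eventually_sol_sub_le hbL hbc hsol (R + 1) t (half_pos hδ)]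
    with h hh hs y hy
  have hby : ‖h • b t y‖ ≤ |h| * B := by
    rw [norm_smul, Real.norm_eq_abs]
    exact mul_le_mul_of_nonneg_left (hB y hy) (abs_nonneg h)
  have hy' : y - h • b t y ∈ Metric.closedBall (0 : Phase d) (R + 1) := by
    rw [mem_closedBall_zero_iff] at hy ⊢
    linarith [norm_sub_le y (h • b t y), hh.1]
  have h1 := hs _ hy'
  have h2 : ‖b t (y - h • b t y) - b t y‖ ≤ δ / 2 := by
    rw [← dist_eq_norm]
    refine ((hbL t).dist_le_mul _ _).trans ?_
    rw [dist_eq_norm, sub_sub_cancel_left, norm_neg]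
    exact (mul_le_mul_of_nonneg_left hby L.2).trans hh.2.le
  calc ‖sol t (y - h • b t y) (t + h) - y‖
      = ‖(sol t (y - h • b t y) (t + h) - (y - h • b t y) - h • b t (y - h • b t y))
          + h • (b t (y - h • b t y) - b t y)‖ := by
        congr 1; rw [smul_sub]; abel
    _ ≤ δ / 2 * |h| + |h| * (δ / 2) := by
        refine (norm_add_le _ _).trans (add_le_add h1 ?_)
        rw [norm_smul, Real.norm_eq_abs]
        exact mul_le_mul_of_nonneg_left h2 (abs_nonneg h)
    _ = δ * |h| := by ring

end Transport

/-! ### Mollification of Lipschitz functions -/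

section Mollify

open Filter Topology

variable {d : ℕ}

/-- The mollification of `g` by a normed bump function. -/
noncomputable def mollify (η : ContDiffBump (0 : Phase d)) (g : Phase d → ℝ) : Phase d → ℝ :=
  convolution (η.normed volume) g (ContinuousLinearMap.lsmul ℝ ℝ) volume

variable {η : ContDiffBump (0 : Phase d)} {g g₁ g₂ : Phase d → ℝ}

theorem contDiff_mollify (hg : Continuous g) : ContDiff ℝ ∞ (mollify η g) :=
  η.hasCompactSupport_normed.contDiff_convolution_left _ η.contDiff_normed hg.locallyIntegrable

/-- Both mollifications are averages with the same probability weight, so a bound on corresponding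
shifts passes to them. The centres may differ, as the comparison along a characteristic requires. -/
theorem abs_mollify_sub_mollify_le (h₁ : Continuous g₁) (h₂ : Continuous g₂) {z₁ z₂ : Phase d}
    {c : ℝ} (h : ∀ u, ‖u‖ ≤ η.rOut → |g₁ (z₁ - u) - g₂ (z₂ - u)| ≤ c) :
    |mollify η g₁ z₁ - mollify η g₂ z₂| ≤ c := by
  have hi : ∀ {g : Phase d → ℝ}, Continuous g → ∀ z,
      Integrable fun u => η.normed volume u * g (z - u) := fun {g} hg z =>
    Continuous.integrable_of_hasCompactSupport (η.continuous_normed.mul (by fun_prop))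
      η.hasCompactSupport_normed.mul_right
  have e : ∀ {g : Phase d → ℝ} z, mollify η g z = ∫ u, η.normed volume u * g (z - u) :=
    fun z => rfl
  rw [e, e, ← integral_sub (hi h₁ z₁) (hi h₂ z₂), ← Real.norm_eq_abs]
  have hn : Integrable (fun u => η.normed volume u * c) volume :=
    (ContDiffBump.integrable_normed η).mul_const c
  refine (norm_integral_le_of_norm_le hn
    (ae_of_all _ fun u => ?_)).trans_eq ?_
  · rw [← mul_sub, norm_mul, Real.norm_of_nonneg (η.nonneg_normed u), Real.norm_eq_abs]
    by_cases hu : ‖u‖ ≤ η.rOut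
    · exact mul_le_mul_of_nonneg_left (h u hu) (η.nonneg_normed u)
    · have : η.normed volume u = 0 := by
        refine image_eq_zero_of_notMem_tsupport fun hmem => hu ?_
        rwa [η.tsupport_normed_eq, mem_closedBall_zero_iff] at hmem
      simp [this]
  · rw [integral_mul_const, η.integral_normed, one_mul]

theorem mollify_eq_zero (hg : Continuous g) {z : Phase d}
    (h : ∀ u, ‖u‖ ≤ η.rOut → g (z - u) = 0) : mollify η g z = 0 := by
  have := abs_mollify_sub_mollify_le (η := η) hg (continuous_const (y := (0 : ℝ))) (z₁ := z)
    (z₂ := z) (c := 0) (fun u hu => by simp [h u hu])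
  have h0 : mollify η (fun _ => (0 : ℝ)) z = 0 := by simp [mollify, convolution]
  rw [h0, sub_zero] at this
  exact abs_eq_zero.1 (le_antisymm this (abs_nonneg _))

theorem abs_mollify_sub_le {C : ℝ≥0} (hg : LipschitzWith C g) (z : Phase d) :
    |mollify η g z - g z| ≤ C * η.rOut := by
  rw [← Real.dist_eq]
  refine η.dist_normed_convolution_le hg.continuous.aestronglyMeasurable fun x hx => ?_
  exact (hg.dist_le_mul x z).trans
    (mul_le_mul_of_nonneg_left (Metric.mem_ball.1 hx).le C.2)

end Mollify

/-! ### Uniqueness for the linear continuity equation by duality -/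

section Representation

open Filter Topology

variable {d : ℕ} {b : ℝ → Phase d → Phase d} {L : ℝ≥0}
  {sol : ℝ → Phase d → ℝ → Phase d}

theorem abs_integral_le_of_forall_abs_le {X : Type*} [MeasurableSpace X] {μ : Measure X}
    [IsProbabilityMeasure μ] {f : X → ℝ} {c : ℝ} (h : ∀ x, |f x| ≤ c) : |∫ x, f x ∂μ| ≤ c := by
  simpa using norm_integral_le_of_norm_le_const (μ := μ) (f := f) (ae_of_all _ h)

theorem lipschitzWith_comp_sol (hbL : ∀ t, LipschitzWith L (b t))
    (hsol : ∀ t z, IsGlobalSolution b t z (sol t z)) {Λ : ℝ≥0} {ψ : Phase d → ℝ}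
    (hψ : LipschitzWith Λ ψ) {s t c : ℝ} (hst : |s - t| ≤ c) :
    LipschitzWith (Λ * (Real.exp (L * c)).toNNReal) fun y => ψ (sol t y s) := by
  refine LipschitzWith.of_dist_le_mul fun y z => ?_
  refine (hψ.dist_le_mul _ _).trans ?_
  rw [NNReal.coe_mul, Real.coe_toNNReal _ (Real.exp_pos _).le, mul_assoc]
  refine mul_le_mul_of_nonneg_left ?_ Λ.2
  refine (dist_sol_le hbL hsol s t y z).trans ?_
  rw [mul_comm]
  gcongr

/-- Trajectories separate at most exponentially, so those ending in the support of `ψ` stay close to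
`sol T 0`. The time window exceeds `[0, T]` by `1` on both sides to leave room for two-sided
increments at the ends. -/
theorem exists_support_bound (hbL : ∀ t, LipschitzWith L (b t))
    (hsol : ∀ t z, IsGlobalSolution b t z (sol t z)) {ψ : Phase d → ℝ}
    (hψ : HasCompactSupport ψ) (T : ℝ) :
    ∃ R : ℝ, ∀ t ∈ Set.Icc (-1) (T + 1), ∀ y, R < ‖y‖ → ψ (sol t y T) = 0 := by
  obtain ⟨R₀, hR₀⟩ := hψ.isCompact.isBounded.subset_closedBall (0 : Phase d)
  have hc : Continuous (sol T 0) :=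
    continuous_iff_continuousAt.2 fun s => ((hsol T 0).2 s).continuousAt
  obtain ⟨B, hB⟩ := (isCompact_Icc (a := (-1 : ℝ)) (b := T + 1)).exists_bound_of_continuousOn
    hc.continuousOn
  refine ⟨|R₀| * Real.exp (L * (|T| + 1)) + B, fun t ht y hy => ?_⟩
  by_contra hne
  have h1 : ‖sol t y T‖ ≤ |R₀| :=
    (mem_closedBall_zero_iff.1 (hR₀ (subset_tsupport _ hne))).trans (le_abs_self _)
  have h2 := dist_solutions_le hbL (hsol t y).2 (hsol T 0).2 T t
  rw [(hsol t y).1, (hsol T 0).1, dist_zero_right] at h2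
  have h3 : |t - T| ≤ |T| + 1 := by
    rw [abs_le]
    constructor <;> cases abs_cases T <;> linarith [ht.1, ht.2]
  have h4 : ‖sol t y T‖ * Real.exp (L * |t - T|) ≤ |R₀| * Real.exp (L * (|T| + 1)) := by gcongr
  have h5 := hB t ht
  have h6 : ‖y‖ ≤ ‖sol T 0 t‖ + dist y (sol T 0 t) := by
    rw [dist_eq_norm]
    linarith [norm_sub_norm_le y (sol T 0 t)]
  linarith

/-- The mollification of a Lipschitz solution of the backward transport equation solves this
equation up to an error controlled by the mollification radius. -/
theorem eventually_mollify_transport (hbL : ∀ t, LipschitzWith L (b t))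
    (hbc : ∀ z, Continuous fun t => b t z)
    (hsol : ∀ t z, IsGlobalSolution b t z (sol t z)) {Λ : ℝ≥0} {T R : ℝ}
    {g : ℝ → Phase d → ℝ} (hg : ∀ t ∈ Set.Icc (-1) (T + 1), LipschitzWith Λ (g t))
    (hgf : ∀ s t y, g s (sol t y s) = g t y)
    (hgR : ∀ t ∈ Set.Icc (-1) (T + 1), ∀ y, R < ‖y‖ → g t y = 0)
    {η : ContDiffBump (0 : Phase d)} (hη : η.rOut ≤ 1) {t : ℝ} (ht : t ∈ Set.Icc 0 T)
    {δ : ℝ} (hδ : 0 < δ) :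
    ∀ᶠ h in 𝓝 (0 : ℝ), ∀ z, |mollify η (g (t + h)) z - mollify η (g t) z
      + h * fderiv ℝ (mollify η (g t)) z (b t z)| ≤ (Λ * L * η.rOut + δ) * |h| := by
  have htI : t ∈ Set.Icc (-1) (T + 1) := ⟨by linarith [ht.1], by linarith [ht.2]⟩
  have hsm : ContDiff ℝ ∞ (mollify η (g t)) := contDiff_mollify (hg t htI).continuous
  have hzero : ∀ s ∈ Set.Icc (-1) (T + 1), ∀ z, R + 1 < ‖z‖ → mollify η (g s) z = 0 :=
    fun s hs z hz => mollify_eq_zero (hg s hs).continuous fun u hu => hgR s hs _ (by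
      linarith [norm_sub_norm_le z u])
  have hdz : ∀ z, R + 1 < ‖z‖ → fderiv ℝ (mollify η (g t)) z = 0 := fun z hz => by
    have : mollify η (g t) =ᶠ[𝓝 z] fun _ => 0 := by
      filter_upwards [(isOpen_lt continuous_const continuous_norm).mem_nhds hz] with w hw
      exact hzero t htI w hw
    rw [this.fderiv_eq]
    simp
  have hd1 : 0 < δ / 2 / (Λ + 1) := by positivity
  have hder := eventually_forall_norm_sub_le
    (q := fun h z => mollify η (g t) (z - h • b t z))
    (q' := fun h z => fderiv ℝ (mollify η (g t)) (z - h • b t z) (-b t z))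
    (isCompact_closedBall (0 : Phase d) (R + 1)) 0 (fun z _ s => by
      have h1 : HasDerivAt (fun h : ℝ => z - h • b t z) (-b t z) s := by
        simpa using ((hasDerivAt_id s).smul_const (b t z)).const_sub z
      exact (hsm.differentiable (by simp) _).hasFDerivAt.comp_hasDerivAt s h1)
    (fun z _ => by
      have hb := (hbL t).continuous
      have : Continuous fun p : ℝ × Phase d =>
          fderiv ℝ (mollify η (g t)) (p.2 - p.1 • b t p.2) (-b t p.2) :=
        ((hsm.continuous_fderiv (by simp)).comp (by fun_prop)).clm_apply (by fun_prop)
      exact this.continuousAt) (half_pos hδ)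
  have hnear : ∀ᶠ h in 𝓝 (0 : ℝ), t + h ∈ Set.Icc (-1) (T + 1) := by
    filter_upwards [Metric.ball_mem_nhds (0 : ℝ) one_pos] with h hh
    rw [mem_ball_zero_iff, Real.norm_eq_abs, abs_lt] at hh
    exact ⟨by linarith [ht.1], by linarith [ht.2]⟩
  filter_upwards [hnear, hder, eventually_sol_backward_sub_le hbL hbc hsol (R + 2) t hd1]
    with h hth hq hs z
  by_cases hz : R + 1 < ‖z‖
  · rw [hzero _ hth z hz, hzero t htI z hz, hdz z hz]
    simp only [sub_self, _root_.zero_apply, mul_zero, add_zero, abs_zero]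
    have := η.rOut_pos.le
    positivity
  · rw [not_lt] at hz
    have e1 : |mollify η (g (t + h)) z - mollify η (g t) (z - h • b t z)| ≤
        (Λ * L * η.rOut + δ / 2) * |h| := by
      refine abs_mollify_sub_mollify_le (hg _ hth).continuous (hg t htI).continuous fun u hu => ?_
      have hy : z - u ∈ Metric.closedBall (0 : Phase d) (R + 2) := by
        rw [mem_closedBall_zero_iff]
        linarith [norm_sub_le z u]
      have h1 : dist (g (t + h) (z - u)) (g t (z - u - h • b t (z - u))) ≤ δ / 2 * |h| := by
        rw [← hgf (t + h) t, dist_comm]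
        refine ((hg _ hth).dist_le_mul _ _).trans ?_
        rw [dist_eq_norm]
        calc Λ * ‖sol t (z - u - h • b t (z - u)) (t + h) - (z - u)‖
            ≤ (Λ + 1) * (δ / 2 / (Λ + 1) * |h|) := by
              gcongr
              · linarith
              · exact hs _ hy
          _ = δ / 2 * |h| := by field_simp
      -- The commutator of mollification and transport: displacing before or after the shift by `u`
      -- differs by `h (b(z) - b(z - u))`, which is at most `|h| L η.rOut`.
      have h2 : dist (g t (z - u - h • b t (z - u))) (g t (z - h • b t z - u)) ≤
          Λ * L * η.rOut * |h| := by
        refine ((hg t htI).dist_le_mul _ _).trans ?_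
        have e : z - u - h • b t (z - u) - (z - h • b t z - u) = h • (b t z - b t (z - u)) := by
          rw [smul_sub]; abel
        rw [dist_eq_norm, e, norm_smul, ← dist_eq_norm, Real.norm_eq_abs]
        have h3 : dist (b t z) (b t (z - u)) ≤ L * η.rOut :=
          ((hbL t).dist_le_mul _ _).trans (by
            rw [dist_eq_norm, sub_sub_cancel]; gcongr)
        calc Λ * (|h| * dist (b t z) (b t (z - u))) ≤ Λ * (|h| * (L * η.rOut)) := by gcongr
          _ = _ := by ring
      rw [← Real.dist_eq]
      refine (dist_triangle _ _ _).trans ((add_le_add h1 h2).trans_eq (by ring))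
    have e2 := hq z (mem_closedBall_zero_iff.2 hz)
    simp only [zero_add, zero_smul, sub_zero, map_neg, smul_eq_mul, mul_neg, sub_neg_eq_add,
      Real.norm_eq_abs] at e2
    have e3 : mollify η (g (t + h)) z - mollify η (g t) z
        + h * fderiv ℝ (mollify η (g t)) z (b t z) =
        (mollify η (g (t + h)) z - mollify η (g t) (z - h • b t z)) +
        (mollify η (g t) (z - h • b t z) - mollify η (g t) z
          + h * fderiv ℝ (mollify η (g t)) z (b t z)) := by ring
    rw [e3]
    exact (abs_add_le _ _).trans ((add_le_add e1 e2).trans_eq (by ring))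

theorem hasCompactSupport_of_norm {V : Type*} [Zero V] {f : Phase d → V} {R : ℝ}
    (h : ∀ z, R < ‖z‖ → f z = 0) : HasCompactSupport f :=
  HasCompactSupport.intro (isCompact_closedBall (0 : Phase d) R) fun z hz =>
    h z (not_le.1 fun h' => hz (mem_closedBall_zero_iff.2 h'))

theorem continuous_integral_of_hasCompactSupport {μ : ℝ → Measure (Phase d)}
    (hμc : ∀ φ : Phase d →ᵇ ℝ, Continuous fun t => ∫ z, φ z ∂(μ t)) {f : Phase d → ℝ}
    (hf : Continuous f) (hfc : HasCompactSupport f) : Continuous fun t => ∫ z, f z ∂(μ t) := by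
  obtain ⟨C, hC⟩ := hfc.exists_bound_of_continuous hf
  exact hμc (BoundedContinuousFunction.ofNormedAddCommGroup f hf C hC)

/-- The function `g t y = ψ (sol t y T)` is constant along characteristics, so `∫ g t ∂(μ t)` should
be constant in time. As `g t` is merely Lipschitz, it is mollified at scale `ε`; the mollified
integral changes by at most `Λ L T ε`, the mollification costs `Λ ε` at each end, and `ε → 0`
concludes. -/
theorem integral_eq_integral_comp_sol (hbL : ∀ t, LipschitzWith L (b t))
    (hbc : ∀ z, Continuous fun t => b t z)
    (hsol : ∀ t z, IsGlobalSolution b t z (sol t z)) {μ : ℝ → Measure (Phase d)}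
    (hp : ∀ t, IsProbabilityMeasure (μ t))
    (hμc : ∀ φ : Phase d →ᵇ ℝ, Continuous fun t => ∫ z, φ z ∂(μ t))
    (hder : ∀ φ : Phase d → ℝ, ContDiff ℝ ∞ φ → HasCompactSupport φ → ∀ t,
      HasDerivAt (fun s => ∫ z, φ z ∂(μ s)) (∫ z, fderiv ℝ φ z (b t z) ∂(μ t)) t)
    {T : ℝ} (hT : 0 ≤ T) {Λ₀ : ℝ≥0} {ψ : Phase d → ℝ} (hψ : LipschitzWith Λ₀ ψ)
    (hψc : HasCompactSupport ψ) :
    ∫ z, ψ z ∂(μ T) = ∫ z, ψ (sol 0 z T) ∂(μ 0) := by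
  set g : ℝ → Phase d → ℝ := fun t y => ψ (sol t y T) with hgdef
  set Λ : ℝ≥0 := Λ₀ * (Real.exp (L * (T + 1))).toNNReal with hΛ
  have hg : ∀ t ∈ Set.Icc (-1) (T + 1), LipschitzWith Λ (g t) := fun t ht =>
    lipschitzWith_comp_sol hbL hsol hψ (by
      rw [abs_le]; constructor <;> linarith [ht.1, ht.2])
  have hgf : ∀ s t y, g s (sol t y s) = g t y := fun s t y => by
    simp only [hgdef, sol_flow hbL hsol]
  obtain ⟨R, hgR⟩ := exists_support_bound hbL hsol hψc T
  change ∀ t ∈ Set.Icc (-1) (T + 1), ∀ y, R < ‖y‖ → g t y = 0 at hgR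
  have hsub : ∀ t ∈ Set.Icc 0 T, t ∈ Set.Icc (-1) (T + 1) := fun t ht =>
    ⟨by linarith [ht.1], by linarith [ht.2]⟩
  have main : ∀ ε ∈ Set.Ioc (0 : ℝ) 1, |(∫ z, g T z ∂(μ T)) - ∫ z, g 0 z ∂(μ 0)| ≤
      (Λ * L * T + 2 * Λ) * ε := fun ε hε => by
    let η : ContDiffBump (0 : Phase d) := ⟨ε / 2, ε, half_pos hε.1, half_lt_self hε.1⟩
    have hηε : η.rOut = ε := rfl
    have hcont : ∀ t ∈ Set.Icc (-1) (T + 1), Continuous (mollify η (g t)) := fun t ht =>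
      (contDiff_mollify (hg t ht).continuous).continuous
    have hcs : ∀ t ∈ Set.Icc (-1) (T + 1), HasCompactSupport (mollify η (g t)) := fun t ht =>
      hasCompactSupport_of_norm (R := R + 1) fun z hz =>
        mollify_eq_zero (hg t ht).continuous fun u hu => hgR t ht _ (by
          linarith [norm_sub_norm_le z u, hε.2])
    have hint : ∀ t ∈ Set.Icc (-1) (T + 1), ∀ s, Integrable (mollify η (g t)) (μ s) :=
      fun t ht s => (hcont t ht).integrable_of_hasCompactSupport (hcs t ht)
    have hF : |(∫ z, mollify η (g T) z ∂(μ T)) - ∫ z, mollify η (g 0) z ∂(μ 0)| ≤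
        Λ * L * ε * (T - 0) := by
      refine abs_sub_le_of_eventually_abs_sub_le (f := fun t => ∫ z, mollify η (g t) z ∂(μ t)) hT
        fun t ht δ hδ => ?_
      have htI := hsub t ht
      have hsm : ContDiff ℝ ∞ (mollify η (g t)) := contDiff_mollify (hg t htI).continuous
      have hDb : Continuous fun z => fderiv ℝ (mollify η (g t)) z (b t z) :=
        (hsm.continuous_fderiv (by simp)).clm_apply (hbL t).continuous
      have hDc : HasCompactSupport fun z => fderiv ℝ (mollify η (g t)) z (b t z) := by
        refine HasCompactSupport.intro (hcs t htI) fun z hz => ?_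
        rw [image_eq_zero_of_notMem_tsupport fun h => hz (tsupport_fderiv_subset ℝ h)]
        rfl
      have hQ := hder _ hsm (hcs t htI) t
      -- The increment splits into the change of `g` tested against `μ (t + h)` and the change of
      -- `μ` tested against `g t`. Their leading terms are `-h P (t + h)` and `h P t`, which cancel
      -- up to `o(h)` because `P` is continuous; three errors share `δ`.
      set P : ℝ → ℝ := fun s => ∫ z, fderiv ℝ (mollify η (g t)) z (b t z) ∂(μ s) with hPdef
      have hP : Continuous P := continuous_integral_of_hasCompactSupport hμc hDb hDc
      have hQ' : ∀ᶠ h in 𝓝 (0 : ℝ), |(∫ z, mollify η (g t) z ∂(μ (t + h)))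
          - (∫ z, mollify η (g t) z ∂(μ t)) - h * P t| ≤ δ / 3 * |h| := by
        have := (hasDerivAt_iff_isLittleO_nhds_zero.1 hQ).def (show 0 < δ / 3 by linarith)
        simpa only [smul_eq_mul, Real.norm_eq_abs] using this
      have hP' : ∀ᶠ h in 𝓝 (0 : ℝ), |P (t + h) - P t| ≤ δ / 3 := by
        have hc : Continuous fun h => |P (t + h) - P t| := by fun_prop
        have hlt : |P (t + 0) - P t| < δ / 3 := by
          rw [add_zero, sub_self, abs_zero]; linarith
        filter_upwards [(hc.tendsto 0).eventually (gt_mem_nhds hlt)] with h hh using hh.le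
      have hnear : ∀ᶠ h in 𝓝 (0 : ℝ), t + h ∈ Set.Icc (-1) (T + 1) := by
        filter_upwards [Metric.ball_mem_nhds (0 : ℝ) one_pos] with h hh
        rw [mem_ball_zero_iff, Real.norm_eq_abs, abs_lt] at hh
        exact ⟨by linarith [ht.1], by linarith [ht.2]⟩
      filter_upwards [hQ', hP', hnear, eventually_mollify_transport hbL hbc hsol hg hgf hgR
        (η := η) hε.2 ht (show 0 < δ / 3 by linarith)] with h hq hpp hth hm
      have hA : |∫ z, (mollify η (g (t + h)) z - mollify η (g t) z
          + h * fderiv ℝ (mollify η (g t)) z (b t z)) ∂(μ (t + h))| ≤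
          (Λ * L * ε + δ / 3) * |h| :=
        abs_integral_le_of_forall_abs_le hm
      have hDi : Integrable (fun z => h * fderiv ℝ (mollify η (g t)) z (b t z)) (μ (t + h)) :=
        (hDb.integrable_of_hasCompactSupport hDc).const_mul h
      have hSi : Integrable (fun z => mollify η (g (t + h)) z - mollify η (g t) z) (μ (t + h)) :=
        (hint _ hth _).sub (hint _ htI _)
      rw [integral_add hSi hDi,
        integral_sub (hint _ hth _) (hint _ htI _), integral_const_mul] at hA
      have hB : |h * (P (t + h) - P t)| ≤ δ / 3 * |h| := by
        rw [abs_mul, mul_comm]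
        exact mul_le_mul_of_nonneg_right hpp (abs_nonneg h)
      rw [abs_le] at hA hB hq ⊢
      change _ ≤ _ - _ + h * P (t + h) ∧ _ - _ + h * P (t + h) ≤ _ at hA
      constructor <;> linarith [hA.1, hA.2, hB.1, hB.2, hq.1, hq.2]
    have happ : ∀ t ∈ Set.Icc 0 T, |(∫ z, mollify η (g t) z ∂(μ t)) - ∫ z, g t z ∂(μ t)| ≤
        Λ * ε := fun t ht => by
      have hgi : Integrable (g t) (μ t) :=
        (hg t (hsub t ht)).continuous.integrable_of_hasCompactSupport
          (hasCompactSupport_of_norm (hgR t (hsub t ht)))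
      rw [← integral_sub (hint t (hsub t ht) t) hgi]
      exact abs_integral_le_of_forall_abs_le fun z =>
        abs_mollify_sub_le (η := η) (hg t (hsub t ht)) z
    have h0 := happ 0 ⟨le_rfl, hT⟩
    have h1 := happ T ⟨hT, le_rfl⟩
    rw [abs_le] at hF h0 h1 ⊢
    constructor <;> linarith [hF.1, hF.2, h0.1, h0.2, h1.1, h1.2]
  have hlim : Tendsto (fun ε : ℝ => (Λ * L * T + 2 * Λ) * ε) (𝓝[>] 0) (𝓝 0) := by
    have : Continuous fun ε : ℝ => (Λ * L * T + 2 * Λ) * ε := by fun_prop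
    simpa using (this.tendsto 0).mono_left nhdsWithin_le_nhds
  have h0 := ge_of_tendsto hlim ((Ioc_mem_nhdsGT one_pos : Set.Ioc (0 : ℝ) 1 ∈ 𝓝[>] 0) |>
    fun hm => Filter.mem_of_superset hm main)
  have h1 := sub_eq_zero.1 (abs_eq_zero.1 (le_antisymm h0 (abs_nonneg _)))
  simpa only [hgdef, (hsol T _).1] using h1

/-- Thickened indicators are Lipschitz with compact support and decrease to the indicator of a
compact set, so the measures agree on compact sets, on open sets by inner regularity, and hence
everywhere. -/
theorem ext_of_integral_lipschitz_eq {μ ν : Measure (Phase d)} [IsProbabilityMeasure μ]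
    [IsProbabilityMeasure ν]
    (h : ∀ (Λ : ℝ≥0) (ψ : Phase d → ℝ), LipschitzWith Λ ψ → HasCompactSupport ψ →
      ∫ z, ψ z ∂μ = ∫ z, ψ z ∂ν) : μ = ν := by
  have hK : ∀ S : Set (Phase d), IsCompact S → μ S = ν S := fun S hS => by
    have hpos : ∀ n : ℕ, (0 : ℝ) < 1 / (n + 1) := fun n => by positivity
    have hlim := tendsto_one_div_add_atTop_nhds_zero_nat (𝕜 := ℝ)
    have e : ∀ n : ℕ, ∫⁻ z, thickenedIndicator (hpos n) S z ∂μ =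
        ∫⁻ z, thickenedIndicator (hpos n) S z ∂ν := fun n => by
      have hc : HasCompactSupport fun z => (thickenedIndicator (hpos n) S z : ℝ) :=
        HasCompactSupport.intro (hS.cthickening (r := 1 / (n + 1))) fun z hz => by
          rw [thickenedIndicator_zero (hpos n) S
            fun h' => hz (Metric.thickening_subset_cthickening _ _ h')]
          rfl
      have hl : LipschitzWith _ fun z => (thickenedIndicator (hpos n) S z : ℝ) :=
        lipschitzWith_thickenedIndicator (hpos n) S
      have := h _ _ hl hc
      have hm : Measurable fun z => (thickenedIndicator (hpos n) S z : ℝ) := hl.continuous.measurable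
      rw [integral_eq_lintegral_of_nonneg_ae (ae_of_all _ fun z => NNReal.coe_nonneg _)
        hm.aestronglyMeasurable, integral_eq_lintegral_of_nonneg_ae
        (ae_of_all _ fun z => NNReal.coe_nonneg _) hm.aestronglyMeasurable] at this
      simp only [ENNReal.ofReal_coe_nnreal] at this
      exact (ENNReal.toReal_eq_toReal_iff'
        (ne_of_lt (BoundedContinuousFunction.lintegral_lt_top_of_nnreal μ _))
        (ne_of_lt (BoundedContinuousFunction.lintegral_lt_top_of_nnreal ν _))).1 this
    have h1 := tendsto_lintegral_thickenedIndicator_of_isClosed μ hS.isClosed hpos hlim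
    have h2 := tendsto_lintegral_thickenedIndicator_of_isClosed ν hS.isClosed hpos hlim
    simp only [e] at h1
    exact tendsto_nhds_unique h1 h2
  refine ext_of_generate_finite {s : Set (Phase d) | IsOpen s} BorelSpace.measurable_eq
    isPiSystem_isOpen (fun U hU => ?_) (by simp)
  have hU : IsOpen U := hU
  rw [IsOpen.measure_eq_iSup_isCompact hU μ, IsOpen.measure_eq_iSup_isCompact hU ν]
  simp only [iSup_congr fun S => iSup_congr fun _ => iSup_congr fun hS => hK S hS]

/-- Weakly continuous measure solutions of a continuity equation with Lipschitz field are
transported by the flow of this field. -/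
theorem eq_map_sol (hbL : ∀ t, LipschitzWith L (b t))
    (hbc : ∀ z, Continuous fun t => b t z)
    (hsol : ∀ t z, IsGlobalSolution b t z (sol t z)) {μ : ℝ → Measure (Phase d)}
    (hp : ∀ t, IsProbabilityMeasure (μ t))
    (hμc : ∀ φ : Phase d →ᵇ ℝ, Continuous fun t => ∫ z, φ z ∂(μ t))
    (hder : ∀ φ : Phase d → ℝ, ContDiff ℝ ∞ φ → HasCompactSupport φ → ∀ t,
      HasDerivAt (fun s => ∫ z, φ z ∂(μ s)) (∫ z, fderiv ℝ φ z (b t z) ∂(μ t)) t)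
    {T : ℝ} (hT : 0 ≤ T) : μ T = (μ 0).map fun z => sol 0 z T := by
  have hm : Continuous fun z => sol 0 z T := by
    have : LipschitzWith (Real.exp (L * |T - 0|)).toNNReal fun z => sol 0 z T :=
      LipschitzWith.of_dist_le_mul fun y z => by
        rw [Real.coe_toNNReal _ (Real.exp_pos _).le, mul_comm]
        exact dist_sol_le hbL hsol T 0 y z
    exact this.continuous
  have : IsProbabilityMeasure ((μ 0).map fun z => sol 0 z T) :=
    Measure.isProbabilityMeasure_map hm.aemeasurable
  refine ext_of_integral_lipschitz_eq fun Λ ψ hψ hψc => ?_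
  rw [integral_map hm.aemeasurable hψ.continuous.aestronglyMeasurable]
  exact integral_eq_integral_comp_sol hbL hbc hsol hp hμc hder hT hψ hψc

end Representation

/-! ### Lipschitz-dual bounds and tensor powers -/

section Dual

variable {d : ℕ}

/-- The Lipschitz-dual distance of `μ` and `ν` is at most `U`. -/
def DualBound (μ ν : Measure (Phase d)) (U : ℝ) : Prop :=
  ∀ (C : ℝ≥0) (g : Phase d → ℝ), LipschitzWith C g → |(∫ z, g z ∂μ) - ∫ z, g z ∂ν| ≤ C * U

variable {μ ν : Measure (Phase d)} {U : ℝ}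

theorem DualBound.nonneg (h : DualBound μ ν U) : 0 ≤ U := by
  simpa using (abs_nonneg _).trans
    (h 1 (fun _ => 0) ((LipschitzWith.const 0).weaken zero_le_one))

/-- Testing with `⟨v, g⟩`, where `v` is the difference of the integrals itself, extends the scalar
bound to vectors without a dimensional factor. -/
theorem DualBound.norm_integral_sub_le (h : DualBound μ ν U) {C : ℝ≥0} {g : Phase d → Phase d}
    (hg : LipschitzWith C g) (hμ : Integrable g μ) (hν : Integrable g ν) :
    ‖(∫ z, g z ∂μ) - ∫ z, g z ∂ν‖ ≤ C * U := by
  set v := (∫ z, g z ∂μ) - ∫ z, g z ∂ν with hv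
  have hl : LipschitzWith (‖v‖₊ * C) fun z => inner ℝ v (g z) :=
    LipschitzWith.of_dist_le_mul fun x y => by
      rw [Real.dist_eq, ← inner_sub_right, NNReal.coe_mul, coe_nnnorm, mul_assoc]
      refine (abs_real_inner_le_norm _ _).trans ?_
      rw [← dist_eq_norm (g x)]
      exact mul_le_mul_of_nonneg_left (hg.dist_le_mul x y) (norm_nonneg _)
  have h1 := h _ _ hl
  rw [integral_inner hμ, integral_inner hν, ← inner_sub_right, ← hv, real_inner_self_eq_norm_sq,
    abs_of_nonneg (sq_nonneg _), NNReal.coe_mul, coe_nnnorm, sq, mul_assoc] at h1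
  rcases (norm_nonneg v).eq_or_lt with h0 | h0
  · rw [← h0]
    exact mul_nonneg C.2 h.nonneg
  · exact le_of_mul_le_mul_left h1 h0

theorem integral_empirical {N : ℕ} {V : Type*} [NormedAddCommGroup V] [NormedSpace ℝ V]
    [CompleteSpace V] (Z : Config d N) (g : Phase d → V) :
    ∫ z, g z ∂(empirical Z) = (N : ℝ)⁻¹ • ∑ k, g (Z k) := by
  rw [empirical, integral_smul_measure, integral_finsetSum_measure fun k _ =>
    (integrable_dirac (by simp))]
  simp

theorem integrable_empirical {N : ℕ} (hN : 1 ≤ N) {V : Type*} [NormedAddCommGroup V]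
    (Z : Config d N) (g : Phase d → V) : Integrable g (empirical Z) := by
  refine Integrable.smul_measure ?_ (ENNReal.inv_ne_top.2 (by
    simpa using Nat.one_le_iff_ne_zero.1 hN))
  exact integrable_finsetSum_measure.2 fun k _ => integrable_dirac (by simp)

theorem integral_tensorPow_empirical {N : ℕ} (hN : 1 ≤ N) {m : ℕ} (Z : Config d N)
    (g : Config d m → ℝ) :
    ∫ Y, g Y ∂(tensorPow m (empirical Z)) =
      ((N : ℝ)⁻¹) ^ m * ∑ ι : Fin m → Fin N, g (fun i => Z (ι i)) := by
  rw [tensorPow_empirical hN, integral_smul_measure, integral_finsetSum_measure fun k _ =>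
    (integrable_dirac (by simp))]
  simp

theorem isProbabilityMeasure_tensorPow (m : ℕ) (μ : Measure (Phase d)) [IsProbabilityMeasure μ] :
    IsProbabilityMeasure (tensorPow m μ) := by
  unfold tensorPow; infer_instance

theorem integrable_of_bounded {X : Type*} [TopologicalSpace X] [MeasurableSpace X]
    [OpensMeasurableSpace X] {μ : Measure X} [IsFiniteMeasure μ] {f : X → ℝ} (hf : Continuous f)
    {S : ℝ} (hS : ∀ x, |f x| ≤ S) : Integrable f μ :=
  (integrable_const S).mono' hf.measurable.aestronglyMeasurable (ae_of_all _ hS)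

theorem integral_tensorPow_succ (m : ℕ) (μ : Measure (Phase d)) [IsProbabilityMeasure μ]
    {φ : Config d (m + 1) → ℝ} (hφ : Continuous φ) {S : ℝ} (hS : ∀ Z, |φ Z| ≤ S) :
    ∫ Z, φ Z ∂(tensorPow (m + 1) μ) =
      ∫ x, ∫ Y, φ (Fin.cons x Y) ∂(tensorPow m μ) ∂μ := by
  have := isProbabilityMeasure_tensorPow m μ
  have hmp := (measurePreserving_piFinSuccAbove (fun _ : Fin (m + 1) => μ) 0).symm
  have h1 := hmp.integral_comp' φ
  have hc : Continuous fun p : Phase d × Config d m => φ (Fin.cons p.1 p.2) :=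
    hφ.comp (Continuous.finCons (A := fun _ => Phase d) continuous_fst continuous_snd)
  have h2 : Integrable (fun p : Phase d × Config d m => φ (Fin.cons p.1 p.2))
      (μ.prod (tensorPow m μ)) := integrable_of_bounded hc fun p => hS _
  rw [← integral_prod _ h2]
  refine Eq.trans h1.symm ?_
  simp only [MeasurableEquiv.piFinSuccAbove_symm_apply, Fin.insertNthEquiv_zero]
  rfl

/-- Stability of tensor powers in the Lipschitz-dual distance. -/
theorem abs_integral_tensorPow_sub_le [IsProbabilityMeasure μ] [IsProbabilityMeasure ν]
    (h : DualBound μ ν U) (m : ℕ) {φ : Config d m → ℝ} (hφ : Continuous φ) {S : ℝ}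
    (hS : ∀ Z, |φ Z| ≤ S) {C : ℝ≥0}
    (hC : ∀ (Z : Config d m) (j : Fin m) (w : Phase d),
      |φ (Function.update Z j w) - φ Z| ≤ C * dist w (Z j)) :
    |(∫ Z, φ Z ∂(tensorPow m μ)) - ∫ Z, φ Z ∂(tensorPow m ν)| ≤ m * (C * U) := by
  induction m with
  | zero =>
    have : tensorPow 0 μ = tensorPow 0 ν := by
      unfold tensorPow
      rw [Measure.pi_of_empty, Measure.pi_of_empty]
    simp [this]
  | succ m ih =>
    have := isProbabilityMeasure_tensorPow m μ
    have := isProbabilityMeasure_tensorPow m ν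
    rw [integral_tensorPow_succ m μ hφ hS, integral_tensorPow_succ m ν hφ hS]
    have hcY : ∀ x : Phase d, Continuous fun Y : Config d m =>
        φ (Fin.cons (α := fun _ => Phase d) x Y) := fun x =>
      hφ.comp (continuous_const.finCons continuous_id)
    have hiY : ∀ (x : Phase d) (ρ : Measure (Config d m)) [IsProbabilityMeasure ρ],
        Integrable (fun Y : Config d m => φ (Fin.cons (α := fun _ => Phase d) x Y)) ρ :=
      fun x ρ _ => integrable_of_bounded (hcY x) fun Y => hS _
    have hlip : ∀ (ρ : Measure (Config d m)) [IsProbabilityMeasure ρ],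
        LipschitzWith C fun x => ∫ Y, φ (Fin.cons (α := fun _ => Phase d) x Y) ∂ρ := fun ρ _ =>
      LipschitzWith.of_dist_le_mul fun x y => by
        rw [Real.dist_eq, ← integral_sub (hiY x ρ) (hiY y ρ)]
        refine abs_integral_le_of_forall_abs_le fun Y => ?_
        have := hC (Fin.cons y Y) 0 x
        rwa [Fin.update_cons_zero, Fin.cons_zero] at this
    have hbd : ∀ (ρ : Measure (Config d m)) [IsProbabilityMeasure ρ] (x : Phase d),
        |∫ Y, φ (Fin.cons (α := fun _ => Phase d) x Y) ∂ρ| ≤ S := fun ρ _ x =>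
      abs_integral_le_of_forall_abs_le fun Y => hS _
    -- The factors are exchanged one at a time: `h1` changes the last `m` factors with the first
    -- variable frozen, `h2` changes the first. Only Lipschitz bounds in a single variable are
    -- involved, so each factor costs exactly `C U`.
    have h1 : |∫ x, ((∫ Y, φ (Fin.cons (α := fun _ => Phase d) x Y) ∂(tensorPow m μ))
        - ∫ Y, φ (Fin.cons (α := fun _ => Phase d) x Y) ∂(tensorPow m ν)) ∂μ| ≤ m * (C * U) :=
      abs_integral_le_of_forall_abs_le fun x => ih (hcY x) (fun Y => hS _) fun Y j w => by
        have := hC (Fin.cons x Y) j.succ w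
        rwa [← Fin.cons_update, Fin.cons_succ] at this
    rw [integral_sub (integrable_of_bounded (hlip _).continuous (hbd _))
      (integrable_of_bounded (hlip _).continuous (hbd _))] at h1
    have h2 := h C _ (hlip (tensorPow m ν))
    rw [abs_le] at h1 h2 ⊢
    push_cast
    constructor <;> linarith [h1.1, h1.2, h2.1, h2.2]

end Dual

/-! ### Dobrushin's estimate between particles and mean field characteristics -/

section Characteristics

variable {d : ℕ} {K : Phase d → Phase d → Phase d} {L : ℝ≥0} {ν : Measure (Phase d)}
  {μ : ℝ → Measure (Phase d)}

theorem exists_characteristics (hμ : IsWeakSolution K ν μ)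
    (h0 : ∀ z z', K z z' + K z' z = 0)
    (h1 : ∀ z', LipschitzWith L (fun z => K z z'))
    (h2 : ∀ z, LipschitzWith L (fun z' => K z z')) :
    ∃ X : ℝ → Phase d → Phase d, (∀ z, X 0 z = z) ∧
      (∀ t, 0 ≤ t → LipschitzWith (Real.exp (L * t)).toNNReal (X t)) ∧
      (∀ z t, HasDerivAt (fun s => X s z) (meanField K (μ t) (X t z)) t) ∧
      ∀ t, 0 ≤ t → μ t = ν.map (X t) := by
  have hbL : ∀ t, LipschitzWith L (meanField K (μ t)) := fun t =>
    lipschitzWith_meanField h1 h2 (hμ.isP1 t)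
  have hbc : ∀ z, Continuous fun t => meanField K (μ t) z := continuous_meanField hμ h0 h1 h2
  choose sol hsol using exists_isGlobalSolution (v := fun t => meanField K (μ t)) hbL hbc
  refine ⟨fun t z => sol 0 z t, fun z => (hsol 0 z).1, fun t ht => ?_, fun z t => (hsol 0 z).2 t,
    fun t ht => ?_⟩
  · refine LipschitzWith.of_dist_le_mul fun y z => ?_
    rw [Real.coe_toNNReal _ (Real.exp_pos _).le, mul_comm]
    have := dist_sol_le hbL hsol t 0 y z
    rwa [sub_zero, abs_of_nonneg ht] at this
  · have := eq_map_sol hbL hbc hsol (fun t => (hμ.isP1 t).1) hμ.continuous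
      (fun φ hφ hφc t => hasDerivAt_integral_test hμ h0 h1 h2 hφ hφc t) ht
    rwa [hμ.initial] at this

/-- The difference `w` of the two motions satisfies `|w'| ≤ 2 L |w| + L e^(Ls) U`. The first term is
the Lipschitz bound on the `N`-body field; the second compares, along `X`, the averages of the
kernel under the empirical measure and under `ν`, where the integrand is `L e^(Ls)`-Lipschitz. The
right side of the claim solves the corresponding equation with value `0` at time `0`. -/
theorem dist_flow_characteristics_le (hν : IsP1 ν)
    (h1 : ∀ z', LipschitzWith L (fun z => K z z'))
    (h2 : ∀ z, LipschitzWith L (fun z' => K z z'))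
    {X : ℝ → Phase d → Phase d} (hX0 : ∀ z, X 0 z = z)
    (hXL : ∀ t, 0 ≤ t → LipschitzWith (Real.exp (L * t)).toNNReal (X t))
    (hXd : ∀ z t, HasDerivAt (fun s => X s z) (meanField K (μ t) (X t z)) t)
    (hXμ : ∀ t, 0 ≤ t → μ t = ν.map (X t)) {N : ℕ} (hN : 1 ≤ N) {Z : Config d N} {U : ℝ}
    (hU : DualBound (empirical Z) ν U) {t : ℝ} (ht : 0 ≤ t) :
    dist (flow K N t Z) (fun k => X t (Z k)) ≤
      U * (Real.exp (2 * L * t) - Real.exp (L * t)) := by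
  have hflow := isTrajectory_flow h1 h2 hN Z
  set w : ℝ → Config d N := fun s => flow K N s Z - fun k => X s (Z k) with hw
  set w' : ℝ → Config d N := fun s =>
    nBodyField K N (flow K N s Z) - fun k => meanField K (μ s) (X s (Z k)) with hw'
  have hwd : ∀ s, HasDerivAt w (w' s) s := fun s =>
    (hflow.2 s).sub (hasDerivAt_pi.2 fun k => hXd (Z k) s)
  have hwn : ∀ s, 0 ≤ s → ‖w' s‖ ≤ 2 * L * ‖w s‖ + L * Real.exp (L * s) * U := fun s hs => by
    have e1 : dist (nBodyField K N (flow K N s Z)) (nBodyField K N fun k => X s (Z k)) ≤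
        2 * L * ‖w s‖ := by
      have := (lipschitzWith_nBodyField h1 h2 hN).dist_le_mul (flow K N s Z) fun k => X s (Z k)
      rw [dist_eq_norm (flow K N s Z)] at this
      exact_mod_cast this
    have e2 : dist (nBodyField K N fun k => X s (Z k)) (fun k => meanField K (μ s) (X s (Z k))) ≤
        L * Real.exp (L * s) * U := by
      refine (dist_pi_le_iff (by have := hU.nonneg; positivity)).2 fun k => ?_
      have hl : LipschitzWith (L * (Real.exp (L * s)).toNNReal)
          fun z => K (X s (Z k)) (X s z) := (h2 _).comp (hXL s hs)
      have e3 : nBodyField K N (fun k => X s (Z k)) k =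
          ∫ z, K (X s (Z k)) (X s z) ∂(empirical Z) := by
        rw [integral_empirical]; rfl
      have e4 : meanField K (μ s) (X s (Z k)) = ∫ z, K (X s (Z k)) (X s z) ∂ν := by
        rw [meanField, hXμ s hs, integral_map (hXL s hs).continuous.aemeasurable
          (h2 _).continuous.aestronglyMeasurable]
      rw [e3, e4, dist_eq_norm]
      have := hU.norm_integral_sub_le hl (integrable_empirical hN Z _)
        (hν.integrable_of_lipschitz hl)
      rwa [NNReal.coe_mul, Real.coe_toNNReal _ (Real.exp_pos _).le] at this
    rw [hw', ← dist_eq_norm]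
    exact (dist_triangle _ _ _).trans (add_le_add e1 e2)
  -- The comparison principle needs a strict differential inequality. The added term gains `η
  -- e^((2L+1)s)` over the growth rate `2 L`; then `η → 0`.
  have key : ∀ η > 0, ‖w t‖ ≤
      U * (Real.exp (2 * L * t) - Real.exp (L * t)) + η * Real.exp ((2 * L + 1) * t) :=
    fun η hη => by
    have hexp : ∀ c s : ℝ, HasDerivAt (fun s => Real.exp (c * s)) (Real.exp (c * s) * c) s :=
      fun c s => by
        simpa using ((hasDerivAt_id s).const_mul c).exp
    refine image_norm_le_of_norm_deriv_right_lt_deriv_boundary (f := w) (f' := w') (a := 0) (b := t)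
      (B := fun s => U * (Real.exp (2 * L * s) - Real.exp (L * s))
        + η * Real.exp ((2 * L + 1) * s))
      (fun s _ => (hwd s).continuousAt.continuousWithinAt) (fun s _ => (hwd s).hasDerivWithinAt)
      ?_ (fun s => ((((hexp (2 * L) s).sub (hexp L s)).const_mul U).add
        ((hexp (2 * L + 1) s).const_mul η))) (fun s hs hB => ?_) ⟨ht, le_rfl⟩
    · have : w 0 = 0 := by
        simp only [hw, hX0]
        rw [show flow K N 0 Z = Z from hflow.1]
        exact sub_self _
      rw [this]
      simp [hη.le]
    · refine (hwn s hs.1).trans_lt ?_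
      rw [hB]
      have := Real.exp_pos ((2 * L + 1) * s)
      nlinarith [mul_pos hη this]
  have hlim : Filter.Tendsto (fun η : ℝ => U * (Real.exp (2 * L * t) - Real.exp (L * t))
      + η * Real.exp ((2 * L + 1) * t)) (nhdsWithin 0 (Set.Ioi 0))
      (nhds (U * (Real.exp (2 * L * t) - Real.exp (L * t)))) := by
    have : Continuous fun η : ℝ => U * (Real.exp (2 * L * t) - Real.exp (L * t))
      + η * Real.exp ((2 * L + 1) * t) := by fun_prop
    simpa using (this.tendsto 0).mono_left nhdsWithin_le_nhds
  rw [dist_eq_norm]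
  exact ge_of_tendsto hlim (eventually_mem_nhdsWithin.mono key)

/-- Reversing time changes the sign of the kernel, so negative times reduce to positive ones. -/
theorem IsWeakSolution.neg (hμ : IsWeakSolution K ν μ) :
    IsWeakSolution (fun z z' => -K z z') ν fun t => μ (-t) where
  isP1 t := hμ.isP1 _
  continuous φ := (hμ.continuous φ).comp continuous_neg
  moment := by
    have hmap : Measure.map (Homeomorph.neg ℝ) volume = volume :=
      (Measure.measurePreserving_neg (volume : Measure ℝ)).map_eq
    have := (locallyIntegrable_map_homeomorph (Homeomorph.neg ℝ)
      (f := fun t => ∫ z, ‖z‖ ∂(μ t)) (μ := volume)).1 (by rw [hmap]; exact hμ.moment)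
    exact this
  initial := by simpa using hμ.initial
  equation φ hφ hφc t := by
    have hm : ∀ s, meanField (fun z z' => -K z z') (μ s) = fun z => -meanField K (μ s) z :=
      fun s => by
        ext z : 1
        exact integral_neg _
    have := hμ.equation φ hφ hφc (-t)
    simp only [neg_zero, hm, map_neg, integral_neg, intervalIntegral.integral_neg]
    rw [this, intervalIntegral.integral_comp_neg
      (fun s => ∫ z, fderiv ℝ φ z (meanField K (μ s) z) ∂(μ s)), neg_zero,
      intervalIntegral.integral_symm]

/-- The solution of the mean field equation at time `t` is the image of the initial data under a
Lipschitz map, which is close to the `N`-body flow. -/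
theorem exists_flowMap (hμ : IsWeakSolution K ν μ)
    (h0 : ∀ z z', K z z' + K z' z = 0)
    (h1 : ∀ z', LipschitzWith L (fun z => K z z'))
    (h2 : ∀ z, LipschitzWith L (fun z' => K z z')) (t : ℝ) :
    ∃ X : Phase d → Phase d, LipschitzWith (Real.exp (L * |t|)).toNNReal X ∧
      μ t = ν.map X ∧ ∀ (N : ℕ), 1 ≤ N → ∀ (Z : Config d N) (U : ℝ),
        DualBound (empirical Z) ν U → dist (flow K N t Z) (fun k => X (Z k)) ≤
          U * (Real.exp (2 * L * |t|) - Real.exp (L * |t|)) := by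
  have hν : IsP1 ν := by simpa only [hμ.initial] using hμ.isP1 0
  rcases le_total 0 t with ht | ht
  · obtain ⟨X, hX0, hXL, hXd, hXμ⟩ := exists_characteristics hμ h0 h1 h2
    rw [abs_of_nonneg ht]
    exact ⟨X t, hXL t ht, hXμ t ht, fun N hN Z U hU =>
      dist_flow_characteristics_le hν h1 h2 hX0 hXL hXd hXμ hN hU ht⟩
  · have h1' : ∀ z', LipschitzWith L (fun z => -K z z') := fun z => (h1 z).neg
    have h2' : ∀ z, LipschitzWith L (fun z' => -K z z') := fun z => (h2 z).neg
    have ht' : 0 ≤ -t := neg_nonneg.2 ht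
    obtain ⟨X, hX0, hXL, hXd, hXμ⟩ := exists_characteristics hμ.neg
      (fun z z' => by rw [← neg_add, h0, neg_zero]) h1' h2'
    rw [abs_of_nonpos ht]
    refine ⟨X (-t), hXL _ ht', by simpa using hXμ _ ht', fun N hN Z U hU => ?_⟩
    have := dist_flow_characteristics_le hν h1' h2' hX0 hXL hXd hXμ hN hU ht'
    rwa [← flow_neg h1 h2 hN, neg_neg] at this

end Characteristics

/-! ### The Monge-Kantorovich distance as a Lipschitz-dual bound -/

section MongeKantorovich

variable {d : ℕ} {μ ν : Measure (Phase d)}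

/-- The elementary half of Kantorovich duality: both integrals are written on the coupling and the
Lipschitz bound is integrated. -/
theorem ofReal_abs_integral_sub_le_of_coupling (hμ : IsP1 μ) (hν : IsP1 ν)
    {π : Measure (Phase d × Phase d)} (hπ : π ∈ couplings μ ν) {C : ℝ≥0} {g : Phase d → ℝ}
    (hg : LipschitzWith C g) :
    ENNReal.ofReal |(∫ z, g z ∂μ) - ∫ z, g z ∂ν| ≤ C * ∫⁻ p, edist p.1 p.2 ∂π := by
  obtain ⟨hp, h1, h2⟩ := hπ
  have hi1 : Integrable (fun p : Phase d × Phase d => g p.1) π := by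
    have := hμ.integrable_of_lipschitz hg
    rw [← h1] at this
    exact this.comp_measurable measurable_fst
  have hi2 : Integrable (fun p : Phase d × Phase d => g p.2) π := by
    have := hν.integrable_of_lipschitz hg
    rw [← h2] at this
    exact this.comp_measurable measurable_snd
  have e1 : ∫ z, g z ∂μ = ∫ p, g p.1 ∂π := by
    rw [← h1, integral_map measurable_fst.aemeasurable hg.continuous.aestronglyMeasurable]
  have e2 : ∫ z, g z ∂ν = ∫ p, g p.2 ∂π := by
    rw [← h2, integral_map measurable_snd.aemeasurable hg.continuous.aestronglyMeasurable]
  rw [e1, e2, ← integral_sub hi1 hi2, ← Real.norm_eq_abs, ofReal_norm]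
  refine (enorm_integral_le_lintegral_enorm _).trans ?_
  rw [← lintegral_const_mul' _ _ ENNReal.coe_ne_top]
  refine lintegral_mono fun p => ?_
  rw [← edist_eq_enorm_sub]
  exact hg p.1 p.2

theorem prod_mem_couplings [IsProbabilityMeasure μ] [IsProbabilityMeasure ν] :
    μ.prod ν ∈ couplings μ ν :=
  ⟨inferInstance, by simp, by simp⟩

theorem distMK_le [IsProbabilityMeasure μ] [IsProbabilityMeasure ν] :
    distMK μ ν ≤ ∫⁻ x, ‖x‖ₑ ∂μ + ∫⁻ y, ‖y‖ₑ ∂ν := by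
  refine (iInf₂_le _ prod_mem_couplings).trans ?_
  have e1 : ∫⁻ x, ‖x‖ₑ ∂μ = ∫⁻ p, ‖p.1‖ₑ ∂(μ.prod ν) := by
    rw [← lintegral_map (μ := μ.prod ν) (f := fun x : Phase d => ‖x‖ₑ) (by fun_prop)
      measurable_fst]
    simp
  have e2 : ∫⁻ x, ‖x‖ₑ ∂ν = ∫⁻ p, ‖p.2‖ₑ ∂(μ.prod ν) := by
    rw [← lintegral_map (μ := μ.prod ν) (f := fun x : Phase d => ‖x‖ₑ) (by fun_prop)
      measurable_snd]
    simp
  rw [e1, e2, ← lintegral_add_left (by fun_prop)]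
  refine lintegral_mono fun p => ?_
  rw [edist_eq_enorm_sub]
  exact enorm_sub_le

theorem IsP1.lintegral_enorm_ne_top {X : Type*} [NormedAddCommGroup X] [MeasurableSpace X]
    {P : Measure X} (hP : IsP1 P) : ∫⁻ x, ‖x‖ₑ ∂P ≠ ⊤ := by
  have := hP.2.2
  simpa [HasFiniteIntegral] using this.ne

theorem distMK_ne_top (hμ : IsP1 μ) (hν : IsP1 ν) : distMK μ ν ≠ ⊤ := by
  have := hμ.1
  have := hν.1
  exact ne_top_of_le_ne_top
    (ENNReal.add_ne_top.2 ⟨hμ.lintegral_enorm_ne_top, hν.lintegral_enorm_ne_top⟩) distMK_le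

theorem dualBound_distMK (hμ : IsP1 μ) (hν : IsP1 ν) : DualBound μ ν (distMK μ ν).toReal := by
  have := hμ.1
  have := hν.1
  intro C g hg
  have key : ENNReal.ofReal |(∫ z, g z ∂μ) - ∫ z, g z ∂ν| ≤ C * distMK μ ν := by
    -- Moving the infimum across the product divides by `C`; for `C = 0` any coupling does.
    rcases eq_or_ne C 0 with rfl | hC
    · simpa using ofReal_abs_integral_sub_le_of_coupling hμ hν prod_mem_couplings hg
    · have hC0 : (C : ℝ≥0∞) ≠ 0 := by simpa using hC
      rw [← ENNReal.div_le_iff' hC0 ENNReal.coe_ne_top]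
      refine le_iInf₂ fun π hπ => ?_
      rw [ENNReal.div_le_iff' hC0 ENNReal.coe_ne_top]
      exact ofReal_abs_integral_sub_le_of_coupling hμ hν hπ hg
  have := ENNReal.toReal_mono (ENNReal.mul_ne_top ENNReal.coe_ne_top (distMK_ne_top hμ hν)) key
  rwa [ENNReal.toReal_ofReal (abs_nonneg _), ENNReal.toReal_mul, ENNReal.coe_toReal] at this

theorem isP1_empirical {N : ℕ} (hN : 1 ≤ N) (Z : Config d N) : IsP1 (empirical Z) :=
  ⟨isProbabilityMeasure_empirical hN Z, integrable_empirical hN Z _⟩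

theorem lintegral_enorm_empirical_le {N : ℕ} (hN : 1 ≤ N) (Z : Config d N) :
    ∫⁻ x, ‖x‖ₑ ∂(empirical Z) ≤ ‖Z‖ₑ := by
  have := isProbabilityMeasure_empirical hN Z
  have hae : ∀ᵐ x ∂(empirical Z), ‖x‖ₑ ≤ ‖Z‖ₑ := by
    refine Measure.ae_smul_measure ?_ _
    rw [ae_iff]
    simp only [Measure.finsetSum_apply, Finset.sum_eq_zero_iff]
    intro k _
    rw [Measure.dirac_apply' _ (by measurability)]
    simp only [Set.indicator_apply_eq_zero, Set.mem_ofPred_eq]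
    intro h
    exact absurd (by
      rw [← ofReal_norm, ← ofReal_norm]
      exact ENNReal.ofReal_le_ofReal (norm_le_pi_norm Z k)) h
  exact (lintegral_mono_ae hae).trans (by simp)

/-- Finiteness matters because statement (b) takes `toReal` of this integral, and an infinite value
would turn into `0`. -/
theorem lintegral_distMK_empirical_ne_top {N : ℕ} (hN : 1 ≤ N) {P : Measure (Config d N)}
    (hP : IsP1 P) (hν : IsP1 ν) : ∫⁻ Z, distMK (empirical Z) ν ∂P ≠ ⊤ := by
  have := hP.1
  have := hν.1
  have hle : ∀ Z : Config d N, distMK (empirical Z) ν ≤ ‖Z‖ₑ + ∫⁻ y, ‖y‖ₑ ∂ν := fun Z => by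
    have := isProbabilityMeasure_empirical hN Z
    exact distMK_le.trans (add_le_add (lintegral_enorm_empirical_le hN Z) le_rfl)
  refine ne_top_of_le_ne_top ?_ (lintegral_mono hle)
  rw [lintegral_add_right _ measurable_const]
  simp [hP.lintegral_enorm_ne_top, hν.lintegral_enorm_ne_top]

end MongeKantorovich

/-! ### From the stability estimate to the marginals: statement (b) -/

section Propagation

variable {d : ℕ} {K : Phase d → Phase d → Phase d} {L : ℝ≥0} {ν : Measure (Phase d)}
  {μ : ℝ → Measure (Phase d)}

/-- The constant `√m` would do; `m` suffices, since the final estimate carries that factor anyway.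
-/
theorem dist_toLp_le {m : ℕ} (Y W : Config d m) :
    dist (WithLp.toLp 2 Y : EConfig d m) (WithLp.toLp 2 W) ≤ m * dist Y W := by
  have h := (PiLp.lipschitzWith_toLp 2 (fun _ : Fin m => Phase d)).dist_le_mul Y W
  refine h.trans (mul_le_mul_of_nonneg_right ?_ dist_nonneg)
  rcases Nat.eq_zero_or_pos m with rfl | hm
  · simp
  · have hm1 : (1 : ℝ) ≤ m := by exact_mod_cast hm
    simp only [Fintype.card_fin, NNReal.coe_rpow, NNReal.coe_natCast]
    exact (Real.rpow_le_rpow_of_exponent_le hm1 (by norm_num)).trans_eq (Real.rpow_one _)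

theorem dist_toLp_update {m : ℕ} (Y : Config d m) (j : Fin m) (w : Phase d) :
    dist (WithLp.toLp 2 (Function.update Y j w) : EConfig d m) (WithLp.toLp 2 Y) =
      dist w (Y j) := by
  rw [dist_eq_norm, ← WithLp.toLp_sub, dist_eq_norm]
  have : Function.update Y j w - Y = Pi.single j (w - Y j) := by
    funext i
    rcases eq_or_ne i j with rfl | h
    · simp
    · simp [h]
  rw [this]
  exact PiLp.norm_single 2 (fun _ : Fin m => Phase d) j (w - Y j)

theorem map_tensorPow (m : ℕ) [IsProbabilityMeasure ν] {X : Phase d → Phase d}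
    (hX : Measurable X) :
    tensorPow m (ν.map X) = (tensorPow m ν).map fun Y i => X (Y i) := by
  have := Measure.isProbabilityMeasure_map (μ := ν) hX.aemeasurable
  exact (Measure.pi_map_pi (fun _ => hX.aemeasurable)).symm

/-- Stability estimate for the tensor powers of the empirical measure. -/
theorem abs_integral_tensorPow_empirical_sub_le (hμ : IsWeakSolution K ν μ)
    (h0 : ∀ z z', K z z' + K z' z = 0)
    (h1 : ∀ z', LipschitzWith L (fun z => K z z'))
    (h2 : ∀ z, LipschitzWith L (fun z' => K z z')) (t : ℝ) {N : ℕ} (hN : 1 ≤ N) {m : ℕ}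
    {φ : EConfig d m → ℝ} {S : ℝ} (hS : ∀ x, |φ x| ≤ S) {Λ : ℝ≥0} (hφ : LipschitzWith Λ φ)
    {Z : Config d N} {U : ℝ} (hU : DualBound (empirical Z) ν U) :
    |(∫ Y, φ (WithLp.toLp 2 Y) ∂(tensorPow m (empirical (flow K N t Z))))
      - ∫ Y, φ (WithLp.toLp 2 Y) ∂(tensorPow m (μ t))| ≤
      m * Real.exp (2 * L * |t|) * Λ * U := by
  have hν : IsP1 ν := by simpa only [hμ.initial] using hμ.isP1 0
  have := hν.1
  obtain ⟨X, hXL, hXμ, hX⟩ := exists_flowMap hμ h0 h1 h2 t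
  have hdist := hX N hN Z U hU
  have hN' : (0 : ℝ) < N := by exact_mod_cast hN
  have hφc : Continuous fun Y : Config d m => φ (WithLp.toLp 2 Y) :=
    hφ.continuous.comp (PiLp.continuous_toLp 2 _)
  have hXc : Continuous fun (Y : Config d m) i => X (Y i) :=
    continuous_pi fun i => hXL.continuous.comp (continuous_apply i)
  -- First error: the atoms move from `z_k(t)` to `X(z_k)`. The second error `e2` compares
  -- `X`-images of two product measures and contributes `e^(L|t|) U`, which the subtracted
  -- exponential of the first compensates.
  have e1 : |(∫ Y, φ (WithLp.toLp 2 Y) ∂(tensorPow m (empirical (flow K N t Z))))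
      - ∫ Y, φ (WithLp.toLp 2 fun i => X (Y i)) ∂(tensorPow m (empirical Z))| ≤
      m * Λ * (U * (Real.exp (2 * L * |t|) - Real.exp (L * |t|))) := by
    rw [integral_tensorPow_empirical hN _ fun Y => φ (WithLp.toLp 2 Y),
      integral_tensorPow_empirical hN _ fun Y => φ (WithLp.toLp 2 fun i => X (Y i)), ← mul_sub,
      ← Finset.sum_sub_distrib, abs_mul, abs_of_nonneg (by positivity)]
    have hterm : ∀ ι : Fin m → Fin N, |φ (WithLp.toLp 2 fun i => flow K N t Z (ι i))
        - φ (WithLp.toLp 2 fun i => X (Z (ι i)))| ≤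
        m * Λ * (U * (Real.exp (2 * L * |t|) - Real.exp (L * |t|))) := fun ι => by
      rw [← Real.dist_eq]
      refine (hφ.dist_le_mul _ _).trans ?_
      have h3 : dist (fun i => flow K N t Z (ι i)) (fun i => X (Z (ι i))) ≤
          dist (flow K N t Z) (fun k => X (Z k)) :=
        (dist_pi_le_iff dist_nonneg).2 fun i =>
          dist_le_pi_dist (flow K N t Z) (fun k => X (Z k)) (ι i)
      calc Λ * dist (WithLp.toLp 2 fun i => flow K N t Z (ι i) : EConfig d m)
            (WithLp.toLp 2 fun i => X (Z (ι i)))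
          ≤ Λ * (m * (U * (Real.exp (2 * L * |t|) - Real.exp (L * |t|)))) := by
            refine mul_le_mul_of_nonneg_left ((dist_toLp_le _ _).trans ?_) Λ.2
            exact mul_le_mul_of_nonneg_left (h3.trans hdist) (Nat.cast_nonneg m)
        _ = _ := by ring
    calc ((N : ℝ)⁻¹) ^ m * |∑ ι : Fin m → Fin N, (φ (WithLp.toLp 2 fun i => flow K N t Z (ι i))
          - φ (WithLp.toLp 2 fun i => X (Z (ι i))))|
        ≤ ((N : ℝ)⁻¹) ^ m * ∑ _ι : Fin m → Fin N,
          m * Λ * (U * (Real.exp (2 * L * |t|) - Real.exp (L * |t|))) := by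
          gcongr
          exact (Finset.abs_sum_le_sum_abs _ _).trans (Finset.sum_le_sum fun ι _ => hterm ι)
      _ = _ := by
          simp only [Finset.sum_const, Finset.card_univ, Fintype.card_fun, Fintype.card_fin,
            nsmul_eq_mul, Nat.cast_pow]
          rw [← mul_assoc, ← mul_pow, inv_mul_cancel₀ hN'.ne', one_pow, one_mul]
  have e2 : |(∫ Y, φ (WithLp.toLp 2 fun i => X (Y i)) ∂(tensorPow m (empirical Z)))
      - ∫ Y, φ (WithLp.toLp 2 Y) ∂(tensorPow m (μ t))| ≤
      m * (Λ * Real.exp (L * |t|) * U) := by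
    have := isProbabilityMeasure_empirical hN Z
    rw [hXμ, map_tensorPow m hXL.continuous.measurable,
      integral_map hXc.aemeasurable hφc.aestronglyMeasurable]
    have := abs_integral_tensorPow_sub_le hU m (φ := fun Y => φ (WithLp.toLp 2 fun i => X (Y i)))
      (hφc.comp hXc) (fun Y => hS _) (C := Λ * (Real.exp (L * |t|)).toNNReal) fun Y j w => by
        have hup : (fun i => X (Function.update Y j w i)) =
            Function.update (fun i => X (Y i)) j (X w) := by
          funext i
          rcases eq_or_ne i j with rfl | h
          · simp
          · simp [h]
        rw [hup, ← Real.dist_eq]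
        refine (hφ.dist_le_mul _ _).trans ?_
        rw [dist_toLp_update, NNReal.coe_mul, mul_assoc]
        exact mul_le_mul_of_nonneg_left (hXL.dist_le_mul _ _) Λ.2
    rwa [NNReal.coe_mul, Real.coe_toNNReal _ (Real.exp_pos _).le] at this
  rw [abs_le] at e1 e2 ⊢
  constructor <;> linarith [e1.1, e1.2, e2.1, e2.2]

theorem integral_bind_tensorPow_empirical {N : ℕ} (hN : 1 ≤ N) {m : ℕ} {P : Measure (Config d N)}
    [IsProbabilityMeasure P] {T : Config d N → Config d N} (hT : Measurable T)
    {g : Config d m → ℝ} (hg : Continuous g) {S : ℝ} (hS : ∀ Y, |g Y| ≤ S) :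
    ∫ Y, g Y ∂(P.bind fun Z => tensorPow m (empirical (T Z))) =
      ∫ Z, ∫ Y, g Y ∂(tensorPow m (empirical (T Z))) ∂P := by
  have hm : ∀ ι : Fin m → Fin N, Measurable fun Z : Config d N => fun i => T Z (ι i) :=
    fun ι => by fun_prop
  have hm' : ∀ ι : Fin m → Fin N, Measurable fun (Z : Config d N) i => Z (ι i) :=
    fun ι => by fun_prop
  have : IsProbabilityMeasure (P.map T) := Measure.isProbabilityMeasure_map hT.aemeasurable
  have hpι : ∀ ι : Fin m → Fin N, IsProbabilityMeasure ((P.map T).map fun Z i => Z (ι i)) :=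
    fun ι => Measure.isProbabilityMeasure_map (hm' ι).aemeasurable
  have hi : ∀ ι : Fin m → Fin N, Integrable (fun Z => g fun i => T Z (ι i)) P := fun ι =>
    (integrable_const S).mono' (hg.measurable.comp (hm ι)).aestronglyMeasurable
      (ae_of_all _ fun Z => hS _)
  simp only [integral_tensorPow_empirical hN]
  rw [bind_tensorPow_empirical hN m P hT, integral_smul_measure,
    integral_finsetSum_measure fun ι _ => integrable_of_bounded hg hS, integral_const_mul,
    integral_finsetSum _ fun ι _ => hi ι]
  simp only [ENNReal.toReal_pow, ENNReal.toReal_inv, ENNReal.toReal_natCast, smul_eq_mul]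
  congr 1
  refine Finset.sum_congr rfl fun ι _ => ?_
  rw [integral_map (hm' ι).aemeasurable hg.aestronglyMeasurable,
    integral_map hT.aemeasurable (f := fun Z => g fun i => Z (ι i))
      (hg.measurable.comp (hm' ι)).aestronglyMeasurable]

theorem isSymmetric_law (h1 : ∀ z', LipschitzWith L (fun z => K z z'))
    (h2 : ∀ z, LipschitzWith L (fun z' => K z z')) {N : ℕ} (hN : 1 ≤ N)
    {P : Measure (Config d N)} (hP : IsSymmetric P) (t : ℝ) : IsSymmetric (law K P t) :=
  isSymmetric_map hP (measurable_flow h1 h2 hN t) (flow_comp_perm h1 h2 hN t)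

theorem isProbabilityMeasure_marginal {N m : ℕ} (hm : m ≤ N) (P : Measure (Config d N))
    [IsProbabilityMeasure P] : IsProbabilityMeasure (marginal m P) := by
  rw [marginal, dif_pos hm]
  exact Measure.isProbabilityMeasure_map
    (measurable_pi_lambda _ fun i => measurable_pi_apply _).aemeasurable

/-- The defect `1 - c` of (a) is paid twice, once as mass missing from the marginal and once as mass
of the remainder; this removes the `2` from `m (m-1) / (2N)`. -/
theorem abs_integral_marginal_sub_le (h1 : ∀ z', LipschitzWith L (fun z => K z z'))
    (h2 : ∀ z, LipschitzWith L (fun z' => K z z')) {N : ℕ} (hN : 1 ≤ N)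
    {P : Measure (Config d N)} [IsProbabilityMeasure P] (hP : IsSymmetric P) (t : ℝ) {m : ℕ}
    (hm : m ≤ N) {g : Config d m → ℝ} (hg : Continuous g) {S : ℝ} (hS : ∀ Y, |g Y| ≤ S) :
    |(∫ Y, g Y ∂(marginal m (law K P t)))
      - ∫ Z, ∫ Y, g Y ∂(tensorPow m (empirical (flow K N t Z))) ∂P| ≤
      S * ((m : ℝ) * ((m : ℝ) - 1) / (N : ℝ)) := by
  have hT := measurable_flow h1 h2 hN t
  have : IsProbabilityMeasure (law K P t) := Measure.isProbabilityMeasure_map hT.aemeasurable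
  have := isProbabilityMeasure_marginal hm (law K P t)
  obtain ⟨ρ, hR, hRm⟩ := exists_remainder hN m hT (isSymmetric_law h1 h2 hN hP t)
  have hb := one_sub_descFactorial_div_le hN m
  change _ = _ • marginal m (law K P t) + ρ at hR
  set c : ℝ := (N.descFactorial m : ℝ) / (N : ℝ) ^ m with hc
  have hc0 : 0 ≤ c := by positivity
  have hc1 : c ≤ 1 := by
    rw [hc, div_le_one (by have : (0 : ℝ) < N := (by exact_mod_cast hN); positivity)]
    exact_mod_cast Nat.descFactorial_le_pow N m
  have hRf : IsFiniteMeasure ρ := ⟨by rw [hRm]; exact ENNReal.ofReal_lt_top⟩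
  have hgM : |∫ Y, g Y ∂(marginal m (law K P t))| ≤ S := abs_integral_le_of_forall_abs_le hS
  have hgR : |∫ Y, g Y ∂ρ| ≤ S * (1 - c) := by
    have := norm_integral_le_of_norm_le_const (μ := ρ) (f := g) (ae_of_all _ hS)
    rwa [measureReal_def, hRm, ENNReal.toReal_ofReal (by linarith)] at this
  have hS0 : 0 ≤ S := (abs_nonneg _).trans hgM
  rw [← integral_bind_tensorPow_empirical hN hT hg hS, hR, integral_add_measure
    ((integrable_of_bounded hg hS).smul_measure ENNReal.ofReal_ne_top)
    (integrable_of_bounded hg hS), integral_smul_measure, ENNReal.toReal_ofReal hc0, smul_eq_mul]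
  set A := ∫ Y, g Y ∂(marginal m (law K P t))
  have e : A - (c * A + ∫ Y, g Y ∂ρ) = (1 - c) * A - ∫ Y, g Y ∂ρ := by ring
  rw [e]
  calc |(1 - c) * A - ∫ Y, g Y ∂ρ| ≤ |(1 - c) * A| + |∫ Y, g Y ∂ρ| := abs_sub _ _
    _ ≤ (1 - c) * S + S * (1 - c) := by
        refine add_le_add ?_ hgR
        rw [abs_mul, abs_of_nonneg (by linarith)]
        exact mul_le_mul_of_nonneg_left hgM (by linarith)
    _ = 2 * S * (1 - c) := by ring
    _ ≤ 2 * S * ((m : ℝ) * ((m : ℝ) - 1) / (2 * (N : ℝ))) := by gcongr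
    _ = _ := by field_simp

/-- Leaving `U` free serves (b) and (c) at once. No measurability of `U` is required, since it
appears only as an upper bound under a lower Lebesgue integral. -/
theorem abs_integral_marginal_sub_integral_tensorPow_le (hμ : IsWeakSolution K ν μ)
    (h0 : ∀ z z', K z z' + K z' z = 0)
    (h1 : ∀ z', LipschitzWith L (fun z => K z z'))
    (h2 : ∀ z, LipschitzWith L (fun z' => K z z')) (t : ℝ) {N : ℕ} (hN : 1 ≤ N)
    {P : Measure (Config d N)} [IsProbabilityMeasure P] (hP : IsSymmetric P) {m : ℕ} (hm : m ≤ N)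
    {φ : EConfig d m → ℝ} {S : ℝ} (hS : ∀ x, |φ x| ≤ S) {Λ : ℝ≥0} (hφ : LipschitzWith Λ φ)
    {U : Config d N → ℝ≥0∞} (hU : ∀ Z, U Z ≠ ⊤)
    (hUd : ∀ Z, DualBound (empirical Z) ν (U Z).toReal) (hUi : ∫⁻ Z, U Z ∂P ≠ ⊤) :
    |(∫ Z, φ (WithLp.toLp 2 Z) ∂(marginal m (law K P t)))
      - ∫ Z, φ (WithLp.toLp 2 Z) ∂(tensorPow m (μ t))| ≤
      S * ((m : ℝ) * ((m : ℝ) - 1) / (N : ℝ))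
        + m * Real.exp (2 * L * |t|) * Λ * (∫⁻ Z, U Z ∂P).toReal := by
  have hφc : Continuous fun Y : Config d m => φ (WithLp.toLp 2 Y) :=
    hφ.continuous.comp (PiLp.continuous_toLp 2 _)
  have hpt := (hμ.isP1 t).1
  have := isProbabilityMeasure_tensorPow m (μ t)
  have e1 := abs_integral_marginal_sub_le h1 h2 hN hP t hm hφc (fun Y => hS _)
  set a : Config d N → ℝ := fun Z =>
    ∫ Y, φ (WithLp.toLp 2 Y) ∂(tensorPow m (empirical (flow K N t Z))) with ha
  set B : ℝ := ∫ Y, φ (WithLp.toLp 2 Y) ∂(tensorPow m (μ t)) with hB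
  have hac : Continuous a := by
    have : a = fun Z => ((N : ℝ)⁻¹) ^ m * ∑ ι : Fin m → Fin N,
        φ (WithLp.toLp 2 fun i => flow K N t Z (ι i)) := by
      funext Z
      exact integral_tensorPow_empirical hN _ fun Y => φ (WithLp.toLp 2 Y)
    rw [this]
    have hf := (lipschitzWith_flow h1 h2 hN t).continuous
    refine continuous_const.mul (continuous_finsetSum _ fun ι _ => hφc.comp ?_)
    exact continuous_pi fun i => (continuous_apply (ι i)).comp hf
  have hai : Integrable a P := integrable_of_bounded hac fun Z => by
    have := isProbabilityMeasure_empirical hN (flow K N t Z)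
    have := isProbabilityMeasure_tensorPow m (empirical (flow K N t Z))
    exact abs_integral_le_of_forall_abs_le fun Y => hS _
  have hc0 : 0 ≤ m * Real.exp (2 * L * |t|) * Λ := by positivity
  have e2 : |(∫ Z, a Z ∂P) - B| ≤ m * Real.exp (2 * L * |t|) * Λ * (∫⁻ Z, U Z ∂P).toReal := by
    have hsub : (∫ Z, a Z ∂P) - B = ∫ Z, (a Z - B) ∂P := by
      rw [integral_sub hai (integrable_const _)]
      simp
    have hpt : ∀ Z, ‖a Z - B‖ₑ ≤ ENNReal.ofReal (m * Real.exp (2 * L * |t|) * Λ) * U Z := fun Z => by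
      rw [← ofReal_norm, ← ENNReal.ofReal_toReal (a := U Z) (hU Z), ← ENNReal.ofReal_mul hc0]
      exact ENNReal.ofReal_le_ofReal
        (abs_integral_tensorPow_empirical_sub_le hμ h0 h1 h2 t hN hS hφ (hUd Z))
    have hle : ‖∫ Z, (a Z - B) ∂P‖ₑ ≤
        ENNReal.ofReal (m * Real.exp (2 * L * |t|) * Λ) * ∫⁻ Z, U Z ∂P := by
      refine (enorm_integral_le_lintegral_enorm _).trans ?_
      rw [← lintegral_const_mul' _ _ ENNReal.ofReal_ne_top]
      exact lintegral_mono hpt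
    have := ENNReal.toReal_mono (ENNReal.mul_ne_top ENNReal.ofReal_ne_top hUi) hle
    rwa [ENNReal.toReal_mul, ENNReal.toReal_ofReal hc0, toReal_enorm, Real.norm_eq_abs,
      ← hsub] at this
  rw [abs_le] at e1 e2 ⊢
  constructor <;> linarith [e1.1, e1.2, e2.1, e2.2]

/-- `lip` is a supremum in `ℝ`, with value `0` when unbounded; the given Lipschitz constant excludes
that case. -/
theorem lipschitzWith_lip {X : Type*} [MetricSpace X] {φ : X → ℝ} {Λ : ℝ≥0}
    (hφ : LipschitzWith Λ φ) : LipschitzWith (lip φ).toNNReal φ := by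
  have hb : BddAbove (Set.range fun p : X × X => |φ p.1 - φ p.2| / dist p.1 p.2) := by
    refine ⟨Λ, ?_⟩
    rintro _ ⟨p, rfl⟩
    exact div_le_of_le_mul₀ dist_nonneg Λ.2 (hφ.dist_le_mul p.1 p.2)
  have h0 : 0 ≤ lip φ := Real.iSup_nonneg fun p => by positivity
  refine LipschitzWith.of_dist_le_mul fun x y => ?_
  rw [Real.coe_toNNReal _ h0]
  rcases eq_or_ne x y with rfl | hxy
  · simp
  · rw [← div_le_iff₀ (dist_pos.2 hxy)]
    exact le_ciSup hb (x, y)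

theorem abs_le_supNorm {X : Type*} {φ : X → ℝ} {B : ℝ} (hB : ∀ x, |φ x| ≤ B) (x : X) :
    |φ x| ≤ supNorm φ :=
  le_ciSup (f := fun x => |φ x|) ⟨B, by rintro _ ⟨y, rfl⟩; exact hB y⟩ x

end Propagation

/-! ### Mean discrepancy of the empirical measure of independent particles -/

section EmpiricalRate

variable {d : ℕ} {ν : Measure (Phase d)}

theorem measurableSet_dist_lt (ε : ℝ) : MeasurableSet {p : Phase d × Phase d | dist p.2 p.1 < ε} :=
  measurableSet_lt (by fun_prop) measurable_const

theorem measurable_measure_ball (ρ : Measure (Phase d)) [SFinite ρ] (ε : ℝ) :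
    Measurable fun z => ρ (Metric.ball z ε) :=
  measurable_measure_prodMk_left (measurableSet_dist_lt ε)

theorem volume_real_ball_pos {ε : ℝ} (hε : 0 < ε) :
    0 < volume.real (Metric.ball (0 : Phase d) ε) := by
  rw [measureReal_def]
  exact ENNReal.toReal_pos (Metric.measure_ball_pos _ _ hε).ne' measure_ball_lt_top.ne

/-- Averaging `g` over balls of radius `ε` changes it by at most `C ε`. By Fubini the integral of
the averages against `ρ` only sees the masses `ρ (ball z ε)`. Normalising `g 0 = 0` gives linear
growth, hence integrability. -/
theorem integral_smul_ball_and_bound {ρ : Measure (Phase d)} (hρ : IsP1 ρ) {C : ℝ≥0}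
    {g : Phase d → ℝ} (hg : LipschitzWith C g) (hg0 : g 0 = 0) {ε : ℝ} (hε : 0 < ε) :
    Integrable (fun z => g z * ρ.real (Metric.ball z ε)) ∧
      |(∫ x, g x ∂ρ) - (volume.real (Metric.ball (0 : Phase d) ε))⁻¹ *
        ∫ z, g z * ρ.real (Metric.ball z ε)| ≤ C * ε := by
  have hp := hρ.1
  set v := volume.real (Metric.ball (0 : Phase d) ε) with hv
  have hball : ∀ x : Phase d, volume.real (Metric.ball x ε) = v := fun x => by
    rw [hv, measureReal_def, measureReal_def, Measure.addHaar_ball_center]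
  have hv0 : 0 < v := volume_real_ball_pos hε
  have hgn : ∀ z, |g z| ≤ C * ‖z‖ := fun z => by
    simpa [hg0, Real.dist_eq] using hg.dist_le_mul z 0
  have hgi : ∀ x, IntegrableOn g (Metric.ball x ε) := fun x =>
    (hg.continuous.locallyIntegrable.integrableOn_isCompact
      (isCompact_closedBall x ε)).mono_set Metric.ball_subset_closedBall
  set F : Phase d × Phase d → ℝ :=
    {p : Phase d × Phase d | dist p.2 p.1 < ε}.indicator fun p => g p.2 with hF
  have hFm : AEStronglyMeasurable F (ρ.prod volume) :=
    ((hg.continuous.comp continuous_snd).measurable.indicator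
      (measurableSet_dist_lt ε)).aestronglyMeasurable
  have hF1 : ∀ x, (fun z => F (x, z)) = (Metric.ball x ε).indicator g := fun x => rfl
  have hF2 : ∀ z, (fun x => F (x, z)) = (Metric.ball z ε).indicator fun _ => g z := fun z => by
    funext x
    by_cases h : dist x z < ε
    · rw [Set.indicator_of_mem (Metric.mem_ball.2 h), hF, Set.indicator_of_mem]
      exact (dist_comm z x).trans_lt h
    · rw [Set.indicator_of_notMem (fun h' => h (Metric.mem_ball.1 h')), hF,
        Set.indicator_of_notMem]
      exact fun h' => h ((dist_comm x z).trans_lt h')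
  have hFi : Integrable F (ρ.prod volume) := by
    rw [integrable_prod_iff hFm]
    refine ⟨ae_of_all _ fun x => ?_, ?_⟩
    · rw [hF1]
      exact (hgi x).integrable_indicator measurableSet_ball
    · refine Integrable.mono' (g := fun x => (C * (‖x‖ + ε)) * v)
        (((hρ.2.add (integrable_const ε)).const_mul _).mul_const _) hFm.norm.integral_prod_right'
        (ae_of_all _ fun x => ?_)
      have e : ∀ z, ‖F (x, z)‖ = (Metric.ball x ε).indicator (fun z => ‖g z‖) z := fun z => by
        rw [show F (x, z) = (Metric.ball x ε).indicator g z from rfl, norm_indicator_eq_indicator_norm]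
      simp only [e]
      rw [integral_indicator measurableSet_ball, ← hball x]
      refine norm_setIntegral_le_of_norm_le_const measure_ball_lt_top fun z hz => ?_
      rw [norm_norm, Real.norm_eq_abs]
      refine (hgn z).trans (mul_le_mul_of_nonneg_left ?_ C.2)
      have := norm_sub_norm_le z x
      rw [← dist_eq_norm] at this
      linarith [Metric.mem_ball.1 hz]
  have e2 : ∀ z, ∫ x, F (x, z) ∂ρ = g z * ρ.real (Metric.ball z ε) := fun z => by
    rw [hF2, integral_indicator_const _ measurableSet_ball, smul_eq_mul, mul_comm]
  have e1 : ∀ x, ∫ z, F (x, z) = ∫ z in Metric.ball x ε, g z := fun x => by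
    rw [hF1, integral_indicator measurableSet_ball]
  have hi2 := hFi.integral_prod_right
  simp only [e2] at hi2
  have hi1 := hFi.integral_prod_left
  simp only [e1] at hi1
  have hsw : ∫ z, g z * ρ.real (Metric.ball z ε) =
      ∫ x, (∫ z in Metric.ball x ε, g z) ∂ρ := by
    calc ∫ z, g z * ρ.real (Metric.ball z ε) = ∫ z, (∫ x, F (x, z) ∂ρ) := by simp only [e2]
      _ = ∫ x, (∫ z, F (x, z)) ∂ρ :=
        (integral_integral_swap (f := fun x z => F (x, z)) hFi).symm
      _ = _ := by simp only [e1]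
  refine ⟨hi2, ?_⟩
  rw [hsw, ← integral_const_mul, ← integral_sub (hρ.integrable_of_lipschitz hg)
    (hi1.const_mul _)]
  refine abs_integral_le_of_forall_abs_le fun x => ?_
  have e3 : g x - v⁻¹ * ∫ z in Metric.ball x ε, g z =
      v⁻¹ * ∫ z in Metric.ball x ε, (g x - g z) := by
    have hc : IntegrableOn (fun _ => g x) (Metric.ball x ε) :=
      integrableOn_const measure_ball_lt_top.ne
    rw [integral_sub hc (hgi x), setIntegral_const, hball, smul_eq_mul]
    field_simp
  rw [e3, abs_mul, abs_of_pos (inv_pos.2 hv0), inv_mul_le_iff₀ hv0, mul_comm v, ← hball x, ← Real.norm_eq_abs]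
  refine norm_setIntegral_le_of_norm_le_const measure_ball_lt_top fun z hz => ?_
  rw [← dist_eq_norm]
  refine (hg.dist_le_mul x z).trans (mul_le_mul_of_nonneg_left ?_ C.2)
  rw [dist_comm]
  exact (Metric.mem_ball.1 hz).le

/-- The upper bound for the Lipschitz-dual distance of two measures obtained by averaging over
balls of radius `ε`. -/
noncomputable def ballDiscrepancy (μ ν : Measure (Phase d)) (ε : ℝ) : ℝ≥0∞ :=
  ENNReal.ofReal (2 * ε) + ENNReal.ofReal (volume.real (Metric.ball (0 : Phase d) ε))⁻¹ *
    ∫⁻ z, ENNReal.ofReal (‖z‖ * |μ.real (Metric.ball z ε) - ν.real (Metric.ball z ε)|)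

theorem integrable_norm_mul_ball_sub {μ ν : Measure (Phase d)} (hμ : IsP1 μ) (hν : IsP1 ν) {ε : ℝ}
    (hε : 0 < ε) : Integrable fun z : Phase d =>
      ‖z‖ * |μ.real (Metric.ball z ε) - ν.real (Metric.ball z ε)| := by
  have h1 := (integral_smul_ball_and_bound hμ lipschitzWith_one_norm norm_zero hε).1
  have h2 := (integral_smul_ball_and_bound hν lipschitzWith_one_norm norm_zero hε).1
  have := (h1.sub h2).abs
  refine this.congr (ae_of_all _ fun z => ?_)
  simp only [Pi.sub_apply]
  rw [← mul_sub, abs_mul, abs_norm]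

theorem ballDiscrepancy_ne_top {μ ν : Measure (Phase d)} (hμ : IsP1 μ) (hν : IsP1 ν) {ε : ℝ}
    (hε : 0 < ε) : ballDiscrepancy μ ν ε ≠ ⊤ :=
  ENNReal.add_ne_top.2 ⟨ENNReal.ofReal_ne_top, ENNReal.mul_ne_top ENNReal.ofReal_ne_top
    (integrable_norm_mul_ball_sub hμ hν hε).lintegral_lt_top.ne⟩

/-- Subtracting `g 0` is free between probability measures and bounds the test function by `C ‖z‖`,
the weight in the discrepancy. The term `2 ε` is one averaging error per measure. -/
theorem dualBound_ballDiscrepancy {μ ν : Measure (Phase d)} (hμ : IsP1 μ) (hν : IsP1 ν) {ε : ℝ}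
    (hε : 0 < ε) : DualBound μ ν (ballDiscrepancy μ ν ε).toReal := by
  intro C g hg
  have hμp := hμ.1
  have hνp := hν.1
  set v := volume.real (Metric.ball (0 : Phase d) ε) with hv
  have hv0 : 0 ≤ v := measureReal_nonneg
  have hi := integrable_norm_mul_ball_sub hμ hν hε
  have hU : (ballDiscrepancy μ ν ε).toReal = 2 * ε + v⁻¹ *
      ∫ z : Phase d, ‖z‖ * |μ.real (Metric.ball z ε) - ν.real (Metric.ball z ε)| := by
    rw [ballDiscrepancy, ENNReal.toReal_add ENNReal.ofReal_ne_top (ENNReal.mul_ne_top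
      ENNReal.ofReal_ne_top hi.lintegral_lt_top.ne), ENNReal.toReal_ofReal (by positivity),
      ENNReal.toReal_mul, ENNReal.toReal_ofReal (inv_nonneg.2 hv0),
      integral_eq_lintegral_of_nonneg_ae (ae_of_all _ fun z => by positivity)
        hi.aestronglyMeasurable]
  have hh : LipschitzWith C fun z => g z - g 0 := by
    simpa using hg.sub (LipschitzWith.const (g 0))
  have hhn : ∀ z, |g z - g 0| ≤ C * ‖z‖ := fun z => by
    simpa [Real.dist_eq] using hg.dist_le_mul z 0
  obtain ⟨hi1, hb1⟩ := integral_smul_ball_and_bound hμ hh (sub_self _) hε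
  obtain ⟨hi2, hb2⟩ := integral_smul_ball_and_bound hν hh (sub_self _) hε
  rw [integral_sub (hμ.integrable_of_lipschitz hg) (integrable_const _)] at hb1
  rw [integral_sub (hν.integrable_of_lipschitz hg) (integrable_const _)] at hb2
  simp only [integral_const, probReal_univ, one_smul, ← hv] at hb1 hb2
  have hb3 : |(∫ z, (g z - g 0) * μ.real (Metric.ball z ε))
      - ∫ z, (g z - g 0) * ν.real (Metric.ball z ε)| ≤
      C * ∫ z : Phase d, ‖z‖ * |μ.real (Metric.ball z ε) - ν.real (Metric.ball z ε)| := by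
    rw [← integral_sub hi1 hi2, ← integral_const_mul, ← Real.norm_eq_abs]
    refine norm_integral_le_of_norm_le (hi.const_mul _) (ae_of_all _ fun z => ?_)
    rw [← mul_sub, norm_mul, Real.norm_eq_abs, Real.norm_eq_abs, ← mul_assoc]
    exact mul_le_mul_of_nonneg_right (hhn z) (abs_nonneg _)
  have hb4 := mul_le_mul_of_nonneg_left hb3 (inv_nonneg.2 hv0)
  rw [← abs_of_nonneg (inv_nonneg.2 hv0), ← abs_mul, abs_of_nonneg (inv_nonneg.2 hv0),
    mul_sub] at hb4
  rw [hU]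
  rw [abs_le] at hb1 hb2 hb4 ⊢
  constructor <;> nlinarith [hb1.1, hb1.2, hb2.1, hb2.2, hb4.1, hb4.2]

theorem empirical_real_apply {N : ℕ} (Z : Config d N) {s : Set (Phase d)} (hs : MeasurableSet s) :
    (empirical Z).real s = ∑ k, s.indicator (fun _ => (N : ℝ)⁻¹) (Z k) := by
  rw [measureReal_def, empirical_apply Z hs, ENNReal.toReal_mul, ENNReal.toReal_sum, Finset.mul_sum]
  · refine Finset.sum_congr rfl fun k _ => ?_
    by_cases h : Z k ∈ s <;> simp [h]
  · intro k _
    by_cases h : Z k ∈ s <;> simp [h]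

/-- The mass of `s` is a mean of `N` independent indicators, so its variance is at most `1/N` times
that of a single one. -/
theorem integral_empirical_sub_sq_le [IsProbabilityMeasure ν] {N : ℕ} (hN : 1 ≤ N)
    {s : Set (Phase d)} (hs : MeasurableSet s) :
    ∫ Z, ((empirical Z).real s - ν.real s) ^ 2 ∂(tensorPow N ν) ≤ ν.real s / N := by
  have := isProbabilityMeasure_tensorPow N ν
  have hN' : (0 : ℝ) < N := by exact_mod_cast hN
  set X : Phase d → ℝ := s.indicator fun _ => (N : ℝ)⁻¹ with hX
  have hXm : Measurable X := measurable_const.indicator hs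
  have hXb : ∀ z, |X z| ≤ (N : ℝ)⁻¹ := fun z => by
    by_cases h : z ∈ s <;> simp [hX, h]
  have hXL : MemLp X 2 ν := MemLp.of_bound hXm.aestronglyMeasurable _ (ae_of_all _ hXb)
  have hvar := ProbabilityTheory.variance_sum_pi (μ := fun _ : Fin N => ν) (X := fun _ => X)
    (fun _ => hXL)
  have hS : (∑ i : Fin N, fun Z : Config d N => X (Z i)) = fun Z => (empirical Z).real s := by
    funext Z
    rw [empirical_real_apply Z hs, Finset.sum_apply]
  have hSm : Measurable fun Z : Config d N => (empirical Z).real s := by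
    simp only [empirical_real_apply _ hs]
    exact Finset.measurable_sum _ fun i _ => hXm.comp (measurable_pi_apply i)
  have hXi : ∫ z, X z ∂ν = (N : ℝ)⁻¹ * ν.real s := by
    rw [hX, integral_indicator_const _ hs, smul_eq_mul, mul_comm]
  have hmean : ∫ Z, (empirical Z).real s ∂(tensorPow N ν) = ν.real s := by
    simp only [empirical_real_apply _ hs]
    rw [integral_finsetSum]
    · have : ∀ i : Fin N, ∫ Z, X (Z i) ∂(tensorPow N ν) = (N : ℝ)⁻¹ * ν.real s := fun i => by
        rw [← hXi, tensorPow]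
        exact integral_comp_eval (μ := fun _ : Fin N => ν) hXm.aestronglyMeasurable
      rw [Finset.sum_congr rfl fun i _ => this i]
      simp only [Finset.sum_const, Finset.card_univ, Fintype.card_fin, nsmul_eq_mul]
      field_simp
    · intro i _
      exact (integrable_const (N : ℝ)⁻¹).mono'
        (hXm.comp (measurable_pi_apply i)).aestronglyMeasurable (ae_of_all _ fun Z => hXb _)
  rw [hS, ProbabilityTheory.variance_eq_integral hSm.aemeasurable] at hvar
  change ∫ Z, ((empirical Z).real s - ∫ W, (empirical W).real s ∂(tensorPow N ν)) ^ 2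
    ∂(tensorPow N ν) = _ at hvar
  rw [hmean] at hvar
  rw [hvar]
  have hle : ProbabilityTheory.variance X ν ≤ (N : ℝ)⁻¹ * ((N : ℝ)⁻¹ * ν.real s) := by
    refine (ProbabilityTheory.variance_le_expectation_sq hXm.aestronglyMeasurable).trans_eq ?_
    have : X ^ 2 = s.indicator fun _ => (N : ℝ)⁻¹ * (N : ℝ)⁻¹ := by
      funext z
      by_cases h : z ∈ s <;> simp [hX, h, sq]
    rw [this, integral_indicator_const _ hs, smul_eq_mul]
    ring
  calc ∑ _i : Fin N, ProbabilityTheory.variance X ν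
      ≤ ∑ _i : Fin N, (N : ℝ)⁻¹ * ((N : ℝ)⁻¹ * ν.real s) := Finset.sum_le_sum fun _ _ => hle
    _ = ν.real s / N := by
        simp only [Finset.sum_const, Finset.card_univ, Fintype.card_fin, nsmul_eq_mul]
        field_simp

/-- Young's inequality with weights turns the first-order deviation into a variance. The power `d +
1` makes the deterministic term integrable over `ℝ^d`, and forces the power `d + 3` on the other;
`κ` balances the two. -/
theorem lintegral_norm_mul_empirical_sub_le [IsProbabilityMeasure ν] {N : ℕ} (hN : 1 ≤ N)
    {s : Set (Phase d)} (hs : MeasurableSet s) {κ : ℝ} (hκ : 0 < κ) (z : Phase d) :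
    ∫⁻ Z, ENNReal.ofReal (‖z‖ * |(empirical Z).real s - ν.real s|) ∂(tensorPow N ν) ≤
      ENNReal.ofReal (κ / 2 * ((1 + ‖z‖) ^ (d + 1))⁻¹) +
        ENNReal.ofReal ((2 * κ * N)⁻¹ * ((1 + ‖z‖) ^ (d + 3) * ν.real s)) := by
  have := isProbabilityMeasure_tensorPow N ν
  have hN' : (0 : ℝ) < N := by exact_mod_cast hN
  set w : ℝ := 1 + ‖z‖ with hw
  have hw0 : 0 < w := by positivity
  have hzw : ‖z‖ ≤ w := by rw [hw]; linarith
  have hpt : ∀ x : ℝ, 0 ≤ x →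
      ‖z‖ * x ≤ κ / 2 * (w ^ (d + 1))⁻¹ + (2 * κ)⁻¹ * w ^ (d + 3) * x ^ 2 := fun x hx => by
    have h1 : ‖z‖ * x ≤ w * x := by gcongr
    refine h1.trans ?_
    have h2 : κ / 2 * (w ^ (d + 1))⁻¹ + (2 * κ)⁻¹ * w ^ (d + 3) * x ^ 2 - w * x =
        (κ - w ^ (d + 1) * w * x) ^ 2 / (2 * κ * w ^ (d + 1)) := by
      rw [show d + 3 = (d + 1) + 2 by ring, pow_add w (d + 1) 2]
      field_simp
      ring
    have h3 : 0 ≤ (κ - w ^ (d + 1) * w * x) ^ 2 / (2 * κ * w ^ (d + 1)) := by positivity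
    linarith
  have hSm : Measurable fun Z : Config d N => (empirical Z).real s := by
    simp only [empirical_real_apply _ hs]
    exact Finset.measurable_sum _ fun i _ =>
      (measurable_const.indicator hs).comp (measurable_pi_apply i)
  have hsq : Integrable (fun Z : Config d N => ((empirical Z).real s - ν.real s) ^ 2)
      (tensorPow N ν) := by
    refine (integrable_const (1 : ℝ)).mono' ((hSm.sub_const _).pow_const 2).aestronglyMeasurable
      (ae_of_all _ fun Z => ?_)
    have := isProbabilityMeasure_empirical hN Z
    have h1 : (empirical Z).real s ≤ 1 := measureReal_le_one
    have h2 : 0 ≤ (empirical Z).real s := measureReal_nonneg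
    have h3 : ν.real s ≤ 1 := measureReal_le_one
    have h4 : 0 ≤ ν.real s := measureReal_nonneg
    rw [Real.norm_of_nonneg (sq_nonneg _), sq_le_one_iff_abs_le_one, abs_le]
    constructor <;> linarith
  calc ∫⁻ Z, ENNReal.ofReal (‖z‖ * |(empirical Z).real s - ν.real s|) ∂(tensorPow N ν)
      ≤ ∫⁻ Z, ENNReal.ofReal (κ / 2 * (w ^ (d + 1))⁻¹ + (2 * κ)⁻¹ * w ^ (d + 3) *
          ((empirical Z).real s - ν.real s) ^ 2) ∂(tensorPow N ν) := by
        refine lintegral_mono fun Z => ENNReal.ofReal_le_ofReal ?_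
        have := hpt _ (abs_nonneg ((empirical Z).real s - ν.real s))
        rwa [sq_abs] at this
    _ = ENNReal.ofReal (κ / 2 * (w ^ (d + 1))⁻¹ + (2 * κ)⁻¹ * w ^ (d + 3) *
          ∫ Z, ((empirical Z).real s - ν.real s) ^ 2 ∂(tensorPow N ν)) := by
        have hi : Integrable (fun Z => κ / 2 * (w ^ (d + 1))⁻¹ + (2 * κ)⁻¹ * w ^ (d + 3) *
            ((empirical Z).real s - ν.real s) ^ 2) (tensorPow N ν) :=
          (integrable_const _).add (hsq.const_mul _)
        rw [← ofReal_integral_eq_lintegral_ofReal hi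
          (ae_of_all _ fun Z => by simp only [Pi.zero_apply]; positivity),
          integral_add (integrable_const _) (hsq.const_mul _), integral_const, probReal_univ, one_smul,
          integral_const_mul]
    _ ≤ ENNReal.ofReal (κ / 2 * (w ^ (d + 1))⁻¹ + (2 * κ * N)⁻¹ * (w ^ (d + 3) * ν.real s)) := by
        refine ENNReal.ofReal_le_ofReal (add_le_add le_rfl ?_)
        refine (mul_le_mul_of_nonneg_left (integral_empirical_sub_sq_le hN hs)
          (by positivity)).trans_eq ?_
        field_simp
    _ = _ := ENNReal.ofReal_add (by positivity) (by positivity)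

/-- Fubini moves the weight onto `ν`: on the ball around `x` one has `1 + ‖z‖ ≤ 2 + ‖x‖`, as `ε ≤
1`. -/
theorem lintegral_weight_mul_ball_le [IsProbabilityMeasure ν] {ε : ℝ} (hε1 : ε ≤ 1) (n : ℕ) :
    ∫⁻ z, ENNReal.ofReal ((1 + ‖z‖) ^ n * ν.real (Metric.ball z ε)) ≤
      volume (Metric.ball (0 : Phase d) ε) * ∫⁻ x, ENNReal.ofReal ((2 + ‖x‖) ^ n) ∂ν := by
  have hm : Measurable fun p : Phase d × Phase d =>
      {p : Phase d × Phase d | dist p.2 p.1 < ε}.indicator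
        (fun p => ENNReal.ofReal ((1 + ‖p.1‖) ^ n)) p :=
    Measurable.indicator (by fun_prop) (measurableSet_dist_lt ε)
  have e1 : ∀ z : Phase d, ENNReal.ofReal ((1 + ‖z‖) ^ n * ν.real (Metric.ball z ε)) =
      ∫⁻ x, {p : Phase d × Phase d | dist p.2 p.1 < ε}.indicator
        (fun p => ENNReal.ofReal ((1 + ‖p.1‖) ^ n)) (z, x) ∂ν := fun z => by
    have : (fun x => {p : Phase d × Phase d | dist p.2 p.1 < ε}.indicator
        (fun p => ENNReal.ofReal ((1 + ‖p.1‖) ^ n)) (z, x)) =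
        (Metric.ball z ε).indicator fun _ => ENNReal.ofReal ((1 + ‖z‖) ^ n) := rfl
    rw [this, lintegral_indicator_const measurableSet_ball, ENNReal.ofReal_mul (by positivity),
      ofReal_measureReal]
  simp only [e1]
  rw [lintegral_lintegral_swap hm.aemeasurable, ← lintegral_const_mul' _ _ measure_ball_lt_top.ne]
  refine lintegral_mono fun x => ?_
  have e2 : ∀ z, {p : Phase d × Phase d | dist p.2 p.1 < ε}.indicator
        (fun p => ENNReal.ofReal ((1 + ‖p.1‖) ^ n)) (z, x) ≤
      (Metric.ball x ε).indicator (fun _ => ENNReal.ofReal ((2 + ‖x‖) ^ n)) z := fun z => by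
    by_cases h : dist z x < ε
    · rw [Set.indicator_of_mem (show (z, x) ∈ {p : Phase d × Phase d | dist p.2 p.1 < ε} by
        simpa [dist_comm] using h), Set.indicator_of_mem (Metric.mem_ball.2 h)]
      refine ENNReal.ofReal_le_ofReal ?_
      have := norm_sub_norm_le z x
      rw [← dist_eq_norm] at this
      gcongr ?_ ^ n
      linarith
    · rw [Set.indicator_of_notMem (show (z, x) ∉ {p : Phase d × Phase d | dist p.2 p.1 < ε} by
        simpa [dist_comm] using h)]
      exact zero_le
  refine (lintegral_mono e2).trans ?_
  rw [lintegral_indicator_const measurableSet_ball, Measure.addHaar_ball_center, mul_comm]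

theorem measurable_ballDiscrepancy_integrand [IsProbabilityMeasure ν] (N : ℕ) (ε : ℝ) :
    Measurable fun p : Config d N × Phase d => ENNReal.ofReal
      (‖p.2‖ * |(empirical p.1).real (Metric.ball p.2 ε) - ν.real (Metric.ball p.2 ε)|) := by
  have h1 : Measurable fun p : Config d N × Phase d => (empirical p.1).real (Metric.ball p.2 ε) := by
    simp only [empirical_real_apply _ measurableSet_ball]
    refine Finset.measurable_sum _ fun k _ => ?_
    have hs : MeasurableSet {p : Config d N × Phase d | dist (p.1 k) p.2 < ε} :=
      measurableSet_lt (by fun_prop) measurable_const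
    exact (measurable_const (a := (N : ℝ)⁻¹)).indicator hs
  have h2 : Measurable fun p : Config d N × Phase d => ν.real (Metric.ball p.2 ε) :=
    (measurable_measure_ball ν ε).ennreal_toReal.comp measurable_snd
  exact (measurable_snd.norm.mul (h1.sub h2).abs).ennreal_ofReal

theorem integrable_inv_pow_one_add_norm (d : ℕ) :
    Integrable fun z : Phase d => ((1 + ‖z‖) ^ (d + 1))⁻¹ := by
  have := integrable_one_add_norm (E := Phase d) (μ := volume) (r := (d + 1 : ℕ)) (by simp)
  refine this.congr (ae_of_all _ fun z => ?_)
  simp only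
  rw [Real.rpow_neg (by positivity), Real.rpow_natCast]

/-- The mean discrepancy of the empirical measure of independent particles. -/
theorem lintegral_ballDiscrepancy_le [IsProbabilityMeasure ν] {N : ℕ} (hN : 1 ≤ N) {ε : ℝ}
    (hε : 0 < ε) (hε1 : ε ≤ 1) {M : ℝ} (hM0 : 0 ≤ M)
    (hM : ∫⁻ x, ENNReal.ofReal ((2 + ‖x‖) ^ (d + 3)) ∂ν ≤ ENNReal.ofReal M) :
    ∫⁻ Z, ballDiscrepancy (empirical Z) ν ε ∂(tensorPow N ν) ≤
      ENNReal.ofReal (2 * ε + ε / 2 * (∫ z : Phase d, ((1 + ‖z‖) ^ (d + 1))⁻¹)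
        + M / (2 * N * ε * volume.real (Metric.ball (0 : Phase d) ε))) := by
  have := isProbabilityMeasure_tensorPow N ν
  have hN' : (0 : ℝ) < N := by exact_mod_cast hN
  set v := volume.real (Metric.ball (0 : Phase d) ε) with hv
  set I := ∫ z : Phase d, ((1 + ‖z‖) ^ (d + 1))⁻¹ with hI
  have hI0 : 0 ≤ I := integral_nonneg fun z => by positivity
  have hv0 : 0 < v := volume_real_ball_pos hε
  -- With this `κ` the prefactor `v⁻¹` cancels in the first term, which becomes of order `ε` like
  -- the averaging error.
  set κ : ℝ := ε * v with hκ
  have hκ0 : 0 < κ := by positivity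
  have hmeas := measurable_ballDiscrepancy_integrand (ν := ν) N ε
  have hmain : ∫⁻ Z, (∫⁻ z, ENNReal.ofReal
      (‖z‖ * |(empirical Z).real (Metric.ball z ε) - ν.real (Metric.ball z ε)|))
      ∂(tensorPow N ν) ≤ ENNReal.ofReal (κ / 2 * I + (2 * κ * N)⁻¹ * (v * M)) := by
    rw [lintegral_lintegral_swap hmeas.aemeasurable]
    refine (lintegral_mono fun z =>
      lintegral_norm_mul_empirical_sub_le hN measurableSet_ball hκ0 z).trans ?_
    rw [lintegral_add_left (by fun_prop), ENNReal.ofReal_add (by positivity) (by positivity)]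
    refine add_le_add (le_of_eq ?_) ?_
    · rw [← ofReal_integral_eq_lintegral_ofReal
        ((integrable_inv_pow_one_add_norm d).const_mul _) (ae_of_all _ fun z => by
          simp only [Pi.zero_apply]; positivity), integral_const_mul]
    · have e : ∀ z : Phase d, ENNReal.ofReal ((2 * κ * N)⁻¹ *
          ((1 + ‖z‖) ^ (d + 3) * ν.real (Metric.ball z ε))) = ENNReal.ofReal (2 * κ * N)⁻¹ *
          ENNReal.ofReal ((1 + ‖z‖) ^ (d + 3) * ν.real (Metric.ball z ε)) := fun z =>
        ENNReal.ofReal_mul (by positivity)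
      simp only [e]
      rw [lintegral_const_mul' _ _ ENNReal.ofReal_ne_top, ENNReal.ofReal_mul (by positivity),
        ENNReal.ofReal_mul hv0.le, hv, ofReal_measureReal measure_ball_lt_top.ne]
      gcongr
      exact (lintegral_weight_mul_ball_le hε1 _).trans (by gcongr)
  have hsplit : ∫⁻ Z, ballDiscrepancy (empirical Z) ν ε ∂(tensorPow N ν) =
      ENNReal.ofReal (2 * ε) + ENNReal.ofReal v⁻¹ * ∫⁻ Z, (∫⁻ z, ENNReal.ofReal
        (‖z‖ * |(empirical Z).real (Metric.ball z ε) - ν.real (Metric.ball z ε)|))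
        ∂(tensorPow N ν) := by
    simp only [ballDiscrepancy]
    rw [lintegral_add_left measurable_const, lintegral_const_mul' _ _ ENNReal.ofReal_ne_top,
      lintegral_const, measure_univ, mul_one]
  rw [hsplit]
  calc ENNReal.ofReal (2 * ε) + ENNReal.ofReal v⁻¹ * ∫⁻ Z, (∫⁻ z, ENNReal.ofReal
        (‖z‖ * |(empirical Z).real (Metric.ball z ε) - ν.real (Metric.ball z ε)|))
        ∂(tensorPow N ν)
      ≤ ENNReal.ofReal (2 * ε) + ENNReal.ofReal v⁻¹ *
        ENNReal.ofReal (κ / 2 * I + (2 * κ * N)⁻¹ * (v * M)) := by gcongr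
    _ = _ := by
        rw [← ENNReal.ofReal_mul (by positivity), ← ENNReal.ofReal_add (by positivity)
          (by positivity)]
        congr 1
        rw [hκ]
        field_simp
        ring

end EmpiricalRate

/-! ### Choice of the averaging radius and the rate of statement (c) -/

section ChaosRate

variable {d : ℕ} {K : Phase d → Phase d → Phase d} {L : ℝ≥0} {ν : Measure (Phase d)}
  {μ : ℝ → Measure (Phase d)}

theorem isSymmetric_tensorPow (N : ℕ) (ν : Measure (Phase d)) [IsProbabilityMeasure ν] :
    IsSymmetric (tensorPow N ν) := by
  intro σ
  refine (Measure.pi_eq fun s hs => ?_).symm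
  rw [Measure.map_apply (by fun_prop) (MeasurableSet.univ_pi hs)]
  have : (fun (Z : Config d N) i => Z (σ i)) ⁻¹' Set.univ.pi s =
      Set.univ.pi fun i => s (σ.symm i) := by
    ext Z
    simp only [Set.mem_preimage, Set.mem_univ_pi]
    exact ⟨fun h i => by simpa using h (σ.symm i), fun h i => by simpa using h (σ i)⟩
  rw [this, tensorPow, Measure.pi_pi]
  exact Equiv.prod_comp σ.symm fun i => ν (s i)

theorem two_add_pow_le {r : ℝ} (hr : 0 ≤ r) (n : ℕ) :
    (2 + r) ^ (n + 3) ≤ 2 ^ (n + 5) * (2 ^ (n + 5) + r ^ (n + 5)) := by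
  calc (2 + r) ^ (n + 3) ≤ (2 + r) ^ (n + 5) :=
        pow_le_pow_right₀ (by linarith) (by omega)
    _ ≤ 2 ^ (n + 5 - 1) * (2 ^ (n + 5) + r ^ (n + 5)) := add_pow_le (by norm_num) hr _
    _ ≤ 2 ^ (n + 5) * (2 ^ (n + 5) + r ^ (n + 5)) := by
        gcongr
        · norm_num
        · omega

theorem lintegral_two_add_pow_density_le {g : Phase d → ℝ} (hg : IsP1Density g)
    (hm : Integrable fun z => ‖z‖ ^ (d + 5) * g z) :
    ∫⁻ x, ENNReal.ofReal ((2 + ‖x‖) ^ (d + 3)) ∂(density g) ≤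
      ENNReal.ofReal (2 ^ (d + 5) * (2 ^ (d + 5) + ∫ z, ‖z‖ ^ (d + 5) * g z)) := by
  have hi : Integrable fun z => 2 ^ (d + 5) * (2 ^ (d + 5) * g z + ‖z‖ ^ (d + 5) * g z) :=
    ((hg.1.const_mul _).add hm).const_mul _
  have e : ∫ z, 2 ^ (d + 5) * (2 ^ (d + 5) * g z + ‖z‖ ^ (d + 5) * g z) =
      2 ^ (d + 5) * (2 ^ (d + 5) + ∫ z, ‖z‖ ^ (d + 5) * g z) := by
    rw [integral_const_mul, integral_add (hg.1.const_mul _) hm, integral_const_mul, hg.2.2.1,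
      mul_one]
  rw [density, lintegral_withDensity_eq_lintegral_mul₀ hg.1.aemeasurable.ennreal_ofReal
    (by fun_prop), ← e, ofReal_integral_eq_lintegral_ofReal hi]
  · refine lintegral_mono_ae ?_
    filter_upwards [hg.2.1] with z hz
    rw [Pi.mul_apply, ← ENNReal.ofReal_mul hz]
    refine ENNReal.ofReal_le_ofReal ?_
    rw [← add_mul, ← mul_assoc, mul_comm]
    exact mul_le_mul_of_nonneg_right (two_add_pow_le (norm_nonneg z) d) hz
  · filter_upwards [hg.2.1] with z hz
    have : (0 : ℝ) ≤ g z := hz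
    simp only [Pi.zero_apply]
    positivity

/-- The constant of the rate of propagation of chaos, as a function of the moment of order
`d + 5` of the initial density. -/
noncomputable def chaosConstant (d : ℕ) (a : ℝ) : ℝ :=
  2 + (∫ z : Phase d, ((1 + ‖z‖) ^ (d + 1))⁻¹) / 2 +
    2 ^ (d + 5) * (2 ^ (d + 5) + a) / (2 * volume.real (Metric.ball (0 : Phase d) 1))

theorem chaosConstant_nonneg (d : ℕ) {a : ℝ} (ha : 0 ≤ a) : 0 ≤ chaosConstant d a := by
  have h : 0 ≤ ∫ z : Phase d, ((1 + ‖z‖) ^ (d + 1))⁻¹ := integral_nonneg fun z => by positivity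
  unfold chaosConstant
  positivity

theorem moment_nonneg {g : Phase d → ℝ} (hg : IsP1Density g) (n : ℕ) :
    0 ≤ ∫ z, ‖z‖ ^ n * g z := by
  refine integral_nonneg_of_ae ?_
  filter_upwards [hg.2.1] with z hz
  have : (0 : ℝ) ≤ g z := hz
  simp only [Pi.zero_apply]
  positivity

theorem volume_real_ball_eq {ε : ℝ} (hε : 0 < ε) : volume.real (Metric.ball (0 : Phase d) ε) =
    ε ^ d * volume.real (Metric.ball (0 : Phase d) 1) := by
  rw [measureReal_def, measureReal_def, Measure.addHaar_ball_of_pos _ _ hε, ENNReal.toReal_mul,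
    ENNReal.toReal_ofReal (by positivity), finrank_euclideanSpace_fin]

/-- Since `N ε^(d+4) = 1`, the variance term is `A / (2v) * ε^3`; the spare factor `ε^2 ≤ 1` is
given away. -/
theorem rate_le {N : ℕ} (hN : 1 ≤ N) {a : ℝ} (ha : 0 ≤ a) {ε : ℝ}
    (hε : ε = ((N : ℝ) ^ ((1 : ℝ) / ((d : ℝ) + 4)))⁻¹) : 0 < ε ∧ ε ≤ 1 ∧
    2 * ε + ε / 2 * (∫ z : Phase d, ((1 + ‖z‖) ^ (d + 1))⁻¹) + 2 ^ (d + 5) * (2 ^ (d + 5) + a) /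
      (2 * N * ε * volume.real (Metric.ball (0 : Phase d) ε)) ≤ chaosConstant d a * ε := by
  have hN1 : (1 : ℝ) ≤ N := by exact_mod_cast hN
  have hN0 : (0 : ℝ) < N := by linarith
  have hε0 : 0 < ε := by rw [hε]; positivity
  have hε1 : ε ≤ 1 := by
    rw [hε]
    exact inv_le_one_of_one_le₀ (Real.one_le_rpow hN1 (by positivity))
  have hNε : (N : ℝ) * ε ^ (d + 4) = 1 := by
    rw [hε, inv_pow, ← Real.rpow_natCast, ← Real.rpow_mul hN0.le]
    have : (1 : ℝ) / ((d : ℝ) + 4) * ((d + 4 : ℕ) : ℝ) = 1 := by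
      push_cast
      field_simp
    rw [this, Real.rpow_one]
    field_simp
  refine ⟨hε0, hε1, ?_⟩
  have hv := volume_real_ball_pos (d := d) one_pos
  rw [volume_real_ball_eq hε0, chaosConstant]
  set v := volume.real (Metric.ball (0 : Phase d) 1)
  set A : ℝ := 2 ^ (d + 5) * (2 ^ (d + 5) + a)
  have hA : 0 ≤ A := by positivity
  have e : A / (2 * N * ε * (ε ^ d * v)) = A / (2 * v) * ε ^ 3 := by
    rw [div_mul_eq_mul_div, div_eq_div_iff (by positivity) (by positivity)]
    linear_combination (-A * 2 * v) * hNε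
  have h3 : A / (2 * v) * ε ^ 3 ≤ A / (2 * v) * ε :=
    mul_le_mul_of_nonneg_left (pow_le_of_le_one hε0.le hε1 (by norm_num)) (by positivity)
  rw [e]
  linarith

theorem lintegral_ballDiscrepancy_tensorPow_le {g : Phase d → ℝ} (hg : IsP1Density g)
    (hm : Integrable fun z => ‖z‖ ^ (d + 5) * g z) [IsProbabilityMeasure (density g)]
    {N : ℕ} (hN : 1 ≤ N) {ε : ℝ} (hε : ε = ((N : ℝ) ^ ((1 : ℝ) / ((d : ℝ) + 4)))⁻¹) :
    ∫⁻ Z, ballDiscrepancy (empirical Z) (density g) ε ∂(tensorPow N (density g)) ≤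
      ENNReal.ofReal (chaosConstant d (∫ z, ‖z‖ ^ (d + 5) * g z) * ε) := by
  have ha := moment_nonneg hg (d + 5)
  obtain ⟨h1, h2, h3⟩ := rate_le (d := d) hN ha hε
  exact (lintegral_ballDiscrepancy_le hN h1 h2 (by positivity)
    (lintegral_two_add_pow_density_le hg hm)).trans (ENNReal.ofReal_le_ofReal h3)

/-- For independent particles `(z_k(t), X(z_k))` has the first marginal of the law and `ν.map X = μ
t` as its two marginals, so it is an admissible coupling, and its cost is bounded pointwise by
Dobrushin's estimate. -/
theorem distMK_marginal_one_le (hμ : IsWeakSolution K ν μ)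
    (h0 : ∀ z z', K z z' + K z' z = 0)
    (h1 : ∀ z', LipschitzWith L (fun z => K z z'))
    (h2 : ∀ z, LipschitzWith L (fun z' => K z z')) (t : ℝ) {N : ℕ} (hN : 1 ≤ N)
    {U : Config d N → ℝ≥0∞} (hU : ∀ Z, U Z ≠ ⊤)
    (hUd : ∀ Z, DualBound (empirical Z) ν (U Z).toReal) :
    distMK ((marginal 1 (law K (tensorPow N ν) t)).map fun Z => Z 0) (μ t) ≤
      ENNReal.ofReal (Real.exp (2 * L * |t|)) * ∫⁻ Z, U Z ∂(tensorPow N ν) := by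
  have hν : IsP1 ν := by simpa only [hμ.initial] using hμ.isP1 0
  have := hν.1
  have := isProbabilityMeasure_tensorPow N ν
  obtain ⟨X, hXL, hXμ, hXd⟩ := exists_flowMap hμ h0 h1 h2 t
  have hXm : Measurable X := hXL.continuous.measurable
  have hTm := measurable_flow h1 h2 hN t
  set k : Fin N := Fin.castLE hN 0
  have hπm : Measurable fun Z : Config d N => (flow K N t Z k, X (Z k)) :=
    ((measurable_pi_apply k).comp hTm).prodMk (hXm.comp (measurable_pi_apply k))
  have hπ : (tensorPow N ν).map (fun Z => (flow K N t Z k, X (Z k))) ∈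
      couplings ((marginal 1 (law K (tensorPow N ν) t)).map fun Z => Z 0) (μ t) := by
    refine ⟨Measure.isProbabilityMeasure_map hπm.aemeasurable, ?_, ?_⟩
    · rw [Measure.map_map measurable_fst hπm, marginal, dif_pos hN, law,
        Measure.map_map (by fun_prop) hTm,
        Measure.map_map (measurable_pi_apply _) (by fun_prop)]
      rfl
    · rw [Measure.map_map measurable_snd hπm, hXμ]
      conv_rhs => rw [← (measurePreserving_eval (fun _ : Fin N => ν) k).map_eq,
        Measure.map_map hXm (measurable_pi_apply k)]
      rfl
  refine (iInf₂_le _ hπ).trans ?_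
  rw [lintegral_map (by fun_prop) hπm, ← lintegral_const_mul' _ _ ENNReal.ofReal_ne_top]
  refine lintegral_mono fun Z => ?_
  have h3 := (dist_le_pi_dist (flow K N t Z) (fun k => X (Z k)) k).trans
    (hXd N hN Z _ (hUd Z))
  have h4 : (U Z).toReal * (Real.exp (2 * L * |t|) - Real.exp (L * |t|)) ≤
      Real.exp (2 * L * |t|) * (U Z).toReal := by
    nlinarith [Real.exp_pos (L * |t|), ENNReal.toReal_nonneg (a := U Z)]
  rw [edist_dist]
  refine (ENNReal.ofReal_le_ofReal (h3.trans h4)).trans_eq ?_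
  rw [ENNReal.ofReal_mul (Real.exp_pos _).le, ENNReal.ofReal_toReal (hU Z)]

theorem lip_nonneg {X : Type*} [MetricSpace X] (φ : X → ℝ) : 0 ≤ lip φ :=
  Real.iSup_nonneg fun _ => by positivity

end ChaosRate

end MeanField

/-! ### Assembly of the three statements -/

theorem mainTheorem3 (d : ℕ) :
    -- the constant `C(a, d)` depends on nothing but `a` and `d`
    ∃ C : ℝ → ℝ,
    ∀ (K : Phase d → Phase d → Phase d) (L : ℝ≥0),
      (∀ z z', K z z' + K z' z = 0) →
      (∀ z', LipschitzWith L (fun z => K z z')) →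
      (∀ z, LipschitzWith L (fun z' => K z z')) →
      -- statements (a) and (b)
      (∀ (N : ℕ), 1 ≤ N → ∀ Pin : Measure (Config d N), IsP1 Pin → IsSymmetric Pin →
        (∀ (t : ℝ) (m : ℕ), 1 ≤ m →
          ∃ R : Measure (Config d m),
            Pin.bind (fun Z => tensorPow m (empirical (flow K N t Z)))
              = ENNReal.ofReal ((N.descFactorial m : ℝ) / (N : ℝ) ^ m)
                  • marginal m (law K Pin t) + R ∧
            R Set.univ = ENNReal.ofReal (1 - (N.descFactorial m : ℝ) / (N : ℝ) ^ m) ∧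
            1 - (N.descFactorial m : ℝ) / (N : ℝ) ^ m ≤ (m : ℝ) * ((m : ℝ) - 1) / (2 * (N : ℝ))) ∧
        (∀ (fin : Phase d → ℝ) (f : ℝ → Phase d → ℝ),
          IsP1Density fin → IsVlasovSolution K fin f →
          ∀ (t : ℝ) (m : ℕ), 1 ≤ m → m ≤ N →
          ∀ φ : EConfig d m → ℝ, (∃ B : ℝ, ∀ x, |φ x| ≤ B) → (∃ Λ : ℝ≥0, LipschitzWith Λ φ) →
            |(∫ Z, φ (WithLp.toLp 2 Z) ∂(marginal m (law K Pin t)))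
                - ∫ Z, φ (WithLp.toLp 2 Z) ∂(tensorPow m (density (f t)))|
              ≤ supNorm φ * ((m : ℝ) * ((m : ℝ) - 1) / (N : ℝ))
                + (m : ℝ) * Real.exp (2 * (L : ℝ) * |t|) * lip φ
                  * (∫⁻ Z, distMK (empirical Z) (density fin) ∂Pin).toReal)) ∧
      -- statement (c)
      (∀ (fin : Phase d → ℝ) (f : ℝ → Phase d → ℝ),
        IsP1Density fin → IsVlasovSolution K fin f →
        Integrable (fun z => ‖z‖ ^ (d + 5) * fin z) →
        ∀ (t : ℝ) (N : ℕ), 1 ≤ N →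
          (∀ m : ℕ, 1 ≤ m → m ≤ N →
            normWNegOneOne (marginal m (law K (tensorPow N (density fin)) t))
                (tensorPow m (density (f t)))
              ≤ ENNReal.ofReal ((m : ℝ) * (((m : ℝ) - 1) / (N : ℝ)
                  + Real.exp (2 * (L : ℝ) * |t|)
                    * (C (∫ z, ‖z‖ ^ (d + 5) * fin z)
                        / (N : ℝ) ^ ((1 : ℝ) / ((d : ℝ) + 4)))))) ∧
          distMK ((marginal 1 (law K (tensorPow N (density fin)) t)).map (fun Z => Z 0))
              (density (f t))
            ≤ ENNReal.ofReal (C (∫ z, ‖z‖ ^ (d + 5) * fin z)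
                * Real.exp (2 * (L : ℝ) * |t|) / (N : ℝ) ^ ((1 : ℝ) / ((d : ℝ) + 4)))) := by
  refine ⟨chaosConstant d, fun K L h0 h1 h2 => ⟨fun N hN Pin hPin hsym => ⟨?_, ?_⟩, ?_⟩⟩
  · intro t m _
    have := hPin.1
    obtain ⟨R, hR, hR1⟩ := exists_remainder hN m (measurable_flow h1 h2 hN t)
      (isSymmetric_law h1 h2 hN hsym t)
    exact ⟨R, hR, hR1, one_sub_descFactorial_div_le hN m⟩
  · rintro fin f hfin ⟨-, hμ⟩ t m - hm φ ⟨B, hB⟩ ⟨Λ, hΛ⟩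
    have := hPin.1
    have hν : IsP1 (density fin) := by simpa only [hμ.initial] using hμ.isP1 0
    have h := abs_integral_marginal_sub_integral_tensorPow_le hμ h0 h1 h2 t hN hsym hm
      (abs_le_supNorm hB) (lipschitzWith_lip hΛ)
      (fun Z => distMK_ne_top (isP1_empirical hN Z) hν)
      (fun Z => dualBound_distMK (isP1_empirical hN Z) hν)
      (lintegral_distMK_empirical_ne_top hN hPin hν)
    rwa [Real.coe_toNNReal _ (lip_nonneg φ)] at h
  · rintro fin f hfin ⟨-, hμ⟩ hmom t N hN
    have hν : IsP1 (density fin) := by simpa only [hμ.initial] using hμ.isP1 0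
    have := hν.1
    have := isProbabilityMeasure_tensorPow N (density fin)
    set a := ∫ z, ‖z‖ ^ (d + 5) * fin z
    obtain ⟨ε, hε⟩ : ∃ ε, ε = ((N : ℝ) ^ ((1 : ℝ) / ((d : ℝ) + 4)))⁻¹ := ⟨_, rfl⟩
    have hN' : (0 : ℝ) < N := by exact_mod_cast hN
    have hε0 : 0 < ε := by rw [hε]; positivity
    have hrate := lintegral_ballDiscrepancy_tensorPow_le hfin hmom hN hε
    have hUne : ∀ Z : Config d N, ballDiscrepancy (empirical Z) (density fin) ε ≠ ⊤ :=
      fun Z => ballDiscrepancy_ne_top (isP1_empirical hN Z) hν hε0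
    have hUd : ∀ Z : Config d N, DualBound (empirical Z) (density fin)
        (ballDiscrepancy (empirical Z) (density fin) ε).toReal :=
      fun Z => dualBound_ballDiscrepancy (isP1_empirical hN Z) hν hε0
    have hC0 : 0 ≤ chaosConstant d a := chaosConstant_nonneg d (moment_nonneg hfin (d + 5))
    refine ⟨fun m hm1 hm => iSup_le fun φ => iSup₂_le fun hφ1 hφL => ENNReal.ofReal_le_ofReal ?_, ?_⟩
    · have h := abs_integral_marginal_sub_integral_tensorPow_le hμ h0 h1 h2 t hN
        (isSymmetric_tensorPow N (density fin)) hm hφ1 hφL hUne hUd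
        (ne_top_of_le_ne_top ENNReal.ofReal_ne_top hrate)
      refine h.trans ?_
      have hr := ENNReal.toReal_mono ENNReal.ofReal_ne_top hrate
      rw [ENNReal.toReal_ofReal (by positivity)] at hr
      rw [NNReal.coe_one, mul_one, one_mul, mul_add, ← mul_div_assoc, mul_assoc (m : ℝ),
        div_eq_mul_inv (chaosConstant d a), ← hε]
      gcongr
    · refine (distMK_marginal_one_le hμ h0 h1 h2 t hN hUne hUd).trans ?_
      refine (mul_le_mul_right hrate _).trans_eq ?_
      rw [← ENNReal.ofReal_mul (Real.exp_pos _).le, hε]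
      congr 1
      ring
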